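/- **Setting.** Let $d,r\ge 1$. Let $(X,Y)$ have law $P$ on $[0,1]^d\times\mathbb R$, with arbitrary marginal law $P_X$ of $X$ and regular conditional law $P_{Y\mid X=x}$, and let $\mu_0(x,\tau)=\inf\{y:\ P(Y\le y\mid X=x)\ge\tau\}$ be the conditional quantile function. Let $\tau_1,\dots,\tau_r\in(0,1)$ be the quantile levels used in the augmentation (drawn once from $\mathcal U(0,1)$ and then held fixed; the result holds for every choice). Assume: 1. $\mu_0$ is $\nu$-Hölder on $[0,1]^d\times(0,1)$ for some $0<\nu\le 1$. 2. For every $x\in[0,1]^d$ the law $P_{Y\mid X=x}$ has a Lebesgue density $\pi(\cdot\mid x)$, and there are constants $\delta>0$ and $0<\alpha\le A<\infty$ with $\alpha<\pi(y\mid x)\le A$ for all $x\in[0,1]^d$, all $j\le r$ and all $y$ with $|y-\mu_0(x,\tau_j)|<\delta$. **Prior.** Given data $\mathcal D_n=(X_i,Y_i)_{i\le n}$, consider the augmented design with the $nr$ rows $(X_i,\tau_j)\in[0,1]^{d+1}$. A *tree partition* of $[0,1]^{d+1}$ arises from the whole cube by successive splits of one cell $\Omega$ into $\Omega\cap\{x_k\le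 c\}$ and $\Omega\cap\{x_k>c\}$, where $c$ is an observed value of the $k$-th coordinate in the augmented design; it is *valid* if every cell contains at least $C^2$ rows of the design ($C\ge1$ a fixed integer). For $S\subseteq\{1,\dots,d+1\}$ and $K\ge1$ let $\mathcal V_S^K$ be the set of valid tree partitions with $K$ cells that split exactly the coordinates in $S$. With fixed $a,c,\lambda_0,\sigma^2>0$, a pair $(S,K)$ with $\mathcal V_S^K\neq\emptyset$ is drawn with probability proportional to $$c^{-|S|}(d+1)^{-a|S|}\binom{d+1}{|S|}^{-1}\frac{\lambda_0^K}{(e^{\lambda_0}-1)K!},$$ then a partition $\{\Omega_k\}_{k\le K}$ uniformly from $\mathcal V_S^K$, then independent heights $\beta_k\sim N(0,\sigma^2)$; the random function is $\mu=\sum_k\beta_k 1_{\Omega_k}$, viewed as a function $\mu(x,\tau)$. The prior $\pi_n$ is the law of $\mu$ conditioned on $\|\mu\|_\infty\le\log^p n$, for a fixed $p>0$. **Posterior.** With the check loss $\rho_\tau(u)=u(\tau-1\{u<0\})$ and a learning rate $\omega_n$, the IQ-BART Gibbs posterior is the probability measure $$\Pi_n^{(r)}(d\mu\mid\mathcal D_n)\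 \propto\ \exp\Big\{-\omega_n\sum_{i=1}^n\sum_{j=1}^r\rho_{\tau_j}\big(Y_i-\mu(X_i,\tau_j)\big)\Big\}\,\pi_n(d\mu).$$ Suppose that, for all large $n$, $c_0\log^{-2p}n\le\omega_n<\tfrac12\log^{-2p}n$, for some constant $c_0>0$. **Theorem.** Let $\|\mu-\mu_0\|_{2,\boldsymbol\tau}=\frac1r\sum_{j=1}^r\|\mu(\cdot,\tau_j)-\mu_0(\cdot,\tau_j)\|_{L^2(P_X)}$ and $\varepsilon_n=n^{-\nu/(2\nu+d+1)}\log^{2p+1/2}n$. Then for all large $n$ the posterior is well defined (a probability measure) for almost every sample of $n$ independent draws from $P$, and for every sequence $M_n\to\infty$ $$P^n\,\Pi_n^{(r)}\big(\{\mu:\ \|\mu-\mu_0\|_{2,\boldsymbol\tau}>M_n\varepsilon_n\}\,\big|\,\mathcal D_n\big)\longrightarrow 0\qquad(n\to\infty),$$ where $P^n$ denotes expectation over $n$ independent draws $(X_i,Y_i)\sim P$. -/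

import Mathlib

open MeasureTheory ProbabilityTheory Filter
open scoped NNReal ENNReal Topology

namespace IQBART

noncomputable section

/-! ### Quantiles and the check loss -/

/-- The `τ`-quantile `inf {y | τ ≤ F(y)}` of a law `ρ` on the real line
(for a probability measure and `0 < τ < 1` the set is nonempty and bounded below). -/
def quantile (ρ : Measure ℝ) (τ : ℝ) : ℝ :=
  sInf {y : ℝ | τ ≤ ρ.real (Set.Iic y)}

/-- The conditional quantile function `μ₀(x, τ)` of a regular conditional law `κ` of `Y`
given `X`. -/
def condQuantile {d : ℕ} (κ : Kernel (Fin d → ℝ) ℝ) (x : Fin d → ℝ) (τ : ℝ) : ℝ :=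
  quantile (κ x) τ

/-- The check loss `ρ_τ(u) = u (τ - 1{u < 0})`. -/
def checkLoss (τ u : ℝ) : ℝ :=
  u * (τ - if u < 0 then 1 else 0)

/-- The unit cube `[0,1]^m`. -/
def unitCube (m : ℕ) : Set (Fin m → ℝ) :=
  Set.Icc 0 1

/-! ### Tree-structured step functions -/

/-- `IsTreePartition obs S P`: the family of cells `P` is obtained from the single cell `[0,1]^m`
by successive axis-parallel binary splits `{x_j ≤ c}`, `{x_j > c}` of one cell, where `c` is one
of the observed values `obs j` of the `j`-th coordinate, and `S` is exactly the set of the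
coordinates that have been split at least once. -/
inductive IsTreePartition {m : ℕ} (obs : Fin m → Set ℝ) :
    Finset (Fin m) → Set (Set (Fin m → ℝ)) → Prop
  | root : IsTreePartition obs ∅ {unitCube m}
  | split {S : Finset (Fin m)} {P : Set (Set (Fin m → ℝ))} (h : IsTreePartition obs S P)
      {Ω : Set (Fin m → ℝ)} (hΩ : Ω ∈ P) (j : Fin m) {c : ℝ} (hc : c ∈ obs j) :
      IsTreePartition obs (insert j S) ((P \ {Ω}) ∪ {Ω ∩ {x | x j ≤ c}, Ω ∩ {x | c < x j}})

/-- The parameters of a step function on `ℝ^m`: a finite family of cells and one height per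
cell. -/
abbrev StepParam (m : ℕ) : Type :=
  Σ T : Finset (Set (Fin m → ℝ)), (T → ℝ)

/-- The step function `∑_k β_k 1{x ∈ Ω_k}`. -/
def stepFun {m : ℕ} (θ : StepParam m) (x : Fin m → ℝ) : ℝ :=
  ∑ Ω : θ.1, (Ω : Set (Fin m → ℝ)).indicator (fun _ => θ.2 Ω) x

/-- A step function on `[0,1]^(d+1)` as a function of the covariate `x` and of the quantile
level `t`, which is the last coordinate. -/
def stepQuantile {d : ℕ} (θ : StepParam (d + 1)) (x : Fin d → ℝ) (t : ℝ) : ℝ :=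
  stepFun θ (Fin.snoc x t : Fin (d + 1) → ℝ)

/-! ### The augmented design -/

/-- A sample of size `n` of pairs (covariate, response). -/
abbrev Sample (d n : ℕ) : Type :=
  Fin n → (Fin d → ℝ) × ℝ

/-- The rows `(X_i, τ_j)` of the augmented design. -/
def designPoint {d n r : ℕ} (D : Sample d n) (τ : Fin r → ℝ) (ij : Fin n × Fin r) :
    Fin (d + 1) → ℝ :=
  Fin.snoc (D ij.1).1 (τ ij.2)

/-- The observed values of the `k`-th coordinate in the augmented design. -/
def observed {d n r : ℕ} (D : Sample d n) (τ : Fin r → ℝ) (k : Fin (d + 1)) : Set ℝ :=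
  Set.range fun ij : Fin n × Fin r => designPoint D τ ij k

/-- The hyperparameters of the tree prior: each cell has to contain at least `C²` rows of the
design; the number of active coordinates has prior weights `∝ c^(-q) (d+1)^(-a q)`; the number of
leaves is a Poisson variable with mean `rate`, conditioned on being at least one; the leaf heights
are independent centred Gaussian variables with variance `variance`. -/
structure PriorParams where
  C : ℕ
  C_pos : 0 < C
  a : ℝ
  a_pos : 0 < a
  c : ℝ
  c_pos : 0 < c
  rate : ℝ
  rate_pos : 0 < rate
  variance : ℝ≥0
  variance_pos : 0 < variance

/-- The valid tree partitions with `K` leaves that split exactly the coordinates in `S`. -/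
def validPartitions {d n r : ℕ} (h : PriorParams) (D : Sample d n) (τ : Fin r → ℝ)
    (S : Finset (Fin (d + 1))) (K : ℕ) : Set (Finset (Set (Fin (d + 1) → ℝ))) :=
  {T | T.card = K ∧
    IsTreePartition (observed D τ) S (T : Set (Set (Fin (d + 1) → ℝ))) ∧
    ∀ Ω ∈ T, h.C ^ 2 ≤ Set.ncard {ij : Fin n × Fin r | designPoint D τ ij ∈ Ω}}

/-! ### The prior -/

/-- The (unnormalised) prior weight of the pair `(S, K)`:
`c^(-q) m^(-a q) * (m choose q)⁻¹ * rate^K / ((e^rate - 1) K!)`, for `K ≥ 1`,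
where `m = d + 1` and `q = |S|`. -/
def shellWeight {m : ℕ} (h : PriorParams) (S : Finset (Fin m)) (K : ℕ) : ℝ :=
  if K = 0 then 0 else
    h.c ^ (-(S.card : ℝ)) * (m : ℝ) ^ (-(h.a * S.card)) * ((m.choose S.card : ℝ))⁻¹ *
      (h.rate ^ K / ((Real.exp h.rate - 1) * (K.factorial : ℝ)))

/-- The law of the step function on the cells `T` whose heights are independent
`N(0, variance)`. -/
def heightLaw {m : ℕ} (h : PriorParams) (T : Finset (Set (Fin m → ℝ))) :
    Measure (StepParam m) :=
  (Measure.pi fun _ : T => gaussianReal 0 h.variance).map (Sigma.mk T)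

/-- The unnormalised tree prior: a pair `(S, K)` with its weight, a uniformly chosen valid
partition given `(S, K)`, and Gaussian heights given the partition. Pairs `(S, K)` for which there
is no valid partition do not contribute. -/
def rawPrior {d n r : ℕ} (h : PriorParams) (D : Sample d n) (τ : Fin r → ℝ) :
    Measure (StepParam (d + 1)) :=
  ∑ S : Finset (Fin (d + 1)), Measure.sum fun K : ℕ =>
    Measure.sum fun T : validPartitions h D τ S K =>
      (ENNReal.ofReal (shellWeight h S K) * ((validPartitions h D τ S K).ncard : ℝ≥0∞)⁻¹) •
        heightLaw h (T : Finset (Set (Fin (d + 1) → ℝ)))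

/-- The step functions that are bounded by `L` on `[0,1]^m`. -/
def boundedSteps (m : ℕ) (L : ℝ) : Set (StepParam m) :=
  {θ | ∀ x ∈ unitCube m, |stepFun θ x| ≤ L}

/-- The tree prior, conditioned on the step functions with sup-norm at most `L`. -/
def prior {d n r : ℕ} (h : PriorParams) (L : ℝ) (D : Sample d n) (τ : Fin r → ℝ) :
    Measure (StepParam (d + 1)) :=
  cond (rawPrior h D τ) (boundedSteps (d + 1) L)

/-! ### The Gibbs posterior -/

/-- The `r`-fold augmented check loss `∑_i ∑_j ρ_{τ_j}(Y_i - μ(X_i, τ_j))`. -/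
def augmentedLoss {d n r : ℕ} (D : Sample d n) (τ : Fin r → ℝ) (θ : StepParam (d + 1)) : ℝ :=
  ∑ i, ∑ j, checkLoss (τ j) ((D i).2 - stepQuantile θ (D i).1 (τ j))

/-- The Gibbs posterior `∝ exp(-ω * loss) dprior`, with learning rate `ω`. -/
def posterior {d n r : ℕ} (h : PriorParams) (L ω : ℝ) (D : Sample d n) (τ : Fin r → ℝ) :
    Measure (StepParam (d + 1)) :=
  let ν := (prior h L D τ).withDensity fun θ =>
    ENNReal.ofReal (Real.exp (-(ω * augmentedLoss D τ θ)))
  (ν Set.univ)⁻¹ • ν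

/-- The distance `(1/r) ∑_j ‖μ₀(·, τ_j) - μ(·, τ_j)‖_{L²(PX)}`. -/
def quantileDist {d r : ℕ} (PX : Measure (Fin d → ℝ)) (τ : Fin r → ℝ)
    (μ₀ μ : (Fin d → ℝ) → ℝ → ℝ) : ℝ≥0∞ :=
  (r : ℝ≥0∞)⁻¹ * ∑ j, eLpNorm (fun x => μ₀ x (τ j) - μ x (τ j)) 2 PX

/-- The rate `n^(-ν/(2ν+d+1)) (log n)^(2p+1/2)`. -/
def rate (d : ℕ) (ν p : ℝ) (n : ℕ) : ℝ :=
  (n : ℝ) ^ (-(ν / (2 * ν + d + 1))) * Real.log n ^ (2 * p + 1 / 2)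

end

end IQBART

/-! ### Excess check loss and its conditional mean. -/

namespace IQBART

/-! Write `L = log^p n`, `l = log n` and `K = n^((d+1)/(2ν+d+1))`. Subtracting the loss of the true
quantiles changes the Gibbs weights by a factor depending on the data only (`posterior_eq`), so the
posterior mass of a set is a ratio of prior integrals of `exp(-ω · excess loss)`. At a true quantile
`m` the excess loss is bounded by `|u - m|`, and its conditional mean lies between `c (u-m)²/B` and
`C (u-m)²` when `|u-m| ≤ B` (`integral_lossDiff_lower`, `integral_lossDiff_upper`). Since `ω` is of
order `L⁻²`, second order terms are absorbed: `exp(-ω · excess)` has mean at most `exp(-c (ω/L) ·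
squared error)`, and its reciprocal at most `exp(C ω · squared error)`.

Denominator. Successive halving, with splits moved to observed values, gives a valid tree with at
most `K` cells which separates all but `O(K)` rows at a scale of order `n^(-1/(2ν+d+1))`
(`exists_isTreePartition_fine`). This tree with heights near the true values has prior mass at least
`exp(-O(K l))`. Its good rows have total squared error `O(K)`; each bad row costs at most `O(ω L²) =
O(1)` in the exponent. Jensen's inequality then bounds the mean of the reciprocal evidence, given
the covariates, by `exp(C₃ K l)` (`exists_lintegral_inv_evidence_le_exp`).

Numerator. Trees with at least `k ≈ B K` cells are negligible by the Poisson tail, because given the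
covariates the Gibbs weight has mean at most one (`lintegral_largeMass_le`). For the other trees the
distance is that of `L²(PX)` while the splits come from the same sample, so a candidate function is
not independent of the data. This is resolved by sample compression: a tree with `K'` cells is
determined by a code naming at most `2(d+1)K'` observations. For a fixed code and fixed heights the
function depends on the named observations only, and each of the others contributes a factor `exp(-c
(ω/L) ρ²)` (`lintegral_codeMass_le`). The sum over codes costs `exp(O(K l))`. For `ρ` at least the
rate, `n ω ρ²/L` is at least a constant times `L K l`, and the spare factor `L → ∞` beats all
constants; hence `M n ≥ 1` is all that is needed of `M`.

Numerator and denominator are decoupled by `min(1, ab) ≤ s b + s⁻¹ a` with `s = exp(2 C₃ K l)`,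
which leaves a bound `C/n`. The posterior is not shown to be measurable in the sample. Its upper
integral is bounded by conditioning on the covariates, given which the prior is a fixed measure;
only the sum over codes is integrated over the whole sample. -/

theorem checkLoss_nonneg {τ : ℝ} (hτ : τ ∈ Set.Ioo (0 : ℝ) 1) (u : ℝ) : 0 ≤ checkLoss τ u := by
  unfold checkLoss
  split_ifs with h
  · nlinarith [hτ.2]
  · nlinarith [hτ.1]

theorem abs_checkLoss_sub_le {τ : ℝ} (hτ : τ ∈ Set.Ioo (0 : ℝ) 1) (u v : ℝ) :
    |checkLoss τ u - checkLoss τ v| ≤ |u - v| := by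
  obtain ⟨h0, h1⟩ := hτ
  unfold checkLoss
  rcases abs_cases (u - v) with ⟨h, _⟩ | ⟨h, _⟩ <;> rw [h, abs_le] <;> split_ifs <;>
    constructor <;> nlinarith

theorem measurable_checkLoss (τ : ℝ) : Measurable (checkLoss τ) := by
  unfold checkLoss
  refine measurable_id.mul (measurable_const.sub ?_)
  exact Measurable.ite measurableSet_Iio measurable_const measurable_const

/-- Without atoms, the mass below the `τ`-quantile is `τ`. -/
theorem real_Iio_quantile (ρ : Measure ℝ) [IsProbabilityMeasure ρ] [NullSingletonClass ρ] {τ : ℝ}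
    (hτ : τ ∈ Set.Ioo (0 : ℝ) 1) : ρ.real (Set.Iio (quantile ρ τ)) = τ := by
  set m := quantile ρ τ with hm
  have hIic : ∀ y, ρ.real (Set.Iic y) = cdf ρ y := fun y => (cdf_eq_real ρ y).symm
  have hset : {y : ℝ | τ ≤ ρ.real (Set.Iic y)} = {y | τ ≤ cdf ρ y} := by simp only [hIic]
  have hne : {y : ℝ | τ ≤ cdf ρ y}.Nonempty :=
    ((tendsto_cdf_atTop ρ).eventually (eventually_ge_nhds hτ.2)).exists
  have hbdd : BddBelow {y : ℝ | τ ≤ cdf ρ y} := by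
    obtain ⟨b, hb⟩ := ((tendsto_cdf_atBot ρ).eventually (eventually_lt_nhds hτ.1)).exists
    refine ⟨b, fun y hy => ?_⟩
    by_contra hlt
    exact absurd ((monotone_cdf ρ (not_le.1 hlt).le).trans_lt hb) (not_lt.2 hy)
  have hm' : m = sInf {y : ℝ | τ ≤ cdf ρ y} := by rw [hm, quantile, hset]
  have heq : ρ.real (Set.Iio m) = ρ.real (Set.Iic m) := measureReal_congr Iio_ae_eq_Iic
  apply le_antisymm
  · have hcont : ρ (Set.Iio m) ≤ ENNReal.ofReal τ := by
      have hU : Set.Iio m = ⋃ k : ℕ, Set.Iic (m - 1 / ((k : ℝ) + 1)) := by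
        ext y
        simp only [Set.mem_Iio, Set.mem_iUnion, Set.mem_Iic]
        constructor
        · intro hy
          obtain ⟨k, hk⟩ := exists_nat_one_div_lt (sub_pos.2 hy)
          exact ⟨k, by linarith⟩
        · rintro ⟨k, hk⟩
          have : (0 : ℝ) < 1 / ((k : ℝ) + 1) := by positivity
          linarith
      have hmono : Monotone fun k : ℕ => Set.Iic (m - 1 / ((k : ℝ) + 1)) := by
        intro a b hab
        apply Set.Iic_subset_Iic.2
        have : 1 / ((b : ℝ) + 1) ≤ 1 / ((a : ℝ) + 1) := by
          apply one_div_le_one_div_of_le (by positivity)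
          have : (a : ℝ) ≤ b := by exact_mod_cast hab
          linarith
        linarith
      rw [hU, hmono.measure_iUnion]
      refine iSup_le fun k => ?_
      rw [← ofReal_cdf]
      apply ENNReal.ofReal_le_ofReal
      by_contra hlt
      have : m ≤ m - 1 / ((k : ℝ) + 1) := by
        conv_lhs => rw [hm']
        exact csInf_le hbdd (not_le.1 hlt).le
      have : (0 : ℝ) < 1 / ((k : ℝ) + 1) := by positivity
      linarith
    rw [measureReal_def]
    exact ENNReal.toReal_le_of_le_ofReal hτ.1.le hcont
  · rw [heq, hIic]
    have hright : Tendsto (cdf ρ) (𝓝[>] m) (𝓝 (cdf ρ m)) :=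
      ((cdf ρ).right_continuous m).mono Set.Ioi_subset_Ici_self
    refine ge_of_tendsto hright ?_
    filter_upwards [self_mem_nhdsWithin] with y hy
    rw [Set.mem_Ioi, hm', csInf_lt_iff hbdd hne] at hy
    obtain ⟨z, hz, hzy⟩ := hy
    exact le_trans hz (monotone_cdf ρ hzy.le)

/-- `m` is a point with mass `τ` below it around which the law `ρ` has a density in `[α, A]`. -/
structure RegularQuantile (ρ : Measure ℝ) (τ m δ α A : ℝ) : Prop where
  level : τ ∈ Set.Ioo (0 : ℝ) 1
  mass : ρ.real (Set.Iio m) = τ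
  delta_pos : 0 < δ
  alpha_pos : 0 < α
  upper_pos : 0 < A
  lower : ∀ a b, m - δ < a → a ≤ b → b < m + δ → α * (b - a) ≤ ρ.real (Set.Ico a b)
  upper : ∀ a b, m - δ < a → a ≤ b → b < m + δ → ρ.real (Set.Ico a b) ≤ A * (b - a)

theorem regularQuantile_of_density {ρ : Measure ℝ} [IsProbabilityMeasure ρ] {f : ℝ → ℝ}
    (hρ : ρ = volume.withDensity fun y => ENNReal.ofReal (f y)) {τ δ α A : ℝ}
    (hτ : τ ∈ Set.Ioo (0 : ℝ) 1) (hδ : 0 < δ) (hα : 0 < α)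
    (hf : ∀ y, |y - quantile ρ τ| < δ → α < f y ∧ f y ≤ A) :
    RegularQuantile ρ τ (quantile ρ τ) δ α A := by
  have : NullSingletonClass ρ := by rw [hρ]; infer_instance
  have hA : 0 < A := by
    have := hf (quantile ρ τ) (by simpa using hδ)
    linarith [this.1, this.2]
  have key : ∀ a b, quantile ρ τ - δ < a → a ≤ b → b < quantile ρ τ + δ →
      ρ (Set.Ico a b) = ∫⁻ y in Set.Ico a b, ENNReal.ofReal (f y) := fun a b _ _ _ => by
    conv_lhs => rw [hρ]
    rw [withDensity_apply _ measurableSet_Ico]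
  have hin : ∀ a b y, quantile ρ τ - δ < a → b < quantile ρ τ + δ → y ∈ Set.Ico a b →
      |y - quantile ρ τ| < δ := fun a b y h1 h2 hy => by
    rw [abs_lt]; constructor <;> linarith [hy.1, hy.2]
  refine ⟨hτ, real_Iio_quantile ρ hτ, hδ, hα, hA, fun a b h1 hab h2 => ?_,
    fun a b h1 hab h2 => ?_⟩
  · have : ENNReal.ofReal (α * (b - a)) ≤ ρ (Set.Ico a b) := by
      rw [key a b h1 hab h2]
      calc ENNReal.ofReal (α * (b - a)) = ∫⁻ _ in Set.Ico a b, ENNReal.ofReal α := by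
            rw [setLIntegral_const, Real.volume_Ico, ENNReal.ofReal_mul hα.le]
        _ ≤ _ := setLIntegral_mono' measurableSet_Ico fun y hy =>
            ENNReal.ofReal_le_ofReal (hf y (hin a b y h1 h2 hy)).1.le
    exact (ENNReal.ofReal_le_iff_le_toReal (measure_ne_top _ _)).1 this
  · have : ρ (Set.Ico a b) ≤ ENNReal.ofReal (A * (b - a)) := by
      rw [key a b h1 hab h2]
      calc _ ≤ ∫⁻ _ in Set.Ico a b, ENNReal.ofReal A :=
            setLIntegral_mono' measurableSet_Ico fun y hy =>
              ENNReal.ofReal_le_ofReal (hf y (hin a b y h1 h2 hy)).2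
        _ = _ := by rw [setLIntegral_const, Real.volume_Ico, ENNReal.ofReal_mul hA.le]
    exact ENNReal.toReal_le_of_le_ofReal (mul_nonneg hA.le (sub_nonneg.2 hab)) this

/-- The difference of the check losses of the predictions `u` and `m` at the response `y`. -/
noncomputable def lossDiff (τ u m y : ℝ) : ℝ := checkLoss τ (y - u) - checkLoss τ (y - m)

theorem abs_lossDiff_le {τ : ℝ} (hτ : τ ∈ Set.Ioo (0 : ℝ) 1) (u m y : ℝ) :
    |lossDiff τ u m y| ≤ |u - m| := by
  refine (abs_checkLoss_sub_le hτ _ _).trans_eq ?_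
  rw [show y - u - (y - m) = -(u - m) by ring, abs_neg]

theorem measurable_lossDiff (τ u m : ℝ) : Measurable (lossDiff τ u m) :=
  ((measurable_checkLoss τ).comp (measurable_id.sub_const u)).sub
    ((measurable_checkLoss τ).comp (measurable_id.sub_const m))

theorem integrable_lossDiff {τ : ℝ} (hτ : τ ∈ Set.Ioo (0 : ℝ) 1) (u m : ℝ) (ρ : Measure ℝ)
    [IsFiniteMeasure ρ] : Integrable (lossDiff τ u m) ρ :=
  Integrable.of_bound (measurable_lossDiff τ u m).aestronglyMeasurable |u - m|
    (ae_of_all _ fun y => by simpa using abs_lossDiff_le hτ u m y)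

/-- The comparison function for both bounds on the excess loss: at a `τ`-quantile the first summand
has mean zero, so that only the mass of one interval remains. -/
theorem integral_step (ρ : Measure ℝ) [IsProbabilityMeasure ρ] (a b τ m p q : ℝ) :
    Integrable (fun y => a * ((Set.Iio m).indicator 1 y - τ)
      + b * (Set.Ico p q).indicator 1 y) ρ ∧
    ∫ y, (a * ((Set.Iio m).indicator 1 y - τ) + b * (Set.Ico p q).indicator 1 y) ∂ρ
      = a * (ρ.real (Set.Iio m) - τ) + b * ρ.real (Set.Ico p q) := by
  have h1 : Integrable ((Set.Iio m).indicator (1 : ℝ → ℝ)) ρ :=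
    (integrable_const (1 : ℝ)).indicator measurableSet_Iio
  have h2 : Integrable ((Set.Ico p q).indicator (1 : ℝ → ℝ)) ρ :=
    (integrable_const (1 : ℝ)).indicator measurableSet_Ico
  have h3 : Integrable (fun y => a * ((Set.Iio m).indicator (1 : ℝ → ℝ) y - τ)) ρ :=
    (h1.sub (integrable_const τ)).const_mul a
  refine ⟨h3.add (h2.const_mul b), ?_⟩
  rw [integral_add h3 (h2.const_mul b), integral_const_mul, integral_const_mul,
    integral_sub h1 (integrable_const τ), integral_indicator_one measurableSet_Iio,
    integral_indicator_one measurableSet_Ico]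
  simp

/-- For `m ≤ u` the excess loss equals `(u-m)(1{y<m} - τ) + (u-y) 1{m ≤ y < u}`, and symmetrically
for `u ≤ m`. The first term has mean zero. The second is bounded below on a short interval next to
`m`, where the density exceeds `α`. Far from `m` the growth is only linear; the factor `1/B` turns
it into a quadratic bound on the range `|u-m| ≤ B`. -/
theorem integral_lossDiff_lower {ρ : Measure ℝ} [IsProbabilityMeasure ρ] {τ m δ α A : ℝ}
    (h : RegularQuantile ρ τ m δ α A) {u B : ℝ} (hB : δ ≤ B) (hu : |u - m| ≤ B) :
    α * δ / (4 * B) * (u - m) ^ 2 ≤ ∫ y, lossDiff τ u m y ∂ρ := by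
  obtain ⟨hτ, hmass, hδ, hα, -, hlow, -⟩ := h
  have hBpos : 0 < B := hδ.trans_le hB
  set D := |u - m| with hD
  have hD0 : 0 ≤ D := abs_nonneg _
  -- The length satisfies `w ≤ δ/2`, to stay where the density is controlled, and `w ≤ D/2`, so that
  -- the distance to `u` is still at least `D/2` on the interval.
  set w := D * δ / (2 * B) with hw
  have hw0 : 0 ≤ w := by positivity
  have hwD : w ≤ D / 2 := by
    rw [hw, div_le_div_iff₀ (by positivity) (by norm_num)]; nlinarith
  have hwδ : w ≤ δ / 2 := by
    rw [hw, div_le_div_iff₀ (by positivity) (by norm_num)]; nlinarith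
  have hgoal : α * δ / (4 * B) * (u - m) ^ 2 = D / 2 * (α * w) := by
    rw [← sq_abs, ← hD, hw]; field_simp; ring
  have main : ∃ p q, α * w ≤ ρ.real (Set.Ico p q) ∧
      ∀ y, (u - m) * ((Set.Iio m).indicator 1 y - τ) + D / 2 * (Set.Ico p q).indicator 1 y
        ≤ lossDiff τ u m y := by
    rcases le_total m u with hmu | hmu
    · have hDe : D = u - m := by rw [hD, abs_of_nonneg (sub_nonneg.2 hmu)]
      refine ⟨m, m + w, ?_, fun y => ?_⟩
      · have := hlow m (m + w) (by linarith) (by linarith) (by linarith)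
        simpa using this
      · simp only [Set.indicator_apply, Set.mem_Iio, Set.mem_Ico, Pi.one_apply, lossDiff,
          checkLoss]
        obtain ⟨h0, h1⟩ := hτ
        split_ifs <;> grind
    · have hDe : D = m - u := by rw [hD, abs_of_nonpos (sub_nonpos.2 hmu)]; ring
      refine ⟨m - w, m, ?_, fun y => ?_⟩
      · have := hlow (m - w) m (by linarith) (by linarith) (by linarith)
        simpa using this
      · simp only [Set.indicator_apply, Set.mem_Iio, Set.mem_Ico, Pi.one_apply, lossDiff,
          checkLoss]
        obtain ⟨h0, h1⟩ := hτ
        split_ifs <;> grind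
  obtain ⟨p, q, hpq, hle⟩ := main
  have hs := integral_step ρ (u - m) (D / 2) τ m p q
  calc α * δ / (4 * B) * (u - m) ^ 2 = D / 2 * (α * w) := hgoal
    _ ≤ D / 2 * ρ.real (Set.Ico p q) := by gcongr
    _ = _ := by rw [hs.2, hmass]; ring
    _ ≤ _ := integral_mono hs.1 (integrable_lossDiff hτ u m ρ) hle

/-- The same decomposition, with the second term bounded by `|u-m|` on the whole interval between
`m` and `u`. The mass of that interval is at most `A|u-m|` if `|u-m| < δ`, and otherwise at most `1
≤ |u-m|/δ`. -/
theorem integral_lossDiff_upper {ρ : Measure ℝ} [IsProbabilityMeasure ρ] {τ m δ α A : ℝ}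
    (h : RegularQuantile ρ τ m δ α A) (u : ℝ) :
    ∫ y, lossDiff τ u m y ∂ρ ≤ (A + 1 / δ) * (u - m) ^ 2 := by
  obtain ⟨hτ, hmass, hδ, -, hA, -, hup⟩ := h
  set D := |u - m| with hD
  have hD0 : 0 ≤ D := abs_nonneg _
  have hone : ∀ p q, ρ.real (Set.Ico p q) ≤ 1 := fun p q => measureReal_le_one
  have main : ∃ p q, (D < δ → ρ.real (Set.Ico p q) ≤ A * D) ∧
      ∀ y, lossDiff τ u m y ≤
        (u - m) * ((Set.Iio m).indicator 1 y - τ) + D * (Set.Ico p q).indicator 1 y := by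
    rcases le_total m u with hmu | hmu
    · have hDe : D = u - m := by rw [hD, abs_of_nonneg (sub_nonneg.2 hmu)]
      refine ⟨m, u, fun hlt => ?_, fun y => ?_⟩
      · rw [hDe]
        exact hup m u (by linarith) hmu (by linarith)
      · simp only [Set.indicator_apply, Set.mem_Iio, Set.mem_Ico, Pi.one_apply, lossDiff,
          checkLoss]
        obtain ⟨h0, h1⟩ := hτ
        split_ifs <;> grind
    · have hDe : D = m - u := by rw [hD, abs_of_nonpos (sub_nonpos.2 hmu)]; ring
      refine ⟨u, m, fun hlt => ?_, fun y => ?_⟩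
      · rw [hDe]
        exact hup u m (by linarith) hmu (by linarith)
      · simp only [Set.indicator_apply, Set.mem_Iio, Set.mem_Ico, Pi.one_apply, lossDiff,
          checkLoss]
        obtain ⟨h0, h1⟩ := hτ
        split_ifs <;> grind
  obtain ⟨p, q, hpq, hle⟩ := main
  have hs := integral_step ρ (u - m) D τ m p q
  have hbound : ρ.real (Set.Ico p q) ≤ (A + 1 / δ) * D := by
    rcases lt_or_ge D δ with hlt | hge
    · refine (hpq hlt).trans ?_
      have : 0 ≤ 1 / δ * D := by positivity
      linarith
    · refine (hone p q).trans ?_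
      have : 1 ≤ 1 / δ * D := by rw [one_div, inv_mul_eq_div, one_le_div hδ]; exact hge
      nlinarith
  calc ∫ y, lossDiff τ u m y ∂ρ ≤ _ := integral_mono (integrable_lossDiff hτ u m ρ) hs.1 hle
    _ = D * ρ.real (Set.Ico p q) := by rw [hs.2, hmass]; ring
    _ ≤ D * ((A + 1 / δ) * D) := by gcongr
    _ = _ := by rw [← sq_abs (u - m), ← hD]; ring

/-! ### Laplace transforms of the excess loss. -/

/-- A second order bound for the Laplace transform of a bounded variable. -/
theorem lintegral_exp_le {Ω : Type*} [MeasurableSpace Ω] (ρ : Measure Ω)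
    [IsProbabilityMeasure ρ] {g : Ω → ℝ} (hg : Measurable g) {b V t : ℝ}
    (hb : ∀ y, |g y| ≤ b) (hV : ∀ y, g y ^ 2 ≤ V) (ht : |t| * b ≤ 1) :
    ∫⁻ y, ENNReal.ofReal (Real.exp (t * g y)) ∂ρ
      ≤ ENNReal.ofReal (Real.exp (t * (∫ y, g y ∂ρ) + t ^ 2 * V)) := by
  have hint : Integrable g ρ :=
    Integrable.of_bound hg.aestronglyMeasurable b (ae_of_all _ fun y => by simpa using hb y)
  have hpt : ∀ y, Real.exp (t * g y) ≤ 1 + t ^ 2 * V + t * g y := fun y => by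
    -- On `[-1, 1]` one has `exp s ≤ 1 + s + s²`.
    have hle : |t * g y| ≤ 1 := by
      rw [abs_mul]; exact (mul_le_mul_of_nonneg_left (hb y) (abs_nonneg t)).trans ht
    have h1 := (abs_le.1 (Real.abs_exp_sub_one_sub_id_le hle)).2
    have h2 : (t * g y) ^ 2 ≤ t ^ 2 * V := by
      rw [mul_pow]; exact mul_le_mul_of_nonneg_left (hV y) (sq_nonneg t)
    linarith
  have hint2 : Integrable (fun y => 1 + t ^ 2 * V + t * g y) ρ :=
    (integrable_const _).add (hint.const_mul t)
  calc ∫⁻ y, ENNReal.ofReal (Real.exp (t * g y)) ∂ρ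
      ≤ ∫⁻ y, ENNReal.ofReal (1 + t ^ 2 * V + t * g y) ∂ρ :=
        lintegral_mono fun y => ENNReal.ofReal_le_ofReal (hpt y)
    _ = ENNReal.ofReal (∫ y, (1 + t ^ 2 * V + t * g y) ∂ρ) :=
        (ofReal_integral_eq_lintegral_ofReal hint2
          (ae_of_all _ fun y => (Real.exp_pos _).le.trans (hpt y))).symm
    _ ≤ _ := by
        apply ENNReal.ofReal_le_ofReal
        rw [integral_add (integrable_const _) (hint.const_mul t), integral_const_mul]
        simp only [integral_const, probReal_univ, one_smul]
        have := Real.add_one_le_exp (t * (∫ y, g y ∂ρ) + t ^ 2 * V)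
        linarith

/-- The difference of the losses, summed over the quantile levels. -/
noncomputable def totalDiff {r : ℕ} (τ u m : Fin r → ℝ) (y : ℝ) : ℝ :=
  ∑ j, lossDiff (τ j) (u j) (m j) y

section totalDiff

variable {r : ℕ} {τ u m : Fin r → ℝ}

theorem measurable_totalDiff : Measurable (totalDiff τ u m) :=
  Finset.measurable_sum _ fun _ _ => measurable_lossDiff _ _ _

theorem abs_totalDiff_le (hτ : ∀ j, τ j ∈ Set.Ioo (0 : ℝ) 1) (y : ℝ) :
    |totalDiff τ u m y| ≤ ∑ j, |u j - m j| :=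
  (Finset.abs_sum_le_sum_abs _ _).trans
    (Finset.sum_le_sum fun j _ => abs_lossDiff_le (hτ j) _ _ _)

theorem totalDiff_sq_le (hτ : ∀ j, τ j ∈ Set.Ioo (0 : ℝ) 1) (y : ℝ) :
    totalDiff τ u m y ^ 2 ≤ r * ∑ j, (u j - m j) ^ 2 := by
  have h1 := abs_totalDiff_le (u := u) (m := m) hτ y
  calc totalDiff τ u m y ^ 2 = |totalDiff τ u m y| ^ 2 := (sq_abs _).symm
    _ ≤ (∑ j, |u j - m j|) ^ 2 := by gcongr
    _ ≤ (Finset.univ : Finset (Fin r)).card * ∑ j, |u j - m j| ^ 2 := sq_sum_le_card_mul_sum_sq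
    _ = _ := by simp

variable {ρ : Measure ℝ} [IsProbabilityMeasure ρ] {δ α A : ℝ}

/-- The drift is at least `2k` times the sum of squares, with `k = αδ/(8B)`. By `hw2` the second
order term consumes at most half of it. -/
theorem lintegral_exp_neg_totalDiff_le (h : ∀ j, RegularQuantile ρ (τ j) (m j) δ α A)
    {B w : ℝ} (hB : δ ≤ B) (hu : ∀ j, |u j - m j| ≤ B) (hw : 0 ≤ w) (hw1 : w * (r * B) ≤ 1)
    (hw2 : w * r ≤ α * δ / (8 * B)) :
    ∫⁻ y, ENNReal.ofReal (Real.exp (-(w * totalDiff τ u m y))) ∂ρ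
      ≤ ENNReal.ofReal (Real.exp (-(w * (α * δ / (8 * B)) * ∑ j, (u j - m j) ^ 2))) := by
  have hτ : ∀ j, τ j ∈ Set.Ioo (0 : ℝ) 1 := fun j => (h j).level
  have hsum : ∑ j, |u j - m j| ≤ r * B := by
    calc ∑ j, |u j - m j| ≤ ∑ _j : Fin r, B := Finset.sum_le_sum fun j _ => hu j
      _ = r * B := by simp
  have key := lintegral_exp_le ρ (measurable_totalDiff (τ := τ) (u := u) (m := m))
    (b := r * B) (t := -w) (fun y => (abs_totalDiff_le hτ y).trans hsum)
    (fun y => totalDiff_sq_le hτ y) (by rwa [abs_neg, abs_of_nonneg hw])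
  simp only [neg_mul] at key
  refine key.trans (ENNReal.ofReal_le_ofReal (Real.exp_le_exp.2 ?_))
  have hlow : α * δ / (4 * B) * ∑ j, (u j - m j) ^ 2 ≤ ∫ y, totalDiff τ u m y ∂ρ := by
    unfold totalDiff
    rw [integral_finsetSum _ fun j _ => integrable_lossDiff (hτ j) _ _ _, Finset.mul_sum]
    exact Finset.sum_le_sum fun j _ => integral_lossDiff_lower (h j) hB (hu j)
  have hS : 0 ≤ ∑ j, (u j - m j) ^ 2 := Finset.sum_nonneg fun j _ => sq_nonneg _
  set S := ∑ j, (u j - m j) ^ 2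
  have e : α * δ / (4 * B) = 2 * (α * δ / (8 * B)) := by ring
  rw [e] at hlow
  set k := α * δ / (8 * B)
  have h1 : w * (2 * k * S) ≤ w * ∫ y, totalDiff τ u m y ∂ρ := by gcongr
  have h2 : w * (w * r) * S ≤ w * k * S := by gcongr
  nlinarith

theorem lintegral_exp_totalDiff_le (h : ∀ j, RegularQuantile ρ (τ j) (m j) δ α A)
    {B w : ℝ} (hu : ∀ j, |u j - m j| ≤ B) (hw : 0 ≤ w) (hw1 : w * (r * B) ≤ 1)
    (hw2 : w * r ≤ 1) :
    ∫⁻ y, ENNReal.ofReal (Real.exp (w * totalDiff τ u m y)) ∂ρ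
      ≤ ENNReal.ofReal (Real.exp (w * (A + 1 / δ + 1) * ∑ j, (u j - m j) ^ 2)) := by
  have hτ : ∀ j, τ j ∈ Set.Ioo (0 : ℝ) 1 := fun j => (h j).level
  have hsum : ∑ j, |u j - m j| ≤ r * B := by
    calc ∑ j, |u j - m j| ≤ ∑ _j : Fin r, B := Finset.sum_le_sum fun j _ => hu j
      _ = r * B := by simp
  have key := lintegral_exp_le ρ (measurable_totalDiff (τ := τ) (u := u) (m := m))
    (b := r * B) (t := w) (fun y => (abs_totalDiff_le hτ y).trans hsum)
    (fun y => totalDiff_sq_le hτ y) (by rwa [abs_of_nonneg hw])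
  refine key.trans (ENNReal.ofReal_le_ofReal (Real.exp_le_exp.2 ?_))
  have hup : ∫ y, totalDiff τ u m y ∂ρ ≤ (A + 1 / δ) * ∑ j, (u j - m j) ^ 2 := by
    unfold totalDiff
    rw [integral_finsetSum _ fun j _ => integrable_lossDiff (hτ j) _ _ _, Finset.mul_sum]
    exact Finset.sum_le_sum fun j _ => integral_lossDiff_upper (h j) _
  have hS : 0 ≤ ∑ j, (u j - m j) ^ 2 := Finset.sum_nonneg fun j _ => sq_nonneg _
  set S := ∑ j, (u j - m j) ^ 2
  have h1 : w * ∫ y, totalDiff τ u m y ∂ρ ≤ w * ((A + 1 / δ) * S) := by gcongr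
  have h2 : w * (w * r) * S ≤ w * 1 * S := by gcongr
  nlinarith

end totalDiff

/-! ### Product laws, conditioning on the covariates, Jensen for the reciprocal. -/

theorem lintegral_pi_prod {ι : Type*} [Fintype ι] {Z : ι → Type*} [∀ i, MeasurableSpace (Z i)]
    (P : ∀ i, Measure (Z i)) [∀ i, IsProbabilityMeasure (P i)] {f : ∀ i, Z i → ℝ≥0∞}
    (hf : ∀ i, Measurable (f i)) :
    ∫⁻ z, ∏ i, f i (z i) ∂Measure.pi P = ∏ i, ∫⁻ z, f i z ∂P i := by
  refine (lintegral_prod_eq_prod_lintegral_of_indepFun Finset.univ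
    (fun i (z : ∀ i, Z i) => f i (z i)) (iIndepFun_pi fun i => (hf i).aemeasurable)
    fun i => (hf i).comp (measurable_pi_apply i)).trans ?_
  refine Finset.prod_congr rfl fun i _ => ?_
  exact (measurePreserving_eval P i).lintegral_comp (hf i)

section condLaw

variable {X Y : Type*} [MeasurableSpace X] [MeasurableSpace Y]

/-- The law of a sample given its covariates. -/
noncomputable def condLaw {n : ℕ} (κ : Kernel X Y) (x : Fin n → X) :
    Measure (Fin n → X × Y) :=
  Measure.pi fun i => (κ (x i)).map (Prod.mk (x i))

theorem isProbabilityMeasure_map_mk (κ : Kernel X Y) [IsMarkovKernel κ] (x : X) :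
    IsProbabilityMeasure ((κ x).map (Prod.mk x)) :=
  Measure.isProbabilityMeasure_map measurable_prodMk_left.aemeasurable

instance isProbabilityMeasure_condLaw {n : ℕ} (κ : Kernel X Y) [IsMarkovKernel κ]
    (x : Fin n → X) : IsProbabilityMeasure (condLaw κ x) := by
  have := fun i => isProbabilityMeasure_map_mk κ (x i)
  unfold condLaw
  infer_instance

theorem condLaw_pi {n : ℕ} (κ : Kernel X Y) [IsMarkovKernel κ] (x : Fin n → X)
    {s : Fin n → Set (X × Y)} (hs : ∀ i, MeasurableSet (s i)) :
    condLaw κ x (Set.univ.pi s) = ∏ i, κ (x i) (Prod.mk (x i) ⁻¹' s i) := by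
  have := fun i => isProbabilityMeasure_map_mk κ (x i)
  rw [condLaw, Measure.pi_pi]
  exact Finset.prod_congr rfl fun i _ => Measure.map_apply measurable_prodMk_left (hs i)

theorem measurable_condLaw {n : ℕ} (κ : Kernel X Y) [IsMarkovKernel κ] :
    Measurable (condLaw (n := n) κ) := by
  refine Measurable.measure_of_isPiSystem_of_isProbabilityMeasure generateFrom_pi.symm
    isPiSystem_pi ?_
  rintro _ ⟨s, hs, rfl⟩
  have hs' : ∀ i, MeasurableSet (s i) := fun i => hs i (Set.mem_univ i)
  simp only [condLaw_pi κ _ hs']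
  exact Finset.measurable_prod _ fun i _ =>
    (Kernel.measurable_kernel_prodMk_left (hs' i)).comp (measurable_pi_apply i)

/-- The sample can be drawn in two stages, covariates first and responses afterwards; the two laws
agree on rectangles. -/
theorem pi_compProd_eq_bind {n : ℕ} (P : Measure X) [IsProbabilityMeasure P] (κ : Kernel X Y)
    [IsMarkovKernel κ] :
    (Measure.pi fun _ : Fin n => P ⊗ₘ κ) = (Measure.pi fun _ : Fin n => P).bind (condLaw κ) := by
  refine Measure.pi_eq fun s hs => ?_
  rw [Measure.bind_apply (MeasurableSet.univ_pi hs) (measurable_condLaw κ).aemeasurable]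
  simp only [condLaw_pi κ _ hs]
  rw [lintegral_pi_prod (fun _ : Fin n => P)
    fun i => Kernel.measurable_kernel_prodMk_left (hs i)]
  exact Finset.prod_congr rfl fun i _ => (Measure.compProd_apply (hs i)).symm

theorem ae_condLaw_fst [MeasurableSingletonClass X] {n : ℕ} (κ : Kernel X Y) [IsMarkovKernel κ]
    (x : Fin n → X) : ∀ᵐ D ∂condLaw κ x, ∀ i, (D i).1 = x i := by
  have := fun i => isProbabilityMeasure_map_mk κ (x i)
  rw [ae_all_iff]
  intro i
  have h : ∀ᵐ z ∂(κ (x i)).map (Prod.mk (x i)), z.1 = x i := by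
    have hset : MeasurableSet {z : X × Y | z.1 = x i} :=
      measurable_fst (measurableSet_singleton (x i))
    rw [ae_map_iff measurable_prodMk_left.aemeasurable hset]
    exact ae_of_all _ fun _ => rfl
  exact (measurePreserving_eval (fun i => (κ (x i)).map (Prod.mk (x i))) i).quasiMeasurePreserving.ae h

theorem lintegral_condLaw_prod {n : ℕ} (κ : Kernel X Y) [IsMarkovKernel κ] (x : Fin n → X)
    {f : Fin n → X × Y → ℝ≥0∞} (hf : ∀ i, Measurable (f i)) :
    ∫⁻ D, ∏ i, f i (D i) ∂condLaw κ x = ∏ i, ∫⁻ y, f i (x i, y) ∂κ (x i) := by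
  have := fun i => isProbabilityMeasure_map_mk κ (x i)
  rw [condLaw, lintegral_pi_prod _ hf]
  exact Finset.prod_congr rfl fun i _ => lintegral_map (hf i) measurable_prodMk_left

/-- An upper bound for the mean of a possibly nonmeasurable function, in which one part is
controlled given the covariates and the other one in mean. -/
theorem lintegral_pi_compProd_le {n : ℕ} (P : Measure X) [IsProbabilityMeasure P]
    (κ : Kernel X Y) [IsMarkovKernel κ] (f g : (Fin n → X × Y) → ℝ≥0∞) (hg : Measurable g)
    (c : ℝ≥0∞) (h : ∀ᵐ x ∂(Measure.pi fun _ : Fin n => P),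
      ∫⁻ D, f D ∂condLaw κ x ≤ c + ∫⁻ D, g D ∂condLaw κ x) :
    ∫⁻ D, f D ∂(Measure.pi fun _ : Fin n => P ⊗ₘ κ)
      ≤ c + ∫⁻ D, g D ∂(Measure.pi fun _ : Fin n => P ⊗ₘ κ) := by
  rw [pi_compProd_eq_bind, Measure.lintegral_bind (measurable_condLaw κ).aemeasurable
    hg.aemeasurable]
  -- Without measurability of `f` only this inequality is available, and it has the direction
  -- needed.
  refine (Measure.lintegral_bind_le _ _ _).trans ((lintegral_mono_ae h).trans ?_)
  rw [lintegral_add_left measurable_const]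
  simp

end condLaw

/-- Integrating a product of functions whose parameters depend on the coordinates in `I` only. -/
theorem lintegral_pi_prod_le_of_dependsOn {ι Z : Type*} [Fintype ι] [DecidableEq ι]
    [MeasurableSpace Z] (P : Measure Z) [IsProbabilityMeasure P] (I : Finset ι)
    {Ψ : (ι → Z) → ℝ≥0∞} {Φ : (ι → Z) → Z → ℝ≥0∞}
    (hmeas : Measurable fun D => Ψ D * ∏ i, Φ D (D i)) (hΦ : ∀ D, Measurable (Φ D))
    (hΨI : ∀ D D', (∀ i ∈ I, D i = D' i) → Ψ D = Ψ D')
    (hΦI : ∀ D D', (∀ i ∈ I, D i = D' i) → Φ D = Φ D')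
    {b c : ℝ≥0∞} (hb : ∀ D z, Φ D z ≤ b)
    (hc : ∀ D, Ψ D * (∫⁻ z, Φ D z ∂P) ^ (Fintype.card ι - I.card) ≤ c) :
    ∫⁻ D, Ψ D * ∏ i, Φ D (D i) ∂(Measure.pi fun _ : ι => P) ≤ b ^ I.card * c := by
  have hZ : Nonempty Z := P.nonempty_of_neZero
  let D₀ : ι → Z := fun _ => hZ.some
  have hsplit := congrFun (lmarginal_union (fun _ : ι => P) _ hmeas
    (disjoint_compl_right : Disjoint I Iᶜ)) D₀
  rw [Finset.union_compl] at hsplit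
  rw [lintegral_eq_lmarginal_univ D₀, hsplit]
  -- With the coordinates in `I` frozen, `Ψ` and `Φ` are constant and the remaining coordinates are
  -- independent. The factors in `I`, whose argument is correlated with the parameter, are replaced
  -- by the bound `b`.
  have key : ∀ D, (∫⋯∫⁻_Iᶜ, (fun D => Ψ D * ∏ i, Φ D (D i)) ∂(fun _ : ι => P)) D
      ≤ b ^ I.card * c := by
    intro D
    unfold lmarginal
    have hupd : ∀ y : (i : {x // x ∈ Iᶜ}) → Z, ∀ i ∈ I, Function.updateFinset D Iᶜ y i = D i := by
      intro y i hi
      simp [Function.updateFinset, hi]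
    have hle : ∀ y : (i : {x // x ∈ Iᶜ}) → Z,
        Ψ (Function.updateFinset D Iᶜ y) * ∏ i, Φ (Function.updateFinset D Iᶜ y)
          (Function.updateFinset D Iᶜ y i) ≤ Ψ D * b ^ I.card * ∏ i, Φ D (y i) := by
      intro y
      rw [hΨI _ _ (hupd y), hΦI _ _ (hupd y), mul_assoc,
        ← Finset.prod_mul_prod_compl I]
      gcongr
      · exact Finset.prod_le_pow_card _ _ _ fun i _ => hb _ _
      · rw [← Finset.prod_coe_sort Iᶜ]
        refine (Finset.prod_congr rfl fun i _ => ?_).le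
        have : (i : ι) ∈ Iᶜ := i.2
        simp only [Function.updateFinset, this, dif_pos]
    refine (lintegral_mono hle).trans ?_
    have hm : Measurable fun y : (i : {x // x ∈ Iᶜ}) → Z => ∏ i, Φ D (y i) :=
      Finset.measurable_prod _ fun i _ => (hΦ D).comp (measurable_pi_apply i)
    rw [lintegral_const_mul _ hm, lintegral_pi_prod (fun _ => P) fun _ => hΦ D,
      Finset.prod_const, Finset.card_univ, Fintype.card_coe, Finset.card_compl]
    calc _ = b ^ I.card * (Ψ D * (∫⁻ z, Φ D z ∂P) ^ (Fintype.card ι - I.card)) := by ring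
      _ ≤ _ := by gcongr; exact hc D
  refine (lintegral_mono fun y => key _).trans ?_
  simp

/-- The reciprocal of a mean is at most the mean of the reciprocal. -/
theorem inv_lintegral_le_lintegral_inv {Ω : Type*} [MeasurableSpace Ω] (q : Measure Ω)
    [IsProbabilityMeasure q] {f : Ω → ℝ≥0∞} (hf : Measurable f) (h0 : ∀ x, f x ≠ 0)
    (htop : ∀ x, f x ≠ ∞) : (∫⁻ x, f x ∂q)⁻¹ ≤ ∫⁻ x, (f x)⁻¹ ∂q := by
  -- Cauchy–Schwarz for `1 = f^(1/2) · f^(-1/2)`.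
  have hH := ENNReal.lintegral_mul_le_Lp_mul_Lq q Real.HolderConjugate.two_two
    (f := fun x => f x ^ (1 / 2 : ℝ)) (g := fun x => (f x)⁻¹ ^ (1 / 2 : ℝ))
    (hf.pow_const _).aemeasurable (hf.inv.pow_const _).aemeasurable
  have h1 : ∀ x, f x ^ (1 / 2 : ℝ) * (f x)⁻¹ ^ (1 / 2 : ℝ) = 1 := fun x => by
    rw [← ENNReal.mul_rpow_of_nonneg _ _ (by norm_num), ENNReal.mul_inv_cancel (h0 x) (htop x),
      ENNReal.one_rpow]
  have h2 : ∀ t : ℝ≥0∞, (t ^ (1 / 2 : ℝ)) ^ (2 : ℝ) = t := fun t => by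
    rw [← ENNReal.rpow_mul]; norm_num
  simp only [Pi.mul_apply, h1, h2, lintegral_one, measure_univ] at hH
  rw [← ENNReal.mul_rpow_of_nonneg _ _ (by norm_num)] at hH
  have h3 : 1 ≤ (∫⁻ x, f x ∂q) * ∫⁻ x, (f x)⁻¹ ∂q := by
    by_contra hlt
    exact absurd hH (not_le.2 (ENNReal.rpow_lt_one (not_le.1 hlt) (by norm_num)))
  have hA0 : ∫⁻ x, f x ∂q ≠ 0 := fun h => by simp [h] at h3
  by_cases hA : ∫⁻ x, f x ∂q = ∞
  · simp [hA]
  calc (∫⁻ x, f x ∂q)⁻¹ ≤ (∫⁻ x, f x ∂q)⁻¹ * ((∫⁻ x, f x ∂q) * ∫⁻ x, (f x)⁻¹ ∂q) := by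
        conv_lhs => rw [← mul_one (∫⁻ x, f x ∂q)⁻¹]
        gcongr
    _ = _ := by rw [← mul_assoc, ENNReal.inv_mul_cancel hA0 hA, one_mul]

/-! ### Tree partitions: coding of the cells and valid dyadic refinement. -/

section Tree

variable {m : ℕ}

theorem IsTreePartition.finite {obs : Fin m → Set ℝ} {S : Finset (Fin m)}
    {P : Set (Set (Fin m → ℝ))} (h : IsTreePartition obs S P) : P.Finite := by
  induction h with
  | root => exact Set.finite_singleton _
  | split h hΩ j hc ih => exact ih.sdiff.union (by simp)

theorem IsTreePartition.eq_of_mem {obs : Fin m → Set ℝ} {S : Finset (Fin m)}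
    {P : Set (Set (Fin m → ℝ))} (h : IsTreePartition obs S P) :
    ∀ Ω ∈ P, ∀ Ω' ∈ P, ∀ x ∈ Ω, x ∈ Ω' → Ω = Ω' := by
  induction h with
  | root => rintro Ω rfl Ω' rfl x _ _; rfl
  | @split S P h Ω₀ hΩ j c hc ih =>
    have hlt : ∀ {x : Fin m → ℝ}, x j ≤ c → ¬ c < x j := fun h => not_lt.2 h
    rintro Ω (⟨h1, hn1⟩ | rfl | rfl) Ω' (⟨h2, hn2⟩ | rfl | rfl) x hx hx'
    · exact ih _ h1 _ h2 x hx hx'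
    · exact absurd (ih _ h1 _ hΩ x hx hx'.1) hn1
    · exact absurd (ih _ h1 _ hΩ x hx hx'.1) hn1
    · exact absurd (ih _ h2 _ hΩ x hx' hx.1) hn2
    · rfl
    · exact absurd hx'.2 (hlt hx.2)
    · exact absurd (ih _ h2 _ hΩ x hx' hx.1) hn2
    · exact absurd hx.2 (hlt hx'.2)
    · rfl

variable {ι : Type*}

/-- A box whose sides are given by the coordinates of points of a design. -/
abbrev BoxCode (ι : Type*) (m : ℕ) : Type _ := Fin m → Option ι × Option ι

/-- The box with the given code in the design `z`. -/
def codeBox (z : ι → Fin m → ℝ) (c : BoxCode ι m) : Set (Fin m → ℝ) :=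
  {x | x ∈ unitCube m ∧ ∀ k, (∀ q ∈ (c k).1, z q k < x k) ∧ ∀ q ∈ (c k).2, x k ≤ z q k}

/-- Of two upper bounds for one coordinate only the smaller is active, so one index per side
suffices however often the coordinate is split. -/
theorem exists_codeBox_inter_le (z : ι → Fin m → ℝ) (c : BoxCode ι m) (j : Fin m) (q : ι) :
    ∃ c', codeBox z c ∩ {x | x j ≤ z q j} = codeBox z c' := by
  classical
  by_cases hkeep : ∃ q' ∈ (c j).2, z q' j ≤ z q j
  · obtain ⟨q', hq', hle⟩ := hkeep
    refine ⟨c, Set.inter_eq_left.2 fun x hx => ((hx.2 j).2 q' hq').trans hle⟩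
  · push Not at hkeep
    refine ⟨Function.update c j ((c j).1, some q), ?_⟩
    ext x
    simp only [codeBox, Set.mem_inter_iff, Set.mem_ofPred_eq, and_assoc]
    refine and_congr_right fun _ => ⟨fun ⟨h, hj⟩ k => ?_, fun h => ⟨fun k => ?_, ?_⟩⟩
    · by_cases hk : k = j
      · subst hk
        simpa using ⟨fun q hq => (h k).1 q hq, hj⟩
      · simpa [hk] using h k
    · by_cases hk : k = j
      · subst hk
        have hk' := h k
        simp only [Function.update_self] at hk'
        exact ⟨hk'.1, fun q' hq' => (hk'.2 q rfl).trans (hkeep q' hq').le⟩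
      · simpa [hk] using h k
    · have hj := h j
      simp only [Function.update_self] at hj
      exact hj.2 q rfl

theorem exists_codeBox_inter_lt (z : ι → Fin m → ℝ) (c : BoxCode ι m) (j : Fin m) (q : ι) :
    ∃ c', codeBox z c ∩ {x | z q j < x j} = codeBox z c' := by
  classical
  by_cases hkeep : ∃ q' ∈ (c j).1, z q j ≤ z q' j
  · obtain ⟨q', hq', hle⟩ := hkeep
    refine ⟨c, Set.inter_eq_left.2 fun x hx => hle.trans_lt ((hx.2 j).1 q' hq')⟩
  · push Not at hkeep
    refine ⟨Function.update c j (some q, (c j).2), ?_⟩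
    ext x
    simp only [codeBox, Set.mem_inter_iff, Set.mem_ofPred_eq, and_assoc]
    refine and_congr_right fun _ => ⟨fun ⟨h, hj⟩ k => ?_, fun h => ⟨fun k => ?_, ?_⟩⟩
    · by_cases hk : k = j
      · subst hk
        simpa using ⟨hj, fun q hq => (h k).2 q hq⟩
      · simpa [hk] using h k
    · by_cases hk : k = j
      · subst hk
        have hk' := h k
        simp only [Function.update_self] at hk'
        exact ⟨fun q' hq' => (hkeep q' hq').trans (hk'.1 q rfl), hk'.2⟩
      · simpa [hk] using h k
    · have hj := h j
      simp only [Function.update_self] at hj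
      exact hj.1 q rfl

theorem IsTreePartition.exists_code {z : ι → Fin m → ℝ} {S : Finset (Fin m)}
    {P : Set (Set (Fin m → ℝ))}
    (h : IsTreePartition (fun k => Set.range fun q => z q k) S P) :
    ∀ Ω ∈ P, ∃ c, Ω = codeBox z c := by
  induction h with
  | root =>
    rintro Ω rfl
    exact ⟨fun _ => (none, none), by simp [codeBox]⟩
  | @split S P h Ω₀ hΩ j c hc ih =>
    obtain ⟨q, rfl⟩ := hc
    obtain ⟨c₀, rfl⟩ := ih _ hΩ
    rintro Ω (⟨h', -⟩ | rfl | rfl)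
    · exact ih _ h'
    · exact exists_codeBox_inter_le z c₀ j q
    · exact exists_codeBox_inter_lt z c₀ j q

/-- Refining one cell of a tree partition by successive halvings of the coordinates in `l`.
Halves with fewer than `N` points are not split off, and their points are discarded. -/
theorem IsTreePartition.exists_refine [Fintype ι] [DecidableEq ι] (z : ι → Fin m → ℝ) (N : ℕ) (hN : 0 < N)
    (l : List (Fin m)) :
    ∀ (S : Finset (Fin m)) (P : Set (Set (Fin m → ℝ))) (Ω : Set (Fin m → ℝ)) (G : Finset ι)
      (v len : Fin m → ℝ), IsTreePartition (fun k => Set.range fun q => z q k) S P → Ω ∈ P →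
      (∀ Ω' ∈ P, N ≤ Set.ncard {q | z q ∈ Ω'}) →
      (∀ q ∈ G, z q ∈ Ω ∧ ∀ k, v k ≤ z q k ∧ z q k ≤ v k + len k) →
      ∃ (S' : Finset (Fin m)) (P' : Set (Set (Fin m → ℝ))) (G' : Finset ι),
        IsTreePartition (fun k => Set.range fun q => z q k) S' P' ∧
        (∀ Ω' ∈ P', N ≤ Set.ncard {q | z q ∈ Ω'}) ∧
        P'.ncard + 1 ≤ P.ncard + 2 ^ l.length ∧
        (∀ Ω' ∈ P', Ω' ∈ P \ {Ω} ∨ Ω' ⊆ Ω) ∧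
        (∀ Ω' ∈ P, Disjoint Ω' Ω → Ω' ∈ P') ∧
        G' ⊆ G ∧ (G \ G').card + N ≤ N * 2 ^ l.length ∧
        ∀ Ω' ∈ P', ∀ q ∈ G', ∀ q' ∈ G', z q ∈ Ω' → z q' ∈ Ω' →
          ∀ k, |z q k - z q' k| ≤ len k / 2 ^ l.count k := by
  -- The terms `+ 1` and `+ N` make the two counts additive over halves: both the number of new
  -- cells and the number of discarded points, divided by `N`, are at most the number `2 ^ l.length
  -- - 1` of internal nodes of a full binary tree.
  induction l with
  | nil =>
    intro S P Ω G v len hP hΩ hval hG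
    refine ⟨S, P, G, hP, hval, by simp, fun Ω' h => ?_, fun Ω' h _ => h, subset_rfl, by simp, ?_⟩
    · by_cases he : Ω' = Ω
      · exact Or.inr he.subset
      · exact Or.inl ⟨h, he⟩
    · intro Ω' _ q hq q' hq' _ _ k
      have h1 := (hG q hq).2 k
      have h2 := (hG q' hq').2 k
      simp only [List.count_nil, pow_zero, div_one, abs_le]
      constructor <;> linarith [h1.1, h1.2, h2.1, h2.2]
  | cons j l ih =>
    intro S P Ω G v len hP hΩ hval hG
    have hlen : ∀ k, Function.update len j (len j / 2) k / 2 ^ l.count k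
        = len k / 2 ^ (j :: l).count k := by
      intro k
      by_cases hk : k = j
      · subst hk
        rw [Function.update_self, List.count_cons_self, pow_succ]
        field_simp
      · rw [Function.update_of_ne hk, List.count_cons_of_ne (Ne.symm hk)]
    have hpow : 1 ≤ 2 ^ l.length := Nat.one_le_two_pow
    -- The points are sorted by the midpoint of the enclosing box, which need not be an observed
    -- value; the box encloses the retained points and not the cell.
    set G₁ := G.filter fun q => z q j ≤ v j + len j / 2 with hG₁
    set G₂ := G.filter fun q => ¬ z q j ≤ v j + len j / 2 with hG₂
    have hcard : G₁.card + G₂.card = G.card := Finset.card_filter_add_card_filter_not _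
    have hsub₁ : G₁ ⊆ G := Finset.filter_subset _ _
    have hsub₂ : G₂ ⊆ G := Finset.filter_subset _ _
    have hbox₁ : ∀ q ∈ G₁, ∀ k, v k ≤ z q k ∧
        z q k ≤ v k + Function.update len j (len j / 2) k := by
      intro q hq k
      obtain ⟨hqG, hqj⟩ := Finset.mem_filter.1 hq
      by_cases hk : k = j
      · subst hk
        rw [Function.update_self]
        exact ⟨((hG q hqG).2 k).1, hqj⟩
      · rw [Function.update_of_ne hk]; exact (hG q hqG).2 k
    have hbox₂ : ∀ q ∈ G₂, ∀ k, Function.update v j (v j + len j / 2) k ≤ z q k ∧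
        z q k ≤ Function.update v j (v j + len j / 2) k
          + Function.update len j (len j / 2) k := by
      intro q hq k
      obtain ⟨hqG, hqj⟩ := Finset.mem_filter.1 hq
      by_cases hk : k = j
      · subst hk
        simp only [Function.update_self]
        exact ⟨(not_le.1 hqj).le, by linarith [((hG q hqG).2 k).2]⟩
      · simp only [Function.update_of_ne hk]; exact (hG q hqG).2 k
    -- If one half holds fewer than `N` retained points, these are forgotten and the cell is kept
    -- whole; the recursion continues with the other half.
    have hdiscard : ∀ (A B : Finset ι), A ⊆ G → (∀ q ∈ G, q ∉ A → q ∈ B) → B.card < N →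
        (∃ v' : Fin m → ℝ, ∀ q ∈ A, z q ∈ Ω ∧ ∀ k, v' k ≤ z q k ∧
          z q k ≤ v' k + Function.update len j (len j / 2) k) →
        ∃ (S' : Finset (Fin m)) (P' : Set (Set (Fin m → ℝ))) (G' : Finset ι),
        IsTreePartition (fun k => Set.range fun q => z q k) S' P' ∧
        (∀ Ω' ∈ P', N ≤ Set.ncard {q | z q ∈ Ω'}) ∧
        P'.ncard + 1 ≤ P.ncard + 2 ^ (j :: l).length ∧
        (∀ Ω' ∈ P', Ω' ∈ P \ {Ω} ∨ Ω' ⊆ Ω) ∧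
        (∀ Ω' ∈ P, Disjoint Ω' Ω → Ω' ∈ P') ∧
        G' ⊆ G ∧ (G \ G').card + N ≤ N * 2 ^ (j :: l).length ∧
        ∀ Ω' ∈ P', ∀ q ∈ G', ∀ q' ∈ G', z q ∈ Ω' → z q' ∈ Ω' →
          ∀ k, |z q k - z q' k| ≤ len k / 2 ^ (j :: l).count k := by
      rintro A B hAG hAB hB ⟨v', hv'⟩
      obtain ⟨S', P', G', h1, h2, h3, h4, h5, h6, h7, h8⟩ := ih S P Ω A v' _ hP hΩ hval hv'
      refine ⟨S', P', G', h1, h2, ?_, h4, h5, h6.trans hAG, ?_, ?_⟩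
      · rw [List.length_cons, pow_succ]; omega
      · have hsubset : G \ G' ⊆ B ∪ (A \ G') := by
          intro q hq
          obtain ⟨hq1, hq2⟩ := Finset.mem_sdiff.1 hq
          by_cases hqA : q ∈ A
          · exact Finset.mem_union_right _ (Finset.mem_sdiff.2 ⟨hqA, hq2⟩)
          · exact Finset.mem_union_left _ (hAB q hq1 hqA)
        have hle := (Finset.card_le_card hsubset).trans (Finset.card_union_le _ _)
        rw [List.length_cons, pow_succ]
        nlinarith
      · simpa only [hlen] using h8
    by_cases hc₁ : G₁.card < N
    · refine hdiscard G₂ G₁ hsub₂ (fun q hq hq' => ?_) hc₁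
        ⟨_, fun q hq => ⟨(hG q (hsub₂ hq)).1, hbox₂ q hq⟩⟩
      by_contra hcon
      exact hq' (Finset.mem_filter.2 ⟨hq, fun hle => hcon (Finset.mem_filter.2 ⟨hq, hle⟩)⟩)
    by_cases hc₂ : G₂.card < N
    · refine hdiscard G₁ G₂ hsub₁ (fun q hq hq' => ?_) hc₂
        ⟨_, fun q hq => ⟨(hG q (hsub₁ hq)).1, hbox₁ q hq⟩⟩
      exact Finset.mem_filter.2 ⟨hq, fun hle => hq' (Finset.mem_filter.2 ⟨hq, hle⟩)⟩
    push Not at hc₁ hc₂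
    -- The largest observed coordinate in the lower half is an admissible split value and separates
    -- the retained points exactly as the midpoint does.
    obtain ⟨q₀, hq₀, hmax⟩ := Finset.exists_max_image G₁ (fun q => z q j)
      (Finset.card_pos.1 (hN.trans_le hc₁))
    set c := z q₀ j with hc
    have hc_le : c ≤ v j + len j / 2 := (Finset.mem_filter.1 hq₀).2
    set Ω₁ := Ω ∩ {x | x j ≤ c} with hΩ₁
    set Ω₂ := Ω ∩ {x | c < x j} with hΩ₂
    have hmem₁ : ∀ q ∈ G₁, z q ∈ Ω₁ := fun q hq => ⟨(hG q (hsub₁ hq)).1, hmax q hq⟩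
    have hmem₂ : ∀ q ∈ G₂, z q ∈ Ω₂ := fun q hq => ⟨(hG q (hsub₂ hq)).1,
      hc_le.trans_lt (not_le.1 (Finset.mem_filter.1 hq).2)⟩
    have hdisj : Disjoint Ω₁ Ω₂ :=
      Set.disjoint_left.2 fun x hx hx' => (not_lt.2 hx.2 : ¬ c < x j) hx'.2
    have hcount : ∀ (A : Finset ι) (Ω' : Set (Fin m → ℝ)), (∀ q ∈ A, z q ∈ Ω') → N ≤ A.card →
        N ≤ Set.ncard {q | z q ∈ Ω'} := fun A Ω' hA hNA => by
      rw [← Set.ncard_coe_finset] at hNA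
      exact hNA.trans (Set.ncard_le_ncard hA (Set.toFinite _))
    have hP₁ := IsTreePartition.split hP hΩ j (c := c) ⟨q₀, rfl⟩
    rw [← hΩ₁, ← hΩ₂] at hP₁
    set P₁ := (P \ {Ω}) ∪ {Ω₁, Ω₂} with hP₁def
    have hval₁ : ∀ Ω' ∈ P₁, N ≤ Set.ncard {q | z q ∈ Ω'} := by
      rintro Ω' (h | rfl | rfl)
      · exact hval _ h.1
      · exact hcount G₁ _ hmem₁ hc₁
      · exact hcount G₂ _ hmem₂ hc₂
    have hP₁card : P₁.ncard ≤ P.ncard + 1 := by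
      have h1 : (P \ {Ω}).ncard + 1 = P.ncard :=
        Set.ncard_sdiff_singleton_add_one hΩ hP.finite
      have h2 : ({Ω₁, Ω₂} : Set (Set (Fin m → ℝ))).ncard ≤ 2 := by
        refine (Set.ncard_insert_le _ _).trans ?_
        simp
      have h3 : P₁.ncard ≤ _ := Set.ncard_union_le (P \ {Ω}) {Ω₁, Ω₂}
      omega
    obtain ⟨S', P', G₁', a1, a2, a3, a4, a5, a6, a7, a8⟩ := ih _ P₁ Ω₁ G₁ v _ hP₁
      (Or.inr (Or.inl rfl)) hval₁ fun q hq => ⟨hmem₁ q hq, hbox₁ q hq⟩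
    -- The second half is refined inside the partition produced by the first refinement, where `Ω₂`
    -- survives because it is disjoint from `Ω₁`.
    obtain ⟨S'', P'', G₂', b1, b2, b3, b4, b5, b6, b7, b8⟩ := ih _ P' Ω₂ G₂ _ _ a1
      (a5 Ω₂ (Or.inr (Or.inr rfl)) hdisj.symm) a2 fun q hq => ⟨hmem₂ q hq, hbox₂ q hq⟩
    have hcell : ∀ Ω' ∈ P'', Ω' ∈ P \ {Ω} ∨ Ω' ⊆ Ω₁ ∧ Ω' ∈ P' ∨ Ω' ⊆ Ω₂ := by
      intro Ω' h
      rcases b4 Ω' h with ⟨h', hne⟩ | h'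
      · rcases a4 Ω' h' with ⟨h'' | rfl | rfl, hne'⟩ | h''
        · exact Or.inl h''
        · exact absurd rfl hne'
        · exact absurd rfl hne
        · exact Or.inr (Or.inl ⟨h'', h'⟩)
      · exact Or.inr (Or.inr h')
    have hnotin : ∀ Ω' ∈ P \ {Ω}, ∀ x ∈ Ω, x ∉ Ω' := fun Ω' h x hx hx' =>
      h.2 (hP.eq_of_mem Ω' h.1 Ω hΩ x hx' hx)
    refine ⟨S'', P'', G₁' ∪ G₂', b1, b2, ?_, ?_, ?_,
      Finset.union_subset (a6.trans hsub₁) (b6.trans hsub₂), ?_, ?_⟩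
    · rw [List.length_cons, pow_succ]; omega
    · intro Ω' h
      rcases hcell Ω' h with h | h | h
      · exact Or.inl h
      · exact Or.inr (h.1.trans Set.inter_subset_left)
      · exact Or.inr (h.trans Set.inter_subset_left)
    · intro Ω' h hd
      -- Only the empty set is disjoint from itself, and `Ω` contains a point of the design.
      have hne : Ω' ≠ Ω := by
        rintro rfl
        rw [disjoint_self] at hd
        have := hmem₁ q₀ hq₀
        rw [hΩ₁, hd] at this
        exact this.1
      exact b5 _ (a5 _ (Or.inl ⟨h, hne⟩) (hd.mono_right Set.inter_subset_left))
        (hd.mono_right Set.inter_subset_left)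
    · have hsubset : G \ (G₁' ∪ G₂') ⊆ (G₁ \ G₁') ∪ (G₂ \ G₂') := by
        intro q hq
        obtain ⟨hq1, hq2⟩ := Finset.mem_sdiff.1 hq
        rw [Finset.mem_union, not_or] at hq2
        by_cases hle : z q j ≤ v j + len j / 2
        · exact Finset.mem_union_left _
            (Finset.mem_sdiff.2 ⟨Finset.mem_filter.2 ⟨hq1, hle⟩, hq2.1⟩)
        · exact Finset.mem_union_right _
            (Finset.mem_sdiff.2 ⟨Finset.mem_filter.2 ⟨hq1, hle⟩, hq2.2⟩)
      have hle := (Finset.card_le_card hsubset).trans (Finset.card_union_le _ _)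
      rw [List.length_cons, pow_succ]
      nlinarith
    · intro Ω' h q hq q' hq' hqΩ hq'Ω k
      rw [← hlen k]
      have hin : ∀ q ∈ G₁' ∪ G₂', z q ∈ Ω := fun q hq => by
        rcases Finset.mem_union.1 hq with h | h
        · exact (hmem₁ q (a6 h)).1
        · exact (hmem₂ q (b6 h)).1
      have hside₁ : ∀ q ∈ G₁' ∪ G₂', z q ∈ Ω₁ → q ∈ G₁' := fun q hq hΩ => by
        rcases Finset.mem_union.1 hq with h | h
        · exact h
        · exact absurd hΩ (Set.disjoint_right.1 hdisj (hmem₂ q (b6 h)))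
      have hside₂ : ∀ q ∈ G₁' ∪ G₂', z q ∈ Ω₂ → q ∈ G₂' := fun q hq hΩ => by
        rcases Finset.mem_union.1 hq with h | h
        · exact absurd hΩ (Set.disjoint_left.1 hdisj (hmem₁ q (a6 h)))
        · exact h
      rcases hcell Ω' h with h' | h' | h'
      · exact absurd hqΩ (hnotin Ω' h' _ (hin q hq))
      · exact a8 Ω' h'.2 q (hside₁ q hq (h'.1 hqΩ)) q' (hside₁ q' hq' (h'.1 hq'Ω)) hqΩ hq'Ω k
      · exact b8 Ω' h q (hside₂ q hq (h' hqΩ)) q' (hside₂ q' hq' (h' hq'Ω)) hqΩ hq'Ω k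

/-- A valid tree partition with at most `2 ^ (a * m)` cells, which up to few exceptions separates
the points of the design at the scale `2 ^ (-a)`. -/
theorem exists_isTreePartition_fine [Fintype ι] [DecidableEq ι] (z : ι → Fin m → ℝ)
    (hz : ∀ q, z q ∈ unitCube m) (N : ℕ) (hN : 0 < N) (hcard : N ≤ Fintype.card ι) (a : ℕ) :
    ∃ (S : Finset (Fin m)) (P : Set (Set (Fin m → ℝ))) (G : Finset ι),
      IsTreePartition (fun k => Set.range fun q => z q k) S P ∧
      (∀ Ω ∈ P, N ≤ Set.ncard {q | z q ∈ Ω}) ∧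
      P.ncard ≤ 2 ^ (a * m) ∧ Gᶜ.card ≤ N * 2 ^ (a * m) ∧
      ∀ Ω ∈ P, ∀ q ∈ G, ∀ q' ∈ G, z q ∈ Ω → z q' ∈ Ω → ∀ k, |z q k - z q' k| ≤ (1 / 2) ^ a := by
  -- Every coordinate is halved `a` times.
  let l : List (Fin m) := (List.replicate a (List.finRange m)).flatten
  have hlen : l.length = a * m := by simp [l]
  have hcount : ∀ k, l.count k = a := fun k => by
    simp [l, List.count_flatten, List.count_eq_one_of_mem (List.nodup_finRange m)]
  obtain ⟨S, P, G, h1, h2, h3, -, -, -, h7, h8⟩ := IsTreePartition.exists_refine z N hN l ∅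
    {unitCube m} (unitCube m) Finset.univ 0 1 IsTreePartition.root rfl
    (by
      rintro Ω rfl
      have : {q | z q ∈ unitCube m} = Set.univ := Set.eq_univ_of_forall hz
      rw [this, Set.ncard_univ, Nat.card_eq_fintype_card]
      exact hcard)
    (fun q _ => ⟨hz q, fun k => ⟨(hz q).1 k, by simpa using (hz q).2 k⟩⟩)
  refine ⟨S, P, G, h1, h2, ?_, ?_, ?_⟩
  · rw [hlen, Set.ncard_singleton] at h3; omega
  · rw [hlen, ← Finset.compl_eq_univ_sdiff] at h7; omega
  · simpa [hcount] using h8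

end Tree

/-! ### Measurability on the space of step functions, one family of cells at a time. -/

section StepParam

variable {m : ℕ}

/-- The step function with cells `T` and heights `β`. -/
abbrev stepMk (T : Finset (Set (Fin m → ℝ))) : (T → ℝ) → StepParam m := fun β => ⟨T, β⟩

theorem measurable_stepMk (T : Finset (Set (Fin m → ℝ))) : Measurable (stepMk T) :=
  fun _ hs => MeasurableSpace.measurableSet_iInf.1 hs T

theorem measurableSet_of_stepMk {s : Set (StepParam m)}
    (h : ∀ T, MeasurableSet (stepMk T ⁻¹' s)) : MeasurableSet s :=
  MeasurableSpace.measurableSet_iInf.2 h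

theorem measurable_of_stepMk {E : Type*} [MeasurableSpace E] {f : StepParam m → E}
    (h : ∀ T, Measurable fun β => f (stepMk T β)) : Measurable f :=
  fun _ hs => measurableSet_of_stepMk fun T => h T hs

theorem continuous_stepFun_mk (T : Finset (Set (Fin m → ℝ))) (x : Fin m → ℝ) :
    Continuous fun β => stepFun (stepMk T β) x := by
  classical
  have : (fun β => stepFun (stepMk T β) x) =
      fun β : T → ℝ => ∑ Ω : T, if x ∈ (Ω : Set (Fin m → ℝ)) then β Ω else 0 := by
    funext β; simp [stepFun, Set.indicator_apply]
  rw [this]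
  refine continuous_finsetSum _ fun Ω _ => ?_
  split_ifs
  · exact continuous_apply Ω
  · exact continuous_const

theorem measurable_stepFun (x : Fin m → ℝ) : Measurable fun θ : StepParam m => stepFun θ x :=
  measurable_of_stepMk fun T => (continuous_stepFun_mk T x).measurable

theorem measurableSet_boundedSteps (L : ℝ) : MeasurableSet (boundedSteps m L) := by
  refine measurableSet_of_stepMk fun T => IsClosed.measurableSet ?_
  have : (stepMk T ⁻¹' boundedSteps m L) =
      ⋂ x ∈ unitCube m, {β : T → ℝ | |stepFun ⟨T, β⟩ x| ≤ L} := by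
    ext β; simp [boundedSteps]
  rw [this]
  exact isClosed_biInter fun x _ =>
    isClosed_le (continuous_stepFun_mk T x).abs continuous_const

theorem stepFun_eq_of_mem {T : Finset (Set (Fin m → ℝ))}
    (hT : ∀ Ω ∈ T, ∀ Ω' ∈ T, ∀ x ∈ Ω, x ∈ Ω' → Ω = Ω') (β : T → ℝ) (Ω : T) {x : Fin m → ℝ}
    (hx : x ∈ (Ω : Set (Fin m → ℝ))) : stepFun ⟨T, β⟩ x = β Ω := by
  simp only [stepFun]
  rw [Finset.sum_eq_single Ω]
  · exact Set.indicator_of_mem hx _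
  · intro Ω' _ hne
    refine Set.indicator_of_notMem (fun hx' => hne ?_) _
    exact Subtype.ext (hT _ Ω'.2 _ Ω.2 x hx' hx)
  · intro h; exact absurd (Finset.mem_univ _) h

theorem stepFun_eq_zero {T : Finset (Set (Fin m → ℝ))} (β : T → ℝ) {x : Fin m → ℝ}
    (hx : ∀ Ω ∈ T, x ∉ Ω) : stepFun ⟨T, β⟩ x = 0 :=
  Finset.sum_eq_zero fun Ω _ => Set.indicator_of_notMem (hx _ Ω.2) _

end StepParam

/-! ### The prior on a given design: coding, counting, Fubini, and the posterior as a ratio. -/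

section Design

variable {d n r : ℕ}

theorem designPoint_congr {D D' : Sample d n} (τ : Fin r → ℝ) (h : ∀ i, (D i).1 = (D' i).1) :
    designPoint D τ = designPoint D' τ := by
  funext ij
  simp [designPoint, h]

theorem validPartitions_congr (h : PriorParams) {D D' : Sample d n} (τ : Fin r → ℝ)
    (hD : ∀ i, (D i).1 = (D' i).1) : validPartitions h D τ = validPartitions h D' τ := by
  have hz := designPoint_congr τ hD
  have hobs : observed D τ = observed D' τ := by
    funext k; simp only [observed, hz]
  funext S K
  simp only [validPartitions, hz, hobs]

/-- Neither the split values nor validity involve the responses. Given the covariates the prior is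
therefore a fixed measure, and can be interchanged with the integral over the responses. -/
theorem rawPrior_congr (h : PriorParams) {D D' : Sample d n} (τ : Fin r → ℝ)
    (hD : ∀ i, (D i).1 = (D' i).1) : rawPrior h D τ = rawPrior h D' τ := by
  unfold rawPrior
  rw [validPartitions_congr h τ hD]

theorem designPoint_mem_unitCube {D : Sample d n} {τ : Fin r → ℝ}
    (hτ : ∀ j, τ j ∈ Set.Ioo (0 : ℝ) 1) (hD : ∀ i, (D i).1 ∈ unitCube d) (ij : Fin n × Fin r) :
    designPoint D τ ij ∈ unitCube (d + 1) := by
  constructor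
  · intro k
    refine Fin.lastCases ?_ (fun k => ?_) k
    · simpa [designPoint] using (hτ ij.2).1.le
    · simpa [designPoint] using (hD ij.1).1 k
  · intro k
    refine Fin.lastCases ?_ (fun k => ?_) k
    · simpa [designPoint] using (hτ ij.2).2.le
    · simpa [designPoint] using (hD ij.1).2 k

/-- A partition that splits at design values is the family of the boxes of some codes. -/
theorem exists_codes_of_mem_validPartitions (h : PriorParams) (D : Sample d n) (τ : Fin r → ℝ)
    {S : Finset (Fin (d + 1))} {K : ℕ} {T : Finset (Set (Fin (d + 1) → ℝ))}
    (hT : T ∈ validPartitions h D τ S K) :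
    ∃ (c : Fin K → BoxCode (Fin n × Fin r) (d + 1)) (e : Fin K ≃ T),
      ∀ k, (e k : Set (Fin (d + 1) → ℝ)) = codeBox (designPoint D τ) (c k) := by
  obtain ⟨hK, htree, -⟩ := hT
  have hcode : ∀ Ω ∈ (T : Set (Set (Fin (d + 1) → ℝ))), ∃ c, Ω = codeBox (designPoint D τ) c :=
    IsTreePartition.exists_code htree
  have e : Fin K ≃ T := (finCongr hK.symm).trans T.equivFin.symm
  choose c hc using fun k => hcode (e k) (e k).2
  exact ⟨c, e, hc⟩

theorem card_boxCode (ι : Type*) [Fintype ι] (m : ℕ) :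
    Fintype.card (BoxCode ι m) = ((Fintype.card ι + 1) ^ 2) ^ m := by
  simp [BoxCode, sq]

/-- The codes of the cells determine the cells, hence the partition. Injectivity serves twice: to
count partitions, and to replace a sum over data-dependent partitions by one over a fixed set of
codes. -/
theorem exists_injective_code (h : PriorParams) (D : Sample d n) (τ : Fin r → ℝ)
    (S : Finset (Fin (d + 1))) (K : ℕ) :
    ∃ c : validPartitions h D τ S K → Fin K → BoxCode (Fin n × Fin r) (d + 1),
      Function.Injective c ∧ ∀ T : validPartitions h D τ S K,
        ∃ e : Fin K ≃ (T : Finset (Set (Fin (d + 1) → ℝ))),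
        ∀ k, (e k : Set (Fin (d + 1) → ℝ)) = codeBox (designPoint D τ) (c T k) := by
  have hex := fun T : validPartitions h D τ S K =>
    exists_codes_of_mem_validPartitions h D τ T.2
  choose c e he using hex
  refine ⟨c, fun T T' hTT' => ?_, fun T => ⟨e T, he T⟩⟩
  have key : ∀ T T' : validPartitions h D τ S K, c T = c T' →
      ∀ Ω ∈ (T : Finset (Set (Fin (d + 1) → ℝ))), Ω ∈ (T' : Finset (Set (Fin (d + 1) → ℝ))) := by
    intro T T' hc Ω hΩ
    have h1 := he T ((e T).symm ⟨Ω, hΩ⟩)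
    rw [Equiv.apply_symm_apply, hc, ← he T'] at h1
    simp only at h1
    rw [h1]
    exact (e T' _).2
  exact Subtype.ext (Finset.ext fun Ω => ⟨key T T' hTT' Ω, key T' T hTT'.symm Ω⟩)

instance finite_validPartitions (h : PriorParams) (D : Sample d n) (τ : Fin r → ℝ)
    (S : Finset (Fin (d + 1))) (K : ℕ) : Finite (validPartitions h D τ S K) := by
  obtain ⟨c, hc, -⟩ := exists_injective_code h D τ S K
  exact Finite.of_injective c hc

theorem ncard_validPartitions_le (h : PriorParams) (D : Sample d n) (τ : Fin r → ℝ)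
    (S : Finset (Fin (d + 1))) (K : ℕ) :
    (validPartitions h D τ S K).ncard ≤ (((n * r + 1) ^ 2) ^ (d + 1)) ^ K := by
  obtain ⟨c, hc, -⟩ := exists_injective_code h D τ S K
  have := Nat.card_le_card_of_injective c hc
  rw [Nat.card_coe_set_eq] at this
  refine this.trans_eq ?_
  rw [Nat.card_eq_fintype_card, Fintype.card_fun, card_boxCode]
  simp

/-- The unnormalised prior weight of one valid partition with `K` cells. -/
noncomputable def cellWeight (h : PriorParams) (D : Sample d n) (τ : Fin r → ℝ)
    (S : Finset (Fin (d + 1))) (K : ℕ) : ℝ≥0∞ :=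
  ENNReal.ofReal (shellWeight h S K) * ((validPartitions h D τ S K).ncard : ℝ≥0∞)⁻¹

theorem lintegral_rawPrior (h : PriorParams) (D : Sample d n) (τ : Fin r → ℝ)
    {F : StepParam (d + 1) → ℝ≥0∞} (hF : Measurable F) :
    ∫⁻ θ, F θ ∂rawPrior h D τ = ∑ S, ∑' K, ∑' T : validPartitions h D τ S K,
      cellWeight h D τ S K * ∫⁻ β, F ⟨T, β⟩ ∂(Measure.pi fun _ => gaussianReal 0 h.variance) := by
  unfold rawPrior
  rw [lintegral_finsetSum_measure]
  refine Finset.sum_congr rfl fun S _ => ?_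
  rw [lintegral_sum_measure]
  refine tsum_congr fun K => ?_
  rw [lintegral_sum_measure]
  refine tsum_congr fun T => ?_
  rw [lintegral_smul_measure, smul_eq_mul]
  congr 1
  exact lintegral_map hF (measurable_stepMk _)

theorem measurable_lintegral_rawPrior (h : PriorParams) (D : Sample d n) (τ : Fin r → ℝ)
    {E : Type*} [MeasurableSpace E] {F : StepParam (d + 1) → E → ℝ≥0∞}
    (hF : ∀ T : Finset (Set (Fin (d + 1) → ℝ)),
      Measurable fun q : (T → ℝ) × E => F (stepMk T q.1) q.2) :
    Measurable fun y => ∫⁻ θ, F θ y ∂rawPrior h D τ := by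
  have h1 : ∀ y, Measurable fun θ => F θ y := fun y =>
    measurable_of_stepMk fun T => (hF T).comp measurable_prodMk_right
  simp only [lintegral_rawPrior h D τ (h1 _)]
  exact Finset.measurable_sum _ fun S _ => Measurable.tsum fun K =>
    Measurable.tsum fun T : validPartitions h D τ S K =>
      ((hF T.1).lintegral_prod_left').const_mul _

/-- The prior is a countable sum over families of cells, so joint measurability is only required for
each family separately. -/
theorem lintegral_lintegral_rawPrior_swap (h : PriorParams) (D : Sample d n) (τ : Fin r → ℝ)
    {E : Type*} [MeasurableSpace E] (P : Measure E) [SFinite P]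
    {F : StepParam (d + 1) → E → ℝ≥0∞}
    (hF : ∀ T : Finset (Set (Fin (d + 1) → ℝ)),
      Measurable fun q : (T → ℝ) × E => F (stepMk T q.1) q.2) :
    ∫⁻ y, ∫⁻ θ, F θ y ∂rawPrior h D τ ∂P = ∫⁻ θ, ∫⁻ y, F θ y ∂P ∂rawPrior h D τ := by
  have h1 : ∀ y, Measurable fun θ => F θ y := fun y =>
    measurable_of_stepMk fun T => (hF T).comp measurable_prodMk_right
  have h2 : Measurable fun θ => ∫⁻ y, F θ y ∂P :=
    measurable_of_stepMk fun T => (hF T).lintegral_prod_right'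
  have h3 : ∀ T : Finset (Set (Fin (d + 1) → ℝ)), Measurable fun y =>
      ∫⁻ β, F (stepMk T β) y ∂(Measure.pi fun _ : T => gaussianReal 0 h.variance) := fun T =>
    (hF T).lintegral_prod_left'
  rw [lintegral_rawPrior h D τ h2]
  simp only [lintegral_rawPrior h D τ (h1 _)]
  rw [lintegral_finsetSum _ fun S _ => Measurable.tsum fun K =>
    Measurable.tsum fun T : validPartitions h D τ S K => (h3 T.1).const_mul _]
  refine Finset.sum_congr rfl fun S _ => ?_
  rw [lintegral_tsum fun K => (Measurable.tsum fun T : validPartitions h D τ S K =>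
    (h3 T.1).const_mul _).aemeasurable]
  refine tsum_congr fun K => ?_
  rw [lintegral_tsum fun T : validPartitions h D τ S K => ((h3 T.1).const_mul _).aemeasurable]
  refine tsum_congr fun T => ?_
  rw [lintegral_const_mul _ (h3 T.1)]
  congr 1
  exact lintegral_lintegral_swap ((hF T.1).comp measurable_swap).aemeasurable

/-- The uniform weight on the valid partitions cancels their number, so a bound depending on `K`
alone costs no counting. -/
theorem lintegral_rawPrior_le (h : PriorParams) (D : Sample d n) (τ : Fin r → ℝ)
    {F : StepParam (d + 1) → ℝ≥0∞} (hF : Measurable F) (b : ℕ → ℝ≥0∞)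
    (hb : ∀ S K, ∀ T ∈ validPartitions h D τ S K,
      ∫⁻ β, F ⟨T, β⟩ ∂(Measure.pi fun _ => gaussianReal 0 h.variance) ≤ b K) :
    ∫⁻ θ, F θ ∂rawPrior h D τ
      ≤ ∑ S : Finset (Fin (d + 1)), ∑' K, ENNReal.ofReal (shellWeight h S K) * b K := by
  rw [lintegral_rawPrior h D τ hF]
  refine Finset.sum_le_sum fun S _ => ENNReal.tsum_le_tsum fun K => ?_
  calc _ ≤ ∑' T : validPartitions h D τ S K, cellWeight h D τ S K * b K :=
        ENNReal.tsum_le_tsum fun T => by gcongr; exact hb S K T T.2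
    _ = (validPartitions h D τ S K).ncard * (cellWeight h D τ S K * b K) := by
        rw [ENNReal.tsum_const, ENat.card_eq_coe_natCard, Nat.card_coe_set_eq]; rfl
    _ = ENNReal.ofReal (shellWeight h S K) * b K *
        ((validPartitions h D τ S K).ncard * ((validPartitions h D τ S K).ncard : ℝ≥0∞)⁻¹) := by
        rw [cellWeight]; ring
    _ ≤ ENNReal.ofReal (shellWeight h S K) * b K * 1 := by
        gcongr; exact ENNReal.mul_inv_le_one _
    _ = _ := mul_one _

/-- The Gibbs weight of a step function, relative to the reference predictions `m`. -/
noncomputable def gibbs (ω : ℝ) (D : Sample d n) (τ : Fin r → ℝ) (m : Fin n → Fin r → ℝ)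
    (θ : StepParam (d + 1)) : ℝ≥0∞ :=
  ENNReal.ofReal (Real.exp (-(ω * ∑ i,
    totalDiff τ (fun j => stepQuantile θ (D i).1 (τ j)) (m i) (D i).2)))

theorem measurable_totalDiff_left (τ m : Fin r → ℝ) :
    Measurable fun q : (Fin r → ℝ) × ℝ => totalDiff τ q.1 m q.2 := by
  unfold totalDiff lossDiff
  refine Finset.measurable_sum _ fun j _ => ?_
  exact ((measurable_checkLoss _).comp
    (measurable_snd.sub ((measurable_pi_apply j).comp measurable_fst))).sub
    ((measurable_checkLoss _).comp (measurable_snd.sub_const _))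

theorem measurable_gibbs (ω : ℝ) (D : Sample d n) (τ : Fin r → ℝ) (m : Fin n → Fin r → ℝ) :
    Measurable (gibbs ω D τ m) := by
  unfold gibbs
  refine (Real.measurable_exp.comp (Measurable.neg (Measurable.const_mul
    (Finset.measurable_sum _ fun i _ => ?_) ω))).ennreal_ofReal
  exact (measurable_totalDiff_left τ (m i)).comp
    ((measurable_pi_lambda _ fun j => measurable_stepFun _).prodMk measurable_const)

/-- The loss of the reference predictions and the normaliser of the prior do not depend on the step
function and cancel. Only loss differences, which are bounded, remain; no moment of the response is
needed. -/
theorem posterior_eq (h : PriorParams) (L ω : ℝ) (D : Sample d n) (τ : Fin r → ℝ)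
    (m : Fin n → Fin r → ℝ) (h0 : rawPrior h D τ (boundedSteps (d + 1) L) ≠ 0)
    (htop : rawPrior h D τ (boundedSteps (d + 1) L) ≠ ∞) :
    posterior h L ω D τ =
      (∫⁻ θ in boundedSteps (d + 1) L, gibbs ω D τ m θ ∂rawPrior h D τ)⁻¹ •
        ((rawPrior h D τ).restrict (boundedSteps (d + 1) L)).withDensity (gibbs ω D τ m) := by
  set k : ℝ≥0∞ :=
    ENNReal.ofReal (Real.exp (-(ω * ∑ i, ∑ j, checkLoss (τ j) ((D i).2 - m i j)))) with hk
  have hk0 : k ≠ 0 := by rw [hk]; simpa using Real.exp_pos _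
  have hktop : k ≠ ∞ := ENNReal.ofReal_ne_top
  have hdens : (fun θ => ENNReal.ofReal (Real.exp (-(ω * augmentedLoss D τ θ))))
      = k • gibbs ω D τ m := by
    funext θ
    rw [Pi.smul_apply, smul_eq_mul, hk, gibbs, ← ENNReal.ofReal_mul (Real.exp_pos _).le,
      ← Real.exp_add]
    congr 2
    simp only [augmentedLoss, totalDiff, lossDiff, Finset.sum_sub_distrib]
    ring
  set ρ := (rawPrior h D τ).restrict (boundedSteps (d + 1) L) with hρ
  have hprior : prior h L D τ = (rawPrior h D τ (boundedSteps (d + 1) L))⁻¹ • ρ := rfl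
  simp only [posterior]
  rw [hdens, hprior, withDensity_smul_measure, withDensity_smul' _ _ hktop, smul_smul]
  set c := (rawPrior h D τ (boundedSteps (d + 1) L))⁻¹ * k with hc
  have hc0 : c ≠ 0 := mul_ne_zero (ENNReal.inv_ne_zero.2 htop) hk0
  have hctop : c ≠ ∞ := ENNReal.mul_ne_top (ENNReal.inv_ne_top.2 h0) hktop
  rw [Measure.smul_apply, Measure.smul_apply, withDensity_apply _ MeasurableSet.univ, Measure.restrict_univ,
    smul_eq_mul, smul_eq_mul, ← mul_assoc, ← hc, ← smul_smul, smul_smul, smul_smul,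
    ENNReal.mul_inv (Or.inl hc0) (Or.inl hctop)]
  congr 1
  set G := (∫⁻ θ, gibbs ω D τ m θ ∂ρ)⁻¹
  set q := (rawPrior h D τ (boundedSteps (d + 1) L))⁻¹
  calc c⁻¹ * G * q * k = c⁻¹ * (q * k) * G := by ring
    _ = G := by rw [← hc, ENNReal.inv_mul_cancel hc0 hctop, one_mul]

end Design

theorem IsTreePartition.exists_mem {m : ℕ} {obs : Fin m → Set ℝ} {S : Finset (Fin m)}
    {P : Set (Set (Fin m → ℝ))} (h : IsTreePartition obs S P) :
    ∀ x ∈ unitCube m, ∃ Ω ∈ P, x ∈ Ω := by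
  induction h with
  | root => exact fun x hx => ⟨_, rfl, hx⟩
  | @split S P h Ω₀ hΩ j c hc ih =>
    intro x hx
    obtain ⟨Ω, hΩP, hxΩ⟩ := ih x hx
    by_cases he : Ω = Ω₀
    · subst he
      rcases le_or_gt (x j) c with hle | hlt
      · exact ⟨_, Or.inr (Or.inl rfl), hxΩ, hle⟩
      · exact ⟨_, Or.inr (Or.inr rfl), hxΩ, hlt⟩
    · exact ⟨Ω, Or.inl ⟨hΩP, he⟩, hxΩ⟩

/-- There are finitely many sets `S`, and the dependence on `K` is the Poisson weight. The lower
bound fails at `K = 0`, where the weight vanishes. -/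
theorem exists_shellWeight_bounds (h : PriorParams) (m : ℕ) :
    ∃ w > (0 : ℝ), ∃ W > (0 : ℝ), ∀ (S : Finset (Fin m)) (K : ℕ),
      (0 < K → w * (h.rate ^ K / K.factorial) ≤ shellWeight h S K) ∧
      shellWeight h S K ≤ W * (h.rate ^ K / K.factorial) := by
  let U : Finset (Fin m) → ℝ := fun S =>
    h.c ^ (-(S.card : ℝ)) * (m : ℝ) ^ (-(h.a * S.card)) * ((m.choose S.card : ℝ))⁻¹ /
      (Real.exp h.rate - 1)
  have hU : ∀ S, 0 < U S := fun S => by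
    have h1 : 0 < Real.exp h.rate - 1 := by
      have := Real.add_one_lt_exp h.rate_pos.ne'
      linarith [h.rate_pos]
    have h2 : (0 : ℝ) < m.choose S.card := by
      have := Finset.card_le_univ S
      rw [Fintype.card_fin] at this
      exact_mod_cast Nat.choose_pos this
    have h3 : (0 : ℝ) < (m : ℝ) ^ (-(h.a * S.card)) := by
      rcases Nat.eq_zero_or_pos m with hm | hm
      · subst hm
        have : S.card = 0 := by
          have := Finset.card_le_univ S
          rw [Fintype.card_fin] at this
          omega
        simp [this]
      · exact Real.rpow_pos_of_pos (by exact_mod_cast hm) _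
    have h4 := Real.rpow_pos_of_pos h.c_pos (-(S.card : ℝ))
    positivity
  have heq : ∀ S K, 0 < K → shellWeight h S K = U S * (h.rate ^ K / K.factorial) := by
    intro S K hK
    rw [shellWeight, if_neg hK.ne']
    simp only [U]
    field_simp
  obtain ⟨S₀, -, hS₀⟩ := Finset.exists_min_image (Finset.univ : Finset (Finset (Fin m))) U
    ⟨∅, Finset.mem_univ _⟩
  obtain ⟨S₁, -, hS₁⟩ := Finset.exists_max_image (Finset.univ : Finset (Finset (Fin m))) U
    ⟨∅, Finset.mem_univ _⟩
  refine ⟨U S₀, hU _, U S₁, hU _, fun S K => ?_⟩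
  have hnn : 0 ≤ h.rate ^ K / (K.factorial : ℝ) := by have := h.rate_pos; positivity
  refine ⟨fun hK => ?_, ?_⟩
  · rw [heq S K hK]
    exact mul_le_mul_of_nonneg_right (hS₀ S (Finset.mem_univ _)) hnn
  · rcases Nat.eq_zero_or_pos K with hK | hK
    · rw [shellWeight, if_pos hK]
      exact mul_nonneg (hU _).le hnn
    · rw [heq S K hK]
      exact mul_le_mul_of_nonneg_right (hS₁ S (Finset.mem_univ _)) hnn

/-- A Gaussian law gives mass at least of the order of their length to intervals in a bounded
range. -/
theorem exists_gaussianReal_Icc_ge {v : ℝ≥0} (hv : 0 < v) (M : ℝ) :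
    ∃ g > (0 : ℝ), ∀ b η, |b| ≤ M → 0 ≤ η → η ≤ 1 →
      ENNReal.ofReal (g * η) ≤ gaussianReal 0 v (Set.Icc (b - η) (b + η)) := by
  -- The constant in the next line is the least value of the density on `[-(M+1), M+1]`, which
  -- contains all the intervals since `η ≤ 1`.
  have hv' : (0 : ℝ) < v := hv
  refine ⟨(Real.sqrt (2 * Real.pi * v))⁻¹ * Real.exp (-(M + 1) ^ 2 / (2 * v)), by positivity,
    fun b η hb h0 h1 => ?_⟩
  set g := (Real.sqrt (2 * Real.pi * v))⁻¹ * Real.exp (-(M + 1) ^ 2 / (2 * v)) with hg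
  have hg0 : 0 < g := by positivity
  rw [gaussianReal_apply _ hv.ne']
  have hpdf : ∀ y ∈ Set.Icc (b - η) (b + η), ENNReal.ofReal g ≤ gaussianPDF 0 v y := by
    intro y hy
    refine ENNReal.ofReal_le_ofReal ?_
    rw [gaussianPDFReal, hg]
    have := abs_le.1 hb
    have h2 : |y| ≤ M + 1 := abs_le.2 ⟨by linarith [hy.1], by linarith [hy.2]⟩
    have hsq : (y - 0) ^ 2 ≤ (M + 1) ^ 2 := by
      rw [sub_zero, sq_le_sq]; exact h2.trans (le_abs_self _)
    exact mul_le_mul_of_nonneg_left (Real.exp_le_exp.2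
      (div_le_div_of_nonneg_right (neg_le_neg hsq) (by positivity))) (by positivity)
  calc ENNReal.ofReal (g * η) ≤ ENNReal.ofReal (g * (2 * η)) :=
        ENNReal.ofReal_le_ofReal (by nlinarith)
    _ = ∫⁻ _ in Set.Icc (b - η) (b + η), ENNReal.ofReal g := by
        rw [setLIntegral_const, Real.volume_Icc, ENNReal.ofReal_mul hg0.le]
        congr 2; ring
    _ ≤ _ := setLIntegral_mono' measurableSet_Icc hpdf

/-! ### The evidence: a good tree, its prior mass, and the mean of the reciprocal. -/

/-- The reference predictions `m` are regular conditional quantiles on the unit cube. -/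
structure RegularModel {d r : ℕ} (κ : Kernel (Fin d → ℝ) ℝ) (τ : Fin r → ℝ)
    (m : (Fin d → ℝ) → Fin r → ℝ) (δ α A M₀ H ν : ℝ) : Prop where
  level : ∀ j, τ j ∈ Set.Ioo (0 : ℝ) 1
  regular : ∀ x ∈ unitCube d, ∀ j, RegularQuantile (κ x) (τ j) (m x j) δ α A
  measurable : Measurable m
  abs_le : ∀ x j, |m x j| ≤ M₀
  M_nonneg : 0 ≤ M₀
  H_nonneg : 0 ≤ H
  delta_pos : 0 < δ
  alpha_pos : 0 < α
  A_pos : 0 < A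
  nu_pos : 0 < ν
  holder : ∀ x ∈ unitCube d, ∀ x' ∈ unitCube d, ∀ j j', ∀ ε : ℝ, 0 ≤ ε → (∀ k, |x k - x' k| ≤ ε) →
    |τ j - τ j'| ≤ ε → |m x j - m x' j'| ≤ H * ε ^ ν

section Evidence

variable {d n r : ℕ} {κ : Kernel (Fin d → ℝ) ℝ} {τ : Fin r → ℝ}
  {m : (Fin d → ℝ) → Fin r → ℝ} {δ α A M₀ H ν : ℝ}

/-- A valid partition and heights that approximate the reference predictions on most rows. -/
theorem exists_approx_partition (hm : RegularModel κ τ m δ α A M₀ H ν) (h : PriorParams)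
    {D : Sample d n} (hD : ∀ i, (D i).1 ∈ unitCube d) (hcard : h.C ^ 2 ≤ n * r) (a : ℕ) :
    ∃ (S : Finset (Fin (d + 1))) (K : ℕ) (T : Finset (Set (Fin (d + 1) → ℝ)))
      (b : T → ℝ) (G : Finset (Fin n × Fin r)), T ∈ validPartitions h D τ S K ∧ 0 < K ∧
      K ≤ 2 ^ (a * (d + 1)) ∧ Gᶜ.card ≤ h.C ^ 2 * 2 ^ (a * (d + 1)) ∧ (∀ Ω, |b Ω| ≤ M₀) ∧
      (∀ q, ∃ Ω : T, designPoint D τ q ∈ (Ω : Set (Fin (d + 1) → ℝ))) ∧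
      ∀ q ∈ G, ∀ Ω : T, designPoint D τ q ∈ (Ω : Set (Fin (d + 1) → ℝ)) →
        |b Ω - m (D q.1).1 q.2| ≤ H * ((1 / 2 : ℝ) ^ a) ^ ν := by
  classical
  have hz : ∀ q, designPoint D τ q ∈ unitCube (d + 1) :=
    designPoint_mem_unitCube hm.level hD
  obtain ⟨S, P, G, h1, h2, h3, h4, h5⟩ := exists_isTreePartition_fine (designPoint D τ) hz
    (h.C ^ 2) (pow_pos h.C_pos 2) (by simpa using hcard) a
  set T := h1.finite.toFinset with hT
  have hTP : (T : Set (Set (Fin (d + 1) → ℝ))) = P := h1.finite.coe_toFinset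
  have hmem : ∀ Ω : T, (Ω : Set (Fin (d + 1) → ℝ)) ∈ P := fun Ω => by
    rw [← hTP]; exact Ω.2
  have hTcard : T.card = P.ncard := (Set.ncard_eq_toFinset_card P h1.finite).symm
  -- The height of a cell is the reference value at one of its good rows; the Hölder condition
  -- carries it to the other good rows of the cell. A cell without good rows gets height zero, about
  -- which nothing is claimed.
  let b : T → ℝ := fun Ω =>
    if hq : ∃ q ∈ G, designPoint D τ q ∈ (Ω : Set (Fin (d + 1) → ℝ)) then
      m (D hq.choose.1).1 hq.choose.2 else 0
  refine ⟨S, T.card, T, b, G, ⟨rfl, ?_, ?_⟩, ?_, ?_, h4, ?_, ?_, ?_⟩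
  · rw [hTP]; exact h1
  · intro Ω hΩ; exact h2 Ω (hmem ⟨Ω, hΩ⟩)
  · obtain ⟨Ω, hΩ, -⟩ := h1.exists_mem 0 ⟨le_rfl, fun _ => zero_le_one⟩
    rw [← hTP] at hΩ
    exact Finset.card_pos.2 ⟨Ω, hΩ⟩
  · rw [hTcard]; exact h3
  · intro Ω
    simp only [b]
    split_ifs with hq
    · exact hm.abs_le _ _
    · simpa using hm.M_nonneg
  · intro q
    obtain ⟨Ω, hΩ, hq⟩ := h1.exists_mem _ (hz q)
    rw [← hTP] at hΩ
    exact ⟨⟨Ω, hΩ⟩, hq⟩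
  · intro q hq Ω hqΩ
    have hex : ∃ q ∈ G, designPoint D τ q ∈ (Ω : Set (Fin (d + 1) → ℝ)) := ⟨q, hq, hqΩ⟩
    have hb : b Ω = m (D hex.choose.1).1 hex.choose.2 := by simp only [b]; rw [dif_pos hex]
    rw [hb]
    have hdist := h5 _ (hmem Ω) _ hex.choose_spec.1 q hq hex.choose_spec.2 hqΩ
    refine hm.holder _ (hD _) _ (hD _) _ _ _ (by positivity) (fun k => ?_) ?_
    · simpa [designPoint] using hdist k.castSucc
    · simpa [designPoint] using hdist (Fin.last d)

/-- The normalising constant of the posterior, up to a factor that depends on the data only. -/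
noncomputable def evidence (h : PriorParams) (L ω : ℝ) (D : Sample d n) (τ : Fin r → ℝ)
    (m : (Fin d → ℝ) → Fin r → ℝ) : ℝ≥0∞ :=
  ∫⁻ θ in boundedSteps (d + 1) L, gibbs ω D τ (fun i => m (D i).1) θ ∂rawPrior h D τ

theorem cellWeight_mul_lintegral_le (h : PriorParams) (D : Sample d n) (τ : Fin r → ℝ)
    {S : Finset (Fin (d + 1))} {K : ℕ} {T : Finset (Set (Fin (d + 1) → ℝ))}
    (hT : T ∈ validPartitions h D τ S K) {F : StepParam (d + 1) → ℝ≥0∞} (hF : Measurable F) :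
    cellWeight h D τ S K * ∫⁻ β, F (stepMk T β) ∂(Measure.pi fun _ => gaussianReal 0 h.variance)
      ≤ ∫⁻ θ, F θ ∂rawPrior h D τ := by
  rw [lintegral_rawPrior h D τ hF]
  refine le_trans ?_ (Finset.single_le_sum (fun _ _ => zero_le) (Finset.mem_univ S))
  refine le_trans ?_ (ENNReal.le_tsum K)
  exact ENNReal.le_tsum (f := fun T : validPartitions h D τ S K => cellWeight h D τ S K *
    ∫⁻ β, F ⟨T, β⟩ ∂(Measure.pi fun _ => gaussianReal 0 h.variance)) ⟨T, hT⟩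

end Evidence

variable {d n r : ℕ} {κ : Kernel (Fin d → ℝ) ℝ} {τ : Fin r → ℝ}
  {m : (Fin d → ℝ) → Fin r → ℝ} {δ α A M₀ H ν : ℝ}

theorem gibbs_inv (ω : ℝ) (D : Sample d n) (τ : Fin r → ℝ) (m : Fin n → Fin r → ℝ)
    (θ : StepParam (d + 1)) :
    (gibbs ω D τ m θ)⁻¹ = ENNReal.ofReal (Real.exp (ω * ∑ i,
      totalDiff τ (fun j => stepQuantile θ (D i).1 (τ j)) (m i) (D i).2)) := by
  rw [gibbs, ← ENNReal.ofReal_inv_of_pos (Real.exp_pos _), ← Real.exp_neg, neg_neg]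

theorem ofReal_exp_mul_sum {ι : Type*} (s : Finset ι) (ω : ℝ) (f : ι → ℝ) :
    ENNReal.ofReal (Real.exp (ω * ∑ i ∈ s, f i))
      = ∏ i ∈ s, ENNReal.ofReal (Real.exp (ω * f i)) := by
  rw [Finset.mul_sum, Real.exp_sum, ENNReal.ofReal_prod_of_nonneg fun _ _ => (Real.exp_pos _).le]

/-- Combines `K! ≤ Kmax ^ K` with the bound on the number of valid partitions by the number of
codes; the result is geometric in `K`. -/
theorem cellWeight_ge (h : PriorParams) (D : Sample d n) (τ : Fin r → ℝ) {w : ℝ}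
    {S : Finset (Fin (d + 1))} {K Kmax : ℕ} (hK : K ≤ Kmax) {T : Finset (Set (Fin (d + 1) → ℝ))}
    (hT : T ∈ validPartitions h D τ S K)
    (hw : w * (h.rate ^ K / K.factorial) ≤ shellWeight h S K) (hw0 : 0 < w) :
    ENNReal.ofReal (w * (h.rate / Kmax / (((n * r + 1 : ℕ) : ℝ) ^ 2) ^ (d + 1)) ^ K)
      ≤ cellWeight h D τ S K := by
  have hne : (validPartitions h D τ S K).Nonempty := ⟨T, hT⟩
  have hfin : (validPartitions h D τ S K).Finite := Set.toFinite _
  have hpos : 0 < (validPartitions h D τ S K).ncard := (Set.ncard_pos hfin).2 hne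
  have hle := ncard_validPartitions_le h D τ S K
  have hr := h.rate_pos
  have hcast : ((validPartitions h D τ S K).ncard : ℝ≥0∞)⁻¹
      = ENNReal.ofReal (((validPartitions h D τ S K).ncard : ℝ)⁻¹) := by
    rw [ENNReal.ofReal_inv_of_pos (by exact_mod_cast hpos), ENNReal.ofReal_natCast]
  have hs0 : 0 ≤ shellWeight h S K := le_trans (by positivity) hw
  rw [cellWeight, hcast, ← ENNReal.ofReal_mul hs0]
  refine ENNReal.ofReal_le_ofReal ?_
  have hle' : ((validPartitions h D τ S K).ncard : ℝ)
      ≤ ((((n * r + 1 : ℕ) : ℝ) ^ 2) ^ (d + 1)) ^ K := by exact_mod_cast hle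
  have hfac : (K.factorial : ℝ) ≤ (Kmax : ℝ) ^ K := by
    have h1 : K.factorial ≤ K ^ K := Nat.factorial_le_pow K
    have h2 : K ^ K ≤ Kmax ^ K := Nat.pow_le_pow_left hK K
    exact_mod_cast h1.trans h2
  have hfac0 : (0 : ℝ) < K.factorial := by exact_mod_cast K.factorial_pos
  set B := (((n * r + 1 : ℕ) : ℝ) ^ 2) ^ (d + 1) with hB
  have hpos' : (0 : ℝ) < (validPartitions h D τ S K).ncard := by exact_mod_cast hpos
  calc w * (h.rate / Kmax / B) ^ K = w * (h.rate ^ K / Kmax ^ K) * (B ^ K)⁻¹ := by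
        rw [div_pow, div_pow, div_eq_mul_inv (_ / _) (B ^ K), mul_assoc]
    _ ≤ w * (h.rate ^ K / K.factorial) * ((validPartitions h D τ S K).ncard : ℝ)⁻¹ := by
        gcongr
    _ ≤ _ := by gcongr

theorem pi_gaussianReal_box_ge (v : ℝ≥0) {ι : Type*} [Fintype ι] {g η : ℝ} (hgη : 0 ≤ g * η)
    (b : ι → ℝ) (hg : ∀ k, ENNReal.ofReal (g * η) ≤ gaussianReal 0 v (Set.Icc (b k - η) (b k + η))) :
    ENNReal.ofReal ((g * η) ^ Fintype.card ι) ≤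
      Measure.pi (fun _ : ι => gaussianReal 0 v)
        (Set.univ.pi fun k => Set.Icc (b k - η) (b k + η)) := by
  rw [Measure.pi_pi, ENNReal.ofReal_pow hgη, ← Finset.card_univ, ← Finset.prod_const]
  exact Finset.prod_le_prod' fun k _ => hg k

/-- The total squared error of step functions with heights close to those of a good partition. -/
theorem sum_sq_error_le {R : Type*} [Fintype R] [DecidableEq R] (G : Finset R) (e : R → ℝ)
    {s B N : ℝ} (hgood : ∀ q ∈ G, |e q| ≤ s) (hbad : ∀ q, |e q| ≤ B)
    (hN : (Gᶜ.card : ℝ) ≤ N) : ∑ q, e q ^ 2 ≤ Fintype.card R * s ^ 2 + N * B ^ 2 := by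
  rw [← Finset.sum_add_sum_compl G]
  have h1 : ∑ q ∈ G, e q ^ 2 ≤ G.card * s ^ 2 := by
    rw [← nsmul_eq_mul]
    refine Finset.sum_le_card_nsmul _ _ _ fun q hq => ?_
    rw [← sq_abs]
    exact pow_le_pow_left₀ (abs_nonneg _) (hgood q hq) 2
  have h2 : ∑ q ∈ Gᶜ, e q ^ 2 ≤ Gᶜ.card * B ^ 2 := by
    rw [← nsmul_eq_mul]
    refine Finset.sum_le_card_nsmul _ _ _ fun q hq => ?_
    rw [← sq_abs]
    exact pow_le_pow_left₀ (abs_nonneg _) (hbad q) 2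
  have h3 : (G.card : ℝ) ≤ Fintype.card R := by exact_mod_cast Finset.card_le_univ G
  nlinarith [sq_nonneg s, sq_nonneg B]

/-- Given the covariates, the reciprocal of the normalising constant has a finite mean, for which
there is an explicit bound. -/
theorem lintegral_inv_evidence_le [IsMarkovKernel κ] (hm : RegularModel κ τ m δ α A M₀ H ν)
    (h : PriorParams) {L ω : ℝ} (hL : M₀ + 1 ≤ L) (hω : 0 ≤ ω) (hω1 : ω * (r * (2 * L)) ≤ 1)
    (hω2 : ω * r ≤ 1) (hcard : h.C ^ 2 ≤ n * r) (a : ℕ) {w : ℝ} (hw : 0 < w)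
    (hshell : ∀ (S : Finset (Fin (d + 1))) (K : ℕ), 0 < K →
      w * (h.rate ^ K / K.factorial) ≤ shellWeight h S K) {g : ℝ} (hg : 0 < g)
    (hgauss : ∀ b η, |b| ≤ M₀ → 0 ≤ η → η ≤ 1 →
      ENNReal.ofReal (g * η) ≤ gaussianReal 0 h.variance (Set.Icc (b - η) (b + η)))
    {q : ℝ} (hq0 : 0 < q) (hq1 : q ≤ 1)
    (hq : q ≤ h.rate / (2 ^ (a * (d + 1)) : ℕ) / (((n * r + 1 : ℕ) : ℝ) ^ 2) ^ (d + 1) *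
      (g * ((1 / 2 : ℝ) ^ a) ^ ν))
    (x : Fin n → Fin d → ℝ) (hx : ∀ i, x i ∈ unitCube d) :
    (∀ D : Sample d n, (∀ i, (D i).1 = x i) → evidence h L ω D τ m ≠ 0) ∧
    ∫⁻ D, (evidence h L ω D τ m)⁻¹ ∂condLaw κ x ≤
      (ENNReal.ofReal (w * q ^ (2 ^ (a * (d + 1)))))⁻¹ * ENNReal.ofReal (Real.exp
        (ω * (A + 1 / δ + 1) * (((n * r : ℕ) : ℝ) * ((1 + H) * ((1 / 2 : ℝ) ^ a) ^ ν) ^ 2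
          + ((h.C ^ 2 * 2 ^ (a * (d + 1)) : ℕ) : ℝ) * (2 * L) ^ 2))) := by
  classical
  set η := ((1 / 2 : ℝ) ^ a) ^ ν with hη
  set Kmax := 2 ^ (a * (d + 1)) with hKmax
  have hη0 : 0 ≤ η := by positivity
  have hη1 : η ≤ 1 := Real.rpow_le_one (by positivity)
    (pow_le_one₀ (by norm_num) (by norm_num)) hm.nu_pos.le
  -- The responses are arbitrary here, as the prior does not depend on them.
  let D₀ : Sample d n := fun i => (x i, 0)
  obtain ⟨S, K, T, b, G, hT, hK0, hK, hGc, hb, hcover, hgood⟩ :=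
    exists_approx_partition hm h (D := D₀) hx hcard a
  have hTK : T.card = K := hT.1
  let γ := Measure.pi fun _ : T => gaussianReal 0 h.variance
  -- The half-width is of the order of the approximation error of the partition, so that the total
  -- error on good rows is `(1+H)η`.
  let E : Set (T → ℝ) := Set.univ.pi fun k => Set.Icc (b k - η) (b k + η)
  have hE : MeasurableSet E := MeasurableSet.univ_pi fun k => measurableSet_Icc
  have hγE : ENNReal.ofReal ((g * η) ^ K) ≤ γ E := by
    have := pi_gaussianReal_box_ge h.variance (g := g) (η := η) (by positivity) b
      fun k => hgauss (b k) η (hb k) hη0 hη1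
    rwa [Fintype.card_coe, hTK] at this
  have hQ : ENNReal.ofReal (w * q ^ Kmax) ≤ cellWeight h D₀ τ S K * γ E := by
    refine le_trans ?_ (mul_le_mul' (cellWeight_ge h D₀ τ hK hT (hshell S K hK0) hw) hγE)
    have hr := h.rate_pos
    rw [← ENNReal.ofReal_mul (by positivity)]
    refine ENNReal.ofReal_le_ofReal ?_
    rw [mul_assoc, ← mul_pow]
    gcongr
    exact (pow_le_pow_of_le_one hq0.le hq1 hK).trans (pow_le_pow_left₀ hq0.le hq K)
  have hQ0 : ENNReal.ofReal (w * q ^ Kmax) ≠ 0 := by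
    have : 0 < w * q ^ Kmax := by positivity
    simpa using this
  have hγE0 : γ E ≠ 0 := fun h0 => hQ0 (le_antisymm (hQ.trans (by rw [h0, mul_zero])) zero_le)
  -- Conditioning the heights on the box gives a probability measure, to which Jensen's inequality
  -- for the reciprocal applies.
  let ρ : Measure (T → ℝ) := cond γ E
  have hρ : IsProbabilityMeasure ρ := cond_isProbabilityMeasure hγE0
  have hρE : ∀ᵐ β ∂ρ, β ∈ E := by
    have : ∀ᵐ β ∂γ.restrict E, β ∈ E := ae_restrict_mem hE
    exact (Measure.smul_absolutelyContinuous (c := (γ E)⁻¹)).ae_le this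
  have hval : ∀ β : T → ℝ, ∀ i j, ∃ Ω : T, stepQuantile (stepMk T β) (x i) (τ j) = β Ω ∧
      ((i, j) ∈ G → |b Ω - m (x i) j| ≤ H * η) := by
    intro β i j
    obtain ⟨Ω, hΩ⟩ := hcover (i, j)
    refine ⟨Ω, ?_, fun hij => hgood (i, j) hij Ω hΩ⟩
    refine stepFun_eq_of_mem (fun Ω₁ h₁ Ω₂ h₂ y hy hy' => ?_) β Ω hΩ
    exact hT.2.1.eq_of_mem Ω₁ h₁ Ω₂ h₂ y hy hy'
  have hEb : ∀ β ∈ E, ∀ Ω, |β Ω - b Ω| ≤ η := fun β hβ Ω => by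
    have := hβ Ω (Set.mem_univ _)
    rw [abs_le]; constructor <;> linarith [this.1, this.2]
  have hEabs : ∀ β ∈ E, ∀ Ω, |β Ω| ≤ L := fun β hβ Ω => by
    have h1 := hEb β hβ Ω
    have h2 := hb Ω
    rw [abs_le] at h1 h2 ⊢
    constructor <;> linarith [h1.1, h1.2, h2.1, h2.2]
  have hM0 := hm.M_nonneg
  have hL0 : 0 < L := by linarith
  have hbdd : ∀ β ∈ E, stepMk T β ∈ boundedSteps (d + 1) L := by
    intro β hβ y hy
    by_cases hyT : ∃ Ω ∈ T, y ∈ Ω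
    · obtain ⟨Ω, hΩ, hyΩ⟩ := hyT
      rw [stepFun_eq_of_mem (fun Ω₁ h₁ Ω₂ h₂ y hy hy' => hT.2.1.eq_of_mem Ω₁ h₁ Ω₂ h₂ y hy hy')
        β ⟨Ω, hΩ⟩ hyΩ]
      exact hEabs β hβ _
    · push Not at hyT
      rw [stepFun_eq_zero β hyT]
      simpa using hL0.le
  let φ : Sample d n → (T → ℝ) → ℝ≥0∞ := fun D β => gibbs ω D τ (fun i => m (x i)) (stepMk T β)
  have hφ : ∀ D, Measurable (φ D) := fun D =>
    (measurable_gibbs ω D τ _).comp (measurable_stepMk T)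
  have hlow : ∀ D : Sample d n, (∀ i, (D i).1 = x i) →
      ENNReal.ofReal (w * q ^ Kmax) * ∫⁻ β, φ D β ∂ρ ≤ evidence h L ω D τ m := by
    intro D hD
    have hDm : (fun i => m (D i).1) = fun i => m (x i) := by funext i; rw [hD]
    rw [evidence, hDm, rawPrior_congr h τ (D' := D₀) hD,
      ← lintegral_indicator (measurableSet_boundedSteps L)]
    refine le_trans ?_ (cellWeight_mul_lintegral_le h D₀ τ hT
      ((measurable_gibbs ω D τ _).indicator (measurableSet_boundedSteps L)))
    have h1 : ∫⁻ β, φ D β ∂ρ = (γ E)⁻¹ * ∫⁻ β in E, φ D β ∂γ := by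
      simp only [ρ, ProbabilityTheory.cond, lintegral_smul_measure, smul_eq_mul]
    calc ENNReal.ofReal (w * q ^ Kmax) * ∫⁻ β, φ D β ∂ρ
        ≤ cellWeight h D₀ τ S K * γ E * ((γ E)⁻¹ * ∫⁻ β in E, φ D β ∂γ) := by
          rw [h1]; gcongr
      _ = cellWeight h D₀ τ S K * ∫⁻ β in E, φ D β ∂γ := by
          rw [mul_assoc, ← mul_assoc (γ E), ENNReal.mul_inv_cancel hγE0 (measure_ne_top _ _),
            one_mul]
      _ ≤ _ := by
          refine mul_le_mul' le_rfl ?_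
          rw [← lintegral_indicator hE]
          refine lintegral_mono fun β => ?_
          by_cases hβ : β ∈ E
          · rw [Set.indicator_of_mem hβ, Set.indicator_of_mem (hbdd β hβ)]
          · rw [Set.indicator_of_notMem hβ]; exact zero_le
  have hφ0 : ∀ D β, φ D β ≠ 0 := fun D β => by
    simp only [φ, gibbs]
    simpa using Real.exp_pos _
  have hφtop : ∀ D β, φ D β ≠ ∞ := fun D β => ENNReal.ofReal_ne_top
  refine ⟨fun D hD h0 => ?_, ?_⟩
  · have h1 := hlow D hD
    rw [h0, nonpos_iff_eq_zero, mul_eq_zero, lintegral_eq_zero_iff (hφ D)] at h1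
    rcases h1 with h1 | h1
    · exact hQ0 h1
    · obtain ⟨β, hβ⟩ := (h1.exists)
      exact hφ0 D β hβ
  · have hinv : ∀ᵐ D ∂condLaw κ x, (evidence h L ω D τ m)⁻¹ ≤
        (ENNReal.ofReal (w * q ^ Kmax))⁻¹ * ∫⁻ β, ∏ i, ENNReal.ofReal (Real.exp (ω *
          totalDiff τ (fun j => stepQuantile (stepMk T β) (x i) (τ j)) (m (x i)) (D i).2)) ∂ρ := by
      filter_upwards [ae_condLaw_fst κ x] with D hD
      refine (ENNReal.inv_le_inv.2 (hlow D hD)).trans ?_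
      rw [ENNReal.mul_inv (Or.inl hQ0) (Or.inl ENNReal.ofReal_ne_top)]
      gcongr
      refine (inv_lintegral_le_lintegral_inv ρ (hφ D) (hφ0 D) (hφtop D)).trans
        (lintegral_mono fun β => le_of_eq ?_)
      simp only [φ]
      rw [gibbs_inv, ofReal_exp_mul_sum]
      simp only [hD]
    refine (lintegral_mono_ae hinv).trans ?_
    have hu : ∀ i, Measurable fun β : T → ℝ =>
        fun j => stepQuantile (stepMk T β) (x i) (τ j) := fun i =>
      measurable_pi_lambda _ fun j => (measurable_stepFun _).comp (measurable_stepMk T)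
    have hjoint : Measurable fun p : Sample d n × (T → ℝ) =>
        ∏ i, ENNReal.ofReal (Real.exp (ω *
          totalDiff τ (fun j => stepQuantile (stepMk T p.2) (x i) (τ j)) (m (x i))
            (p.1 i).2)) := by
      refine Finset.measurable_prod _ fun i _ => ?_
      refine (Real.measurable_exp.comp (Measurable.const_mul ?_ ω)).ennreal_ofReal
      exact (measurable_totalDiff_left τ (m (x i))).comp
        (((hu i).comp measurable_snd).prodMk
          (measurable_snd.comp ((measurable_pi_apply i).comp measurable_fst)))
    rw [lintegral_const_mul _ hjoint.lintegral_prod_right']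
    gcongr
    rw [lintegral_lintegral_swap hjoint.aemeasurable]
    have hbound : ∀ᵐ β ∂ρ, ∫⁻ D, ∏ i, ENNReal.ofReal (Real.exp (ω *
          totalDiff τ (fun j => stepQuantile (stepMk T β) (x i) (τ j)) (m (x i))
            (D i).2)) ∂condLaw κ x ≤ ENNReal.ofReal (Real.exp
        (ω * (A + 1 / δ + 1) * (((n * r : ℕ) : ℝ) * ((1 + H) * η) ^ 2
          + ((h.C ^ 2 * Kmax : ℕ) : ℝ) * (2 * L) ^ 2))) := by
      filter_upwards [hρE] with β hβ
      rw [lintegral_condLaw_prod κ x (f := fun i z => ENNReal.ofReal (Real.exp (ω *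
          totalDiff τ (fun j => stepQuantile (stepMk T β) (x i) (τ j)) (m (x i)) z.2)))
          fun i => (Real.measurable_exp.comp (Measurable.const_mul
            (measurable_totalDiff.comp measurable_snd) ω)).ennreal_ofReal]
      have herr : ∀ i j, |stepQuantile (stepMk T β) (x i) (τ j) - m (x i) j| ≤ 2 * L := by
        intro i j
        obtain ⟨Ω, hΩ, -⟩ := hval β i j
        have h1 := hEabs β hβ Ω
        have h2 := hm.abs_le (x i) j
        rw [hΩ]
        rw [abs_le] at h1 h2 ⊢
        constructor <;> linarith [h1.1, h1.2, h2.1, h2.2]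
      have hone : ∀ i, ∫⁻ y, ENNReal.ofReal (Real.exp (ω *
          totalDiff τ (fun j => stepQuantile (stepMk T β) (x i) (τ j)) (m (x i)) y)) ∂κ (x i) ≤
          ENNReal.ofReal (Real.exp (ω * (A + 1 / δ + 1) *
            ∑ j, (stepQuantile (stepMk T β) (x i) (τ j) - m (x i) j) ^ 2)) := fun i =>
        lintegral_exp_totalDiff_le (hm.regular (x i) (hx i)) (herr i) hω hω1 hω2
      refine (Finset.prod_le_prod' fun i _ => hone i).trans ?_
      rw [← ofReal_exp_mul_sum]
      refine ENNReal.ofReal_le_ofReal (Real.exp_le_exp.2 ?_)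
      have hA := hm.A_pos
      have hδ := hm.delta_pos
      have hH := hm.H_nonneg
      refine mul_le_mul_of_nonneg_left ?_ (by positivity)
      rw [← Finset.sum_product', Finset.univ_product_univ]
      -- The discarded rows are controlled only through the sup-norm bound `2L`; there are at most
      -- `C² Kmax` of them.
      refine (sum_sq_error_le G (fun q : Fin n × Fin r =>
        stepQuantile (stepMk T β) (x q.1) (τ q.2) - m (x q.1) q.2) (s := (1 + H) * η)
        (B := 2 * L) (N := ((h.C ^ 2 * Kmax : ℕ) : ℝ))
        (fun q hqG => ?_) (fun q => herr q.1 q.2) (by exact_mod_cast hGc)).trans_eq ?_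
      · obtain ⟨Ω, hΩ, hgoodΩ⟩ := hval β q.1 q.2
        have h1 := hEb β hβ Ω
        have h2 := hgoodΩ hqG
        rw [hΩ]
        calc |β Ω - m (x q.1) q.2| = |(β Ω - b Ω) + (b Ω - m (x q.1) q.2)| := by ring_nf
          _ ≤ |β Ω - b Ω| + |b Ω - m (x q.1) q.2| := abs_add_le _ _
          _ ≤ (1 + H) * η := by linarith
      · simp
    refine (lintegral_mono_ae hbound).trans ?_
    simp

/-! ### Step functions built from codes. -/

/-- The projection of the real line onto `[-L, L]`. -/
def clip (L u : ℝ) : ℝ := max (-L) (min u L)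

theorem measurable_clip (L : ℝ) : Measurable (clip L) :=
  measurable_const.max (measurable_id.min measurable_const)

theorem abs_clip_le {L : ℝ} (hL : 0 ≤ L) (u : ℝ) : |clip L u| ≤ L := by
  rw [abs_le]
  exact ⟨le_max_left _ _, max_le (by linarith) (min_le_right _ _)⟩

theorem clip_of_abs_le {L u : ℝ} (h : |u| ≤ L) : clip L u = u := by
  rw [abs_le] at h
  rw [clip, min_eq_left h.2, max_eq_right h.1]

section Code

variable {d n r K : ℕ}

theorem measurable_snoc (t : ℝ) :
    Measurable fun x : Fin d → ℝ => (Fin.snoc x t : Fin (d + 1) → ℝ) := by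
  refine measurable_pi_lambda _ fun k => ?_
  refine Fin.lastCases ?_ (fun k => ?_) k
  · simp
  · simpa using measurable_pi_apply k

theorem measurable_designPoint (τ : Fin r → ℝ) (q : Fin n × Fin r) :
    Measurable fun D : Sample d n => designPoint D τ q :=
  (measurable_snoc (τ q.2)).comp (measurable_fst.comp (measurable_pi_apply q.1))

theorem measurableSet_unitCube (m : ℕ) : MeasurableSet (unitCube m) := measurableSet_Icc

/-- For a fixed code the box varies measurably with the sample, which allows integration over all
observations at once. -/
theorem measurableSet_codeBox_joint (τ : Fin r → ℝ) (c : BoxCode (Fin n × Fin r) (d + 1))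
    (t : ℝ) : MeasurableSet {p : Sample d n × (Fin d → ℝ) |
      (Fin.snoc p.2 t : Fin (d + 1) → ℝ) ∈ codeBox (designPoint p.1 τ) c} := by
  have h1 : ∀ k, Measurable fun p : Sample d n × (Fin d → ℝ) =>
      (Fin.snoc p.2 t : Fin (d + 1) → ℝ) k := fun k =>
    (measurable_pi_apply k).comp ((measurable_snoc t).comp measurable_snd)
  have h2 : ∀ q k, Measurable fun p : Sample d n × (Fin d → ℝ) => designPoint p.1 τ q k :=
    fun q k => (measurable_pi_apply k).comp ((measurable_designPoint τ q).comp measurable_fst)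
  refine measurableSet_setOfPred.2 (Measurable.and ?_ (Measurable.forall fun k =>
    Measurable.and (Measurable.forall fun q => Measurable.forall fun _ => ?_)
      (Measurable.forall fun q => Measurable.forall fun _ => ?_)))
  · exact measurableSet_setOfPred.1
      ((measurable_snoc t).comp measurable_snd (measurableSet_unitCube (d + 1)))
  · exact measurableSet_setOfPred.1 (measurableSet_lt (h2 q k) (h1 k))
  · exact measurableSet_setOfPred.1 (measurableSet_le (h1 k) (h2 q k))

theorem measurableSet_codeBox {ι : Type*} [Countable ι] {m : ℕ} (z : ι → Fin m → ℝ)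
    (c : BoxCode ι m) : MeasurableSet (codeBox z c) := by
  refine measurableSet_setOfPred.2 (Measurable.and ?_ (Measurable.forall fun k =>
    Measurable.and (Measurable.forall fun q => Measurable.forall fun _ => ?_)
      (Measurable.forall fun q => Measurable.forall fun _ => ?_)))
  · exact measurableSet_setOfPred.1 (measurableSet_unitCube m)
  · exact measurableSet_setOfPred.1 (measurableSet_lt measurable_const (measurable_pi_apply k))
  · exact measurableSet_setOfPred.1 (measurableSet_le (measurable_pi_apply k) measurable_const)

/-- The clipped step function on the boxes with the codes `c` and the heights `β`. -/
noncomputable def codeFun (L : ℝ) (D : Sample d n) (τ : Fin r → ℝ)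
    (c : Fin K → BoxCode (Fin n × Fin r) (d + 1)) (β : Fin K → ℝ) (x : Fin d → ℝ) (t : ℝ) : ℝ :=
  clip L (∑ k, (codeBox (designPoint D τ) (c k)).indicator (fun _ => β k)
    (Fin.snoc x t : Fin (d + 1) → ℝ))

theorem measurable_codeFun (L : ℝ) (τ : Fin r → ℝ)
    (c : Fin K → BoxCode (Fin n × Fin r) (d + 1)) (t : ℝ) :
    Measurable fun p : (Sample d n × (Fin K → ℝ)) × (Fin d → ℝ) =>
      codeFun L p.1.1 τ c p.1.2 p.2 t := by
  classical
  refine (measurable_clip L).comp (Finset.measurable_sum _ fun k _ => ?_)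
  simp only [Set.indicator_apply]
  refine Measurable.ite ?_ ((measurable_pi_apply k).comp (measurable_snd.comp measurable_fst))
    measurable_const
  exact ((measurable_fst.comp measurable_fst).prodMk measurable_snd)
    (measurableSet_codeBox_joint τ (c k) t)

theorem measurable_codeFun_comp {E : Type*} [MeasurableSpace E] (L : ℝ) (τ : Fin r → ℝ)
    (c : Fin K → BoxCode (Fin n × Fin r) (d + 1)) (t : ℝ) {D : E → Sample d n}
    {β : E → Fin K → ℝ} {x : E → Fin d → ℝ} (hD : Measurable D) (hβ : Measurable β)
    (hx : Measurable x) : Measurable fun e => codeFun L (D e) τ c (β e) (x e) t := by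
  have h := (measurable_codeFun L τ c t).comp ((hD.prodMk hβ).prodMk hx)
  exact h

theorem abs_codeFun_le {L : ℝ} (hL : 0 ≤ L) (D : Sample d n) (τ : Fin r → ℝ)
    (c : Fin K → BoxCode (Fin n × Fin r) (d + 1)) (β : Fin K → ℝ) (x : Fin d → ℝ) (t : ℝ) :
    |codeFun L D τ c β x t| ≤ L := abs_clip_le hL _

/-- The sample points that occur in the codes `c`. -/
def codeIndices (c : Fin K → BoxCode (Fin n × Fin r) (d + 1)) : Finset (Fin n) :=
  (Finset.univ : Finset (Fin K × Fin (d + 1))).biUnion fun kl =>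
    ((c kl.1 kl.2).1.toFinset ∪ (c kl.1 kl.2).2.toFinset).image Prod.fst

theorem card_codeIndices_le (c : Fin K → BoxCode (Fin n × Fin r) (d + 1)) :
    (codeIndices c).card ≤ 2 * (d + 1) * K := by
  have hopt : ∀ o : Option (Fin n × Fin r), o.toFinset.card ≤ 1 := fun o => by
    cases o <;> simp
  refine (Finset.card_biUnion_le_card_mul _ _ 2 fun kl _ => ?_).trans_eq ?_
  · refine Finset.card_image_le.trans ((Finset.card_union_le _ _).trans ?_)
    have h1 := hopt (c kl.1 kl.2).1
    have h2 := hopt (c kl.1 kl.2).2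
    omega
  · simp; ring

/-- The endpoints of the boxes are coordinates of named observations, so no other part of the sample
enters. This is the compression property. -/
theorem codeFun_congr (L : ℝ) {D D' : Sample d n} (τ : Fin r → ℝ)
    (c : Fin K → BoxCode (Fin n × Fin r) (d + 1)) (β : Fin K → ℝ)
    (h : ∀ i ∈ codeIndices c, D i = D' i) : codeFun L D τ c β = codeFun L D' τ c β := by
  have hbox : ∀ k, codeBox (designPoint D τ) (c k) = codeBox (designPoint D' τ) (c k) := by
    intro k
    have hz : ∀ l q, q ∈ (c k l).1 ∨ q ∈ (c k l).2 → designPoint D τ q = designPoint D' τ q := by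
      intro l q hq
      have : q.1 ∈ codeIndices c := by
        refine Finset.mem_biUnion.2 ⟨(k, l), Finset.mem_univ _, Finset.mem_image.2 ⟨q, ?_, rfl⟩⟩
        simpa using hq
      simp only [designPoint, h _ this]
    ext x
    refine and_congr_right fun _ => forall_congr' fun l => and_congr ?_ ?_
    · refine forall₂_congr fun q hq => ?_
      rw [hz l q (Or.inl hq)]
    · refine forall₂_congr fun q hq => ?_
      rw [hz l q (Or.inr hq)]
  funext x t
  simp only [codeFun, hbox]

end Code

/-! ### Sample compression: mean Gibbs weight for a fixed code. -/

section Compression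

variable {d n r K : ℕ} {κ : Kernel (Fin d → ℝ) ℝ} {τ : Fin r → ℝ}
  {m : (Fin d → ℝ) → Fin r → ℝ} {δ α A M₀ H ν : ℝ}

/-- The squared `L²(PX)`-distance of `u` from the reference predictions, summed over the
quantile levels. -/
noncomputable def sqDist (PX : Measure (Fin d → ℝ)) (τ : Fin r → ℝ)
    (m : (Fin d → ℝ) → Fin r → ℝ) (u : (Fin d → ℝ) → ℝ → ℝ) : ℝ≥0∞ :=
  ∫⁻ x, ∑ j, ENNReal.ofReal ((u x (τ j) - m x j) ^ 2) ∂PX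

/-- The Gibbs factor of one observation. -/
noncomputable def gibbsFactor (ω : ℝ) (τ : Fin r → ℝ) (m : (Fin d → ℝ) → Fin r → ℝ)
    (u : (Fin d → ℝ) → ℝ → ℝ) (z : (Fin d → ℝ) × ℝ) : ℝ≥0∞ :=
  ENNReal.ofReal (Real.exp (-(ω * totalDiff τ (fun j => u z.1 (τ j)) (m z.1) z.2)))

theorem measurable_totalDiff_joint (τ : Fin r → ℝ) :
    Measurable fun q : ((Fin r → ℝ) × (Fin r → ℝ)) × ℝ => totalDiff τ q.1.1 q.1.2 q.2 := by
  unfold totalDiff lossDiff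
  refine Finset.measurable_sum _ fun j _ => ?_
  exact ((measurable_checkLoss _).comp
    (measurable_snd.sub ((measurable_pi_apply j).comp (measurable_fst.comp measurable_fst)))).sub
    ((measurable_checkLoss _).comp
      (measurable_snd.sub ((measurable_pi_apply j).comp (measurable_snd.comp measurable_fst))))

theorem measurable_gibbs_comp {E : Type*} [MeasurableSpace E] (ω : ℝ) {U V : E → Fin r → ℝ}
    {Y : E → ℝ} (hU : Measurable U) (hV : Measurable V) (hY : Measurable Y) :
    Measurable fun p => ENNReal.ofReal (Real.exp (-(ω * totalDiff τ (U p) (V p) (Y p)))) := by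
  have h1 : Measurable fun p => totalDiff τ (U p) (V p) (Y p) :=
    (measurable_totalDiff_joint τ).comp ((hU.prodMk hV).prodMk hY)
  exact (Real.measurable_exp.comp (h1.const_mul ω).neg).ennreal_ofReal

theorem measurable_gibbsFactor (ω : ℝ) (hm : Measurable m) {u : (Fin d → ℝ) → ℝ → ℝ}
    (hu : ∀ j, Measurable fun x => u x (τ j)) : Measurable (gibbsFactor ω τ m u) :=
  measurable_gibbs_comp ω ((measurable_pi_lambda _ hu).comp measurable_fst)
    (hm.comp measurable_fst) measurable_snd

theorem gibbsFactor_le (hm : RegularModel κ τ m δ α A M₀ H ν) {L ω : ℝ} (hL : M₀ ≤ L)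
    (hω : 0 ≤ ω) {u : (Fin d → ℝ) → ℝ → ℝ} (hu : ∀ x t, |u x t| ≤ L) (z : (Fin d → ℝ) × ℝ) :
    gibbsFactor ω τ m u z ≤ ENNReal.ofReal (Real.exp (ω * (r * (2 * L)))) := by
  refine ENNReal.ofReal_le_ofReal (Real.exp_le_exp.2 ?_)
  have h1 := abs_totalDiff_le (u := fun j => u z.1 (τ j)) (m := m z.1) hm.level z.2
  have h2 : ∑ j, |u z.1 (τ j) - m z.1 j| ≤ ∑ _j : Fin r, 2 * L :=
    Finset.sum_le_sum fun j _ => by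
      have := abs_sub (u z.1 (τ j)) (m z.1 j)
      have h3 := hu z.1 (τ j)
      have h4 := hm.abs_le z.1 j
      linarith
  rw [Finset.sum_const, Finset.card_univ, Fintype.card_fin, nsmul_eq_mul] at h2
  have h3 := (abs_le.1 (h1.trans h2)).1
  rw [← mul_neg]
  exact mul_le_mul_of_nonneg_left (by linarith) hω

/-- Given `x` the factor has mean at most `exp(-s q(x))`, where `q` is the pointwise sum of squared
errors. As `s q ≤ 1`, this is at most `1 - s q/2`, and averaging over `x` gives the
`L²(PX)`-distance. -/
theorem lintegral_gibbsFactor_le [IsMarkovKernel κ] {PX : Measure (Fin d → ℝ)}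
    [IsProbabilityMeasure PX] (hPX : ∀ᵐ x ∂PX, x ∈ unitCube d)
    (hm : RegularModel κ τ m δ α A M₀ H ν) {L ω : ℝ} (hL : M₀ ≤ L) (hδL : δ ≤ 2 * L)
    (hω : 0 ≤ ω) (hω1 : ω * (r * (2 * L)) ≤ 1) (hω2 : ω * r ≤ α * δ / (16 * L))
    (hω3 : ω * (α * δ / (16 * L)) * (r * (2 * L) ^ 2) ≤ 1)
    {u : (Fin d → ℝ) → ℝ → ℝ} (hu : ∀ x t, |u x t| ≤ L)
    (hu_meas : ∀ j, Measurable fun x => u x (τ j)) {a : ℝ}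
    (ha : ENNReal.ofReal a < sqDist PX τ m u) :
    ∫⁻ z, gibbsFactor ω τ m u z ∂(PX ⊗ₘ κ)
      ≤ ENNReal.ofReal (Real.exp (-(ω * (α * δ / (32 * L)) * a))) := by
  have hL0 : 0 < L := by linarith [hm.delta_pos]
  have hmeas : Measurable (gibbsFactor ω τ m u) := measurable_gibbsFactor ω hm.measurable hu_meas
  let q : (Fin d → ℝ) → ℝ := fun x => ∑ j, (u x (τ j) - m x j) ^ 2
  have hq_meas : Measurable q := Finset.measurable_sum _ fun j _ =>
    ((hu_meas j).sub ((measurable_pi_apply j).comp hm.measurable)).pow_const 2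
  have hq0 : ∀ x, 0 ≤ q x := fun x => Finset.sum_nonneg fun j _ => sq_nonneg _
  have herr : ∀ x j, |u x (τ j) - m x j| ≤ 2 * L := fun x j => by
    have := abs_sub (u x (τ j)) (m x j)
    have h3 := hu x (τ j)
    have h4 := hm.abs_le x j
    linarith
  have hqle : ∀ x, q x ≤ r * (2 * L) ^ 2 := fun x => by
    calc q x ≤ ∑ _j : Fin r, (2 * L) ^ 2 := Finset.sum_le_sum fun j _ => by
          rw [← sq_abs]; exact pow_le_pow_left₀ (abs_nonneg _) (herr x j) 2
      _ = _ := by simp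
  set s := ω * (α * δ / (16 * L)) with hs
  have hα := hm.alpha_pos
  have hδ := hm.delta_pos
  have hs0 : 0 ≤ s := by positivity
  have hint : Integrable q PX := Integrable.of_bound hq_meas.aestronglyMeasurable
    (r * (2 * L) ^ 2) (ae_of_all _ fun x => by
      rw [Real.norm_eq_abs, abs_of_nonneg (hq0 x)]; exact hqle x)
  have hsq : sqDist PX τ m u = ENNReal.ofReal (∫ x, q x ∂PX) := by
    rw [ofReal_integral_eq_lintegral_ofReal hint (ae_of_all _ hq0), sqDist]
    refine lintegral_congr fun x => ?_
    rw [ENNReal.ofReal_sum_of_nonneg fun j _ => sq_nonneg _]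
  have ha' : a ≤ ∫ x, q x ∂PX := by
    rw [hsq] at ha
    by_contra hlt
    exact absurd ha (not_lt.2 (ENNReal.ofReal_le_ofReal (not_le.1 hlt).le))
  rw [Measure.lintegral_compProd hmeas]
  have hinner : ∀ᵐ x ∂PX, ∫⁻ y, gibbsFactor ω τ m u (x, y) ∂κ x
      ≤ ENNReal.ofReal (1 - s / 2 * q x) := by
    filter_upwards [hPX] with x hx
    have hB : α * δ / (8 * (2 * L)) = α * δ / (16 * L) := by ring
    have := lintegral_exp_neg_totalDiff_le (u := fun j => u x (τ j)) (B := 2 * L) (w := ω)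
      (hm.regular x hx) hδL (herr x) hω hω1 (by rw [hB]; exact hω2)
    refine this.trans (ENNReal.ofReal_le_ofReal ?_)
    rw [hB, ← hs]
    have h1 : |(-(s * q x))| ≤ 1 := by
      rw [abs_neg, abs_of_nonneg (mul_nonneg hs0 (hq0 x))]
      exact (mul_le_mul_of_nonneg_left (hqle x) hs0).trans hω3
    have hsq0 : 0 ≤ s * q x := mul_nonneg hs0 (hq0 x)
    have hsq1 : s * q x ≤ 1 := (mul_le_mul_of_nonneg_left (hqle x) hs0).trans hω3
    -- `exp(-t) ≤ 1/(1+t) ≤ 1 - t/2` on `[0, 1]`.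
    have h2 : Real.exp (-(s * q x)) ≤ 1 / (1 + s * q x) := by
      rw [Real.exp_neg, one_div]
      exact inv_anti₀ (by linarith) (by linarith [Real.add_one_le_exp (s * q x)])
    refine h2.trans ?_
    rw [div_le_iff₀ (by linarith)]
    nlinarith
  refine (lintegral_mono_ae hinner).trans ?_
  have hnn : ∀ x, 0 ≤ 1 - s / 2 * q x := fun x => by
    have := (mul_le_mul_of_nonneg_left (hqle x) hs0).trans hω3
    linarith
  have hint2 : Integrable (fun x => s / 2 * q x) PX := hint.const_mul _
  have hint3 : Integrable (fun x => 1 - s / 2 * q x) PX := (integrable_const 1).sub hint2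
  rw [← ofReal_integral_eq_lintegral_ofReal hint3 (ae_of_all _ hnn)]
  refine ENNReal.ofReal_le_ofReal ?_
  rw [integral_sub (integrable_const 1) hint2, integral_const_mul]
  simp only [integral_const, probReal_univ, one_smul]
  have h1 := Real.add_one_le_exp (-(s / 2 * a))
  have h2 : s / 2 * a ≤ s / 2 * ∫ x, q x ∂PX := by gcongr
  have h3 : ω * (α * δ / (32 * L)) * a = s / 2 * a := by rw [hs]; ring
  rw [h3]
  linarith

/-- The contribution of one family of codes, in mean over the heights. -/
noncomputable def codeMass (v : ℝ≥0) (L ω a : ℝ) (PX : Measure (Fin d → ℝ)) (τ : Fin r → ℝ)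
    (m : (Fin d → ℝ) → Fin r → ℝ) (c : Fin K → BoxCode (Fin n × Fin r) (d + 1))
    (D : Sample d n) : ℝ≥0∞ :=
  ∫⁻ β, (Set.Ioi (ENNReal.ofReal a)).indicator 1 (sqDist PX τ m (codeFun L D τ c β)) *
    ∏ i, gibbsFactor ω τ m (codeFun L D τ c β) (D i) ∂(Measure.pi fun _ : Fin K => gaussianReal 0 v)

theorem measurable_sqDist_codeFun {PX : Measure (Fin d → ℝ)} [SFinite PX]
    (hm : Measurable m) (L : ℝ) (c : Fin K → BoxCode (Fin n × Fin r) (d + 1)) :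
    Measurable fun p : Sample d n × (Fin K → ℝ) => sqDist PX τ m (codeFun L p.1 τ c p.2) := by
  unfold sqDist
  refine Measurable.lintegral_prod_right' (f := fun p : (Sample d n × (Fin K → ℝ)) × (Fin d → ℝ) =>
    ∑ j, ENNReal.ofReal ((codeFun L p.1.1 τ c p.1.2 p.2 (τ j) - m p.2 j) ^ 2)) ?_
  refine Finset.measurable_sum _ fun j _ => (Measurable.pow_const ?_ 2).ennreal_ofReal
  exact (measurable_codeFun L τ c (τ j)).sub
    ((measurable_pi_apply j).comp (hm.comp measurable_snd))

theorem measurable_codeMass_integrand {PX : Measure (Fin d → ℝ)} [SFinite PX]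
    (hm : Measurable m) (L ω a : ℝ) (c : Fin K → BoxCode (Fin n × Fin r) (d + 1)) :
    Measurable fun p : Sample d n × (Fin K → ℝ) =>
      (Set.Ioi (ENNReal.ofReal a)).indicator (1 : ℝ≥0∞ → ℝ≥0∞)
          (sqDist PX τ m (codeFun L p.1 τ c p.2)) *
        ∏ i, gibbsFactor ω τ m (codeFun L p.1 τ c p.2) (p.1 i) := by
  refine Measurable.mul ?_ (Finset.measurable_prod _ fun i _ => ?_)
  · exact (measurable_one.indicator measurableSet_Ioi).comp (measurable_sqDist_codeFun hm L c)
  · have hD : Measurable fun p : Sample d n × (Fin K → ℝ) => p.1 i :=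
      (measurable_pi_apply i).comp measurable_fst
    have hU : ∀ j, Measurable fun p : Sample d n × (Fin K → ℝ) =>
        codeFun L p.1 τ c p.2 (p.1 i).1 (τ j) := fun j =>
      measurable_codeFun_comp L τ c (τ j) measurable_fst measurable_snd (measurable_fst.comp hD)
    exact measurable_gibbs_comp ω (measurable_pi_lambda _ hU) (hm.comp (measurable_fst.comp hD))
      (measurable_snd.comp hD)

theorem measurable_codeMass {PX : Measure (Fin d → ℝ)} [SFinite PX]
    (hm : Measurable m) (v : ℝ≥0) (L ω a : ℝ) (c : Fin K → BoxCode (Fin n × Fin r) (d + 1)) :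
    Measurable (codeMass v L ω a PX τ m c) :=
  (measurable_codeMass_integrand hm L ω a c).lintegral_prod_right'

/-- For fixed heights the function depends on at most `2(d+1)K` observations. Each of these
contributes a factor at most `e`; the remaining ones are independent of the function and contribute
the decay of `lintegral_gibbsFactor_le` whenever the function is far. -/
theorem lintegral_codeMass_le [IsMarkovKernel κ] {PX : Measure (Fin d → ℝ)}
    [IsProbabilityMeasure PX] (hPX : ∀ᵐ x ∂PX, x ∈ unitCube d)
    (hm : RegularModel κ τ m δ α A M₀ H ν) {L ω : ℝ} (hL : M₀ ≤ L) (hδL : δ ≤ 2 * L)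
    (hω : 0 ≤ ω) (hω1 : ω * (r * (2 * L)) ≤ 1) (hω2 : ω * r ≤ α * δ / (16 * L))
    (hω3 : ω * (α * δ / (16 * L)) * (r * (2 * L) ^ 2) ≤ 1) (v : ℝ≥0) {a : ℝ} (ha : 0 ≤ a)
    (c : Fin K → BoxCode (Fin n × Fin r) (d + 1)) :
    ∫⁻ D, codeMass v L ω a PX τ m c D ∂(Measure.pi fun _ : Fin n => PX ⊗ₘ κ) ≤
      ENNReal.ofReal (Real.exp ((2 * (d + 1) * K : ℕ)
        - ω * (α * δ / (32 * L)) * a * ((n : ℝ) - (2 * (d + 1) * K : ℕ)))) := by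
  have hL0 : 0 < L := by linarith [hm.delta_pos]
  have hα := hm.alpha_pos
  have hδ := hm.delta_pos
  unfold codeMass
  rw [lintegral_lintegral_swap (measurable_codeMass_integrand hm.measurable L ω a c).aemeasurable]
  set I := codeIndices c with hI
  have hIcard : I.card ≤ 2 * (d + 1) * K := card_codeIndices_le c
  set b := ENNReal.ofReal (Real.exp (ω * (r * (2 * L)))) with hb
  set e := ω * (α * δ / (32 * L)) * a with he
  have he0 : 0 ≤ e := by positivity
  have hfix : ∀ β : Fin K → ℝ, ∫⁻ D, (Set.Ioi (ENNReal.ofReal a)).indicator 1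
      (sqDist PX τ m (codeFun L D τ c β)) *
      ∏ i, gibbsFactor ω τ m (codeFun L D τ c β) (D i) ∂(Measure.pi fun _ : Fin n => PX ⊗ₘ κ)
      ≤ b ^ I.card * ENNReal.ofReal (Real.exp (-e)) ^ (n - I.card) := by
    intro β
    have hmeasu : ∀ D : Sample d n, ∀ j, Measurable fun x => codeFun L D τ c β x (τ j) :=
      fun D j => measurable_codeFun_comp L τ c (τ j) measurable_const measurable_const measurable_id
    refine lintegral_pi_prod_le_of_dependsOn (PX ⊗ₘ κ) I
      (Ψ := fun D => (Set.Ioi (ENNReal.ofReal a)).indicator 1 (sqDist PX τ m (codeFun L D τ c β)))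
      (Φ := fun D z => gibbsFactor ω τ m (codeFun L D τ c β) z) ?_ ?_ ?_ ?_ ?_ ?_
    · have hβ : Measurable fun D : Sample d n => (D, β) := measurable_prodMk_right
      have h := (measurable_codeMass_integrand (τ := τ) (PX := PX) hm.measurable L ω a c).comp hβ
      exact h
    · exact fun D => measurable_gibbsFactor ω hm.measurable (hmeasu D)
    · intro D D' hDD'
      simp only [codeFun_congr L τ c β hDD']
    · intro D D' hDD'
      simp only [codeFun_congr L τ c β hDD']
    · exact fun D z => gibbsFactor_le hm hL hω (abs_codeFun_le hL0.le D τ c β) z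
    · intro D
      simp only [Set.indicator_apply, Set.mem_Ioi, Fintype.card_fin, Pi.one_apply]
      split_ifs with hlt
      · rw [one_mul]
        gcongr
        exact lintegral_gibbsFactor_le hPX hm hL hδL hω hω1 hω2 hω3
          (abs_codeFun_le hL0.le D τ c β) (hmeasu D) hlt
      · simp
  refine (lintegral_mono hfix).trans ?_
  rw [lintegral_const, measure_univ, mul_one, hb, ← ENNReal.ofReal_pow (Real.exp_pos _).le,
    ← ENNReal.ofReal_pow (Real.exp_pos _).le, ← ENNReal.ofReal_mul (by positivity),
    ← Real.exp_nat_mul, ← Real.exp_nat_mul, ← Real.exp_add]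
  refine ENNReal.ofReal_le_ofReal (Real.exp_le_exp.2 ?_)
  have h1 : (I.card : ℝ) ≤ (2 * (d + 1) * K : ℕ) := by exact_mod_cast hIcard
  have h2 : (n : ℝ) - I.card ≤ (n - I.card : ℕ) := by
    rw [sub_le_iff_le_add]
    exact_mod_cast (by omega : n ≤ n - I.card + I.card)
  -- By `hω1` a named observation costs at most one unit in the exponent.
  have h3 : (I.card : ℝ) * (ω * (r * (2 * L))) ≤ (I.card : ℝ) * 1 := by gcongr
  have h4 : e * ((n : ℝ) - (2 * (d + 1) * K : ℕ)) ≤ e * (n - I.card : ℕ) := by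
    gcongr
    linarith
  linarith

end Compression

/-! ### Total mass and Poisson tail of the prior. -/

section Prior

variable {d n r : ℕ}

theorem tsum_ofReal_rate_pow {W lam t : ℝ} (hW : 0 ≤ W) (hlam : 0 ≤ lam) (ht : 0 ≤ t) :
    ∑' K : ℕ, ENNReal.ofReal (W * (lam ^ K / K.factorial) * t ^ K)
      = ENNReal.ofReal (W * Real.exp (lam * t)) := by
  have hs : HasSum (fun K : ℕ => W * (lam ^ K / K.factorial) * t ^ K)
      (W * Real.exp (lam * t)) := by
    have h1 := (NormedSpace.expSeries_div_hasSum_exp (lam * t)).mul_left W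
    rw [← Real.exp_eq_exp_ℝ] at h1
    refine h1.congr_fun fun K => ?_
    rw [mul_pow]; ring
  rw [← hs.tsum_eq, ENNReal.ofReal_tsum_of_nonneg (fun K => by positivity) hs.summable]

/-- Chernoff's bound: `1{K ≥ k} ≤ t^(K-k)`, summed with the generating function of the Poisson
weights. The factor `2^(d+1)` counts the sets `S`. -/
theorem rawPrior_card_ge_le (h : PriorParams) (D : Sample d n) (τ : Fin r → ℝ) {W : ℝ}
    (hW : 0 ≤ W) (hshell : ∀ (S : Finset (Fin (d + 1))) (K : ℕ),
      shellWeight h S K ≤ W * (h.rate ^ K / K.factorial)) {t : ℝ} (ht : 1 ≤ t) (k : ℕ)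
    {F : StepParam (d + 1) → ℝ≥0∞} (hF : Measurable F)
    (hF1 : ∀ θ, F θ ≤ {θ : StepParam (d + 1) | k ≤ θ.1.card}.indicator 1 θ) :
    ∫⁻ θ, F θ ∂rawPrior h D τ
      ≤ 2 ^ (d + 1) * ENNReal.ofReal (W * (t ^ k)⁻¹ * Real.exp (h.rate * t)) := by
  have hr := h.rate_pos
  have ht0 : 0 < t := by linarith
  refine (lintegral_rawPrior_le h D τ hF (fun K => ENNReal.ofReal ((t ^ k)⁻¹ * t ^ K)) ?_).trans ?_
  · rintro S K T hT
    have hpt : ∀ β : T → ℝ, F ⟨T, β⟩ ≤ ENNReal.ofReal ((t ^ k)⁻¹ * t ^ K) := by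
      intro β
      refine (hF1 _).trans ?_
      rw [Set.indicator_apply]
      split_ifs with hk
      · have hk' : k ≤ K := by rw [← hT.1]; exact hk
        rw [Pi.one_apply, ← ENNReal.ofReal_one]
        refine ENNReal.ofReal_le_ofReal ?_
        rw [inv_mul_eq_div, one_le_div (by positivity)]
        exact pow_le_pow_right₀ ht hk'
      · exact zero_le
    refine (lintegral_mono hpt).trans ?_
    simp
  · have hS : ∀ S : Finset (Fin (d + 1)),
        ∑' K, ENNReal.ofReal (shellWeight h S K) * ENNReal.ofReal ((t ^ k)⁻¹ * t ^ K)
          ≤ ENNReal.ofReal (W * (t ^ k)⁻¹ * Real.exp (h.rate * t)) := by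
      intro S
      rw [← tsum_ofReal_rate_pow (by positivity) hr.le ht0.le]
      refine ENNReal.tsum_le_tsum fun K => ?_
      rw [mul_comm, ← ENNReal.ofReal_mul (by positivity)]
      refine ENNReal.ofReal_le_ofReal ?_
      calc (t ^ k)⁻¹ * t ^ K * shellWeight h S K
          ≤ (t ^ k)⁻¹ * t ^ K * (W * (h.rate ^ K / K.factorial)) := by
            gcongr; exact hshell S K
        _ = _ := by ring
    refine (Finset.sum_le_sum fun S _ => hS S).trans_eq ?_
    simp

theorem rawPrior_ne_top (h : PriorParams) (D : Sample d n) (τ : Fin r → ℝ)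
    (s : Set (StepParam (d + 1))) : rawPrior h D τ s ≠ ∞ := by
  obtain ⟨_, _, W, hW, hshell⟩ := exists_shellWeight_bounds h (d + 1)
  refine ne_top_of_le_ne_top ?_ (measure_mono (Set.subset_univ s))
  have := rawPrior_card_ge_le h D τ hW.le (fun S K => (hshell S K).2) le_rfl 0
    (F := fun _ => 1) measurable_const (fun θ => by simp)
  rw [lintegral_one] at this
  refine ne_top_of_le_ne_top ?_ this
  exact ENNReal.mul_ne_top (by simp) ENNReal.ofReal_ne_top

theorem measurableSet_card (s : Set ℕ) :
    MeasurableSet {θ : StepParam (d + 1) | θ.1.card ∈ s} :=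
  measurableSet_of_stepMk fun T => by
    by_cases hT : T.card ∈ s
    · have : stepMk T ⁻¹' {θ : StepParam (d + 1) | θ.1.card ∈ s} = Set.univ :=
        Set.eq_univ_of_forall fun _ => hT
      rw [this]; exact MeasurableSet.univ
    · have : stepMk T ⁻¹' {θ : StepParam (d + 1) | θ.1.card ∈ s} = ∅ :=
        Set.eq_empty_of_forall_notMem fun _ => hT
      rw [this]; exact MeasurableSet.empty

end Prior

/-! ### The numerator, split into trees with many and with few cells. -/

section Parts

variable {d n r : ℕ} {κ : Kernel (Fin d → ℝ) ℝ} {τ : Fin r → ℝ}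
  {m : (Fin d → ℝ) → Fin r → ℝ} {δ α A M₀ H ν : ℝ}

theorem gibbs_eq_prod (ω : ℝ) (D : Sample d n) (τ : Fin r → ℝ) (m : (Fin d → ℝ) → Fin r → ℝ)
    (θ : StepParam (d + 1)) :
    gibbs ω D τ (fun i => m (D i).1) θ = ∏ i, gibbsFactor ω τ m (stepQuantile θ) (D i) := by
  rw [gibbs, ← neg_mul, ofReal_exp_mul_sum]
  simp only [gibbsFactor, neg_mul]

/-- The contribution of the partitions with at least `k` cells. -/
noncomputable def largeMass (h : PriorParams) (L ω : ℝ) (k : ℕ) (D : Sample d n) (τ : Fin r → ℝ)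
    (m : (Fin d → ℝ) → Fin r → ℝ) : ℝ≥0∞ :=
  ∫⁻ θ in boundedSteps (d + 1) L ∩ {θ | θ.1.card ∈ Set.Ici k},
    gibbs ω D τ (fun i => m (D i).1) θ ∂rawPrior h D τ

/-- The integrand of `largeMass` for given covariates `x`. -/
noncomputable def largeIntegrand (L ω : ℝ) (k : ℕ) (x : Fin n → Fin d → ℝ) (τ : Fin r → ℝ)
    (m : (Fin d → ℝ) → Fin r → ℝ) (θ : StepParam (d + 1)) (D : Sample d n) : ℝ≥0∞ :=
  (boundedSteps (d + 1) L ∩ {θ : StepParam (d + 1) | θ.1.card ∈ Set.Ici k}).indicator 1 θ *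
    ∏ i, ENNReal.ofReal (Real.exp (-(ω *
      totalDiff τ (fun j => stepQuantile θ (x i) (τ j)) (m (x i)) (D i).2)))

theorem measurable_largeIntegrand (L ω : ℝ) (k : ℕ) (x : Fin n → Fin d → ℝ)
    (T : Finset (Set (Fin (d + 1) → ℝ))) : Measurable fun p : (T → ℝ) × Sample d n =>
      largeIntegrand L ω k x τ m (stepMk T p.1) p.2 := by
  refine Measurable.mul ?_ (Finset.measurable_prod _ fun i _ => ?_)
  · exact (measurable_one.indicator ((measurableSet_boundedSteps L).inter
      (measurableSet_card _))).comp ((measurable_stepMk T).comp measurable_fst)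
  · exact measurable_gibbs_comp ω (measurable_pi_lambda _ fun j =>
      (measurable_stepFun _).comp ((measurable_stepMk T).comp measurable_fst))
      measurable_const (measurable_snd.comp ((measurable_pi_apply i).comp measurable_snd))

theorem largeMass_ae_eq [IsMarkovKernel κ] (h : PriorParams) (L ω : ℝ) (k : ℕ)
    (x : Fin n → Fin d → ℝ) : ∀ᵐ D ∂condLaw κ x, largeMass h L ω k D τ m =
      ∫⁻ θ, largeIntegrand L ω k x τ m θ D ∂rawPrior h (fun i => (x i, 0)) τ := by
  have hBm : MeasurableSet (boundedSteps (d + 1) L ∩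
      {θ : StepParam (d + 1) | θ.1.card ∈ Set.Ici k}) :=
    (measurableSet_boundedSteps L).inter (measurableSet_card _)
  filter_upwards [ae_condLaw_fst κ x] with D hD
  rw [largeMass, rawPrior_congr h τ (D' := fun i => (x i, 0)) hD, ← lintegral_indicator hBm]
  refine lintegral_congr fun θ => ?_
  by_cases hθ : θ ∈ boundedSteps (d + 1) L ∩ {θ : StepParam (d + 1) | θ.1.card ∈ Set.Ici k}
  · rw [Set.indicator_of_mem hθ, gibbs_eq_prod]
    simp only [largeIntegrand, Set.indicator_of_mem hθ, Pi.one_apply, one_mul, gibbsFactor, hD]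
  · simp only [largeIntegrand, Set.indicator_of_notMem hθ, zero_mul]

theorem aemeasurable_largeMass [IsMarkovKernel κ] (h : PriorParams) (L ω : ℝ) (k : ℕ)
    (x : Fin n → Fin d → ℝ) :
    AEMeasurable (fun D => largeMass h L ω k D τ m) (condLaw κ x) :=
  ⟨_, measurable_lintegral_rawPrior h _ τ (measurable_largeIntegrand L ω k x),
    largeMass_ae_eq h L ω k x⟩

/-- Given the covariates, every bounded step function has Gibbs weight of mean at most one, so after
interchanging integrals only the prior mass of the large trees is left. -/
theorem lintegral_largeMass_le [IsMarkovKernel κ] (hm : RegularModel κ τ m δ α A M₀ H ν)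
    (h : PriorParams) {L ω : ℝ} (hL : M₀ ≤ L) (hδL : δ ≤ 2 * L)
    (hω : 0 ≤ ω) (hω1 : ω * (r * (2 * L)) ≤ 1) (hω2 : ω * r ≤ α * δ / (16 * L)) {W : ℝ}
    (hW : 0 ≤ W) (hshell : ∀ (S : Finset (Fin (d + 1))) (K : ℕ),
      shellWeight h S K ≤ W * (h.rate ^ K / K.factorial)) {t : ℝ} (ht : 1 ≤ t) (k : ℕ)
    (x : Fin n → Fin d → ℝ) (hx : ∀ i, x i ∈ unitCube d) :
    ∫⁻ D, largeMass h L ω k D τ m ∂condLaw κ x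
      ≤ 2 ^ (d + 1) * ENNReal.ofReal (W * (t ^ k)⁻¹ * Real.exp (h.rate * t)) := by
  let D₀ : Sample d n := fun i => (x i, 0)
  have hL0 : 0 < L := by linarith [hm.delta_pos]
  have hα := hm.alpha_pos
  have hδ := hm.delta_pos
  set B := boundedSteps (d + 1) L ∩ {θ : StepParam (d + 1) | θ.1.card ∈ Set.Ici k} with hB
  have hBm : MeasurableSet B := (measurableSet_boundedSteps L).inter (measurableSet_card _)
  have hFm := measurable_largeIntegrand (n := n) (τ := τ) (m := m) L ω k x
  rw [lintegral_congr_ae (largeMass_ae_eq h L ω k x),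
    lintegral_lintegral_rawPrior_swap h D₀ τ (condLaw κ x) hFm]
  refine rawPrior_card_ge_le h D₀ τ hW hshell ht k
    (measurable_of_stepMk fun T => (hFm T).lintegral_prod_right') fun θ => ?_
  by_cases hθ : θ ∈ B
  · have hind : ∀ D : Sample d n, largeIntegrand L ω k x τ m θ D =
        ∏ i, ENNReal.ofReal (Real.exp (-(ω *
          totalDiff τ (fun j => stepQuantile θ (x i) (τ j)) (m (x i)) (D i).2))) := fun D => by
      simp only [largeIntegrand, ← hB, Set.indicator_of_mem hθ, Pi.one_apply, one_mul]
    simp only [hind]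
    have hk : θ ∈ {θ : StepParam (d + 1) | k ≤ θ.1.card} := hθ.2
    rw [Set.indicator_of_mem hk, lintegral_condLaw_prod κ x (f := fun i z =>
      ENNReal.ofReal (Real.exp (-(ω *
        totalDiff τ (fun j => stepQuantile θ (x i) (τ j)) (m (x i)) z.2))))
        fun i => measurable_gibbs_comp ω measurable_const measurable_const measurable_snd]
    refine Finset.prod_le_one' fun i _ => ?_
    have herr : ∀ j, |stepQuantile θ (x i) (τ j) - m (x i) j| ≤ 2 * L := fun j => by
      have h1 : |stepQuantile θ (x i) (τ j)| ≤ L :=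
        hθ.1 _ (designPoint_mem_unitCube (D := D₀) hm.level hx (i, j))
      have h2 := abs_sub (stepQuantile θ (x i) (τ j)) (m (x i) j)
      have h3 := hm.abs_le (x i) j
      linarith
    have hBe : α * δ / (8 * (2 * L)) = α * δ / (16 * L) := by ring
    refine (lintegral_exp_neg_totalDiff_le (hm.regular (x i) (hx i)) hδL herr hω hω1
      (by rw [hBe]; exact hω2)).trans ?_
    rw [← ENNReal.ofReal_one]
    refine ENNReal.ofReal_le_ofReal (Real.exp_le_one_iff.2 ?_)
    have : 0 ≤ ∑ j, (stepQuantile θ (x i) (τ j) - m (x i) j) ^ 2 :=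
      Finset.sum_nonneg fun j _ => sq_nonneg _
    have : 0 ≤ ω * (α * δ / (8 * (2 * L))) *
      ∑ j, (stepQuantile θ (x i) (τ j) - m (x i) j) ^ 2 := by positivity
    linarith
  · have hind : ∀ D : Sample d n, largeIntegrand L ω k x τ m θ D = 0 := fun D => by
      simp only [largeIntegrand, ← hB, Set.indicator_of_notMem hθ, zero_mul]
    simp only [hind, lintegral_zero]
    exact zero_le

/-- The step functions that are far from the reference predictions. Those with nonmeasurable
cells are included, which makes this set measurable. -/
def farSteps (PX : Measure (Fin d → ℝ)) (τ : Fin r → ℝ) (m : (Fin d → ℝ) → Fin r → ℝ) (a : ℝ) :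
    Set (StepParam (d + 1)) :=
  {θ | (∀ Ω ∈ θ.1, MeasurableSet Ω) → ENNReal.ofReal a < sqDist PX τ m (stepQuantile θ)}

theorem measurableSet_farSteps (PX : Measure (Fin d → ℝ)) [SFinite PX] (hm : Measurable m)
    (a : ℝ) : MeasurableSet (farSteps PX τ m a) := by
  classical
  refine measurableSet_of_stepMk fun T => ?_
  by_cases hT : ∀ Ω ∈ T, MeasurableSet Ω
  · have hset : stepMk T ⁻¹' farSteps PX τ m a =
        {β | ENNReal.ofReal a < sqDist PX τ m (stepQuantile (stepMk T β))} := by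
      ext β
      exact ⟨fun hβ => hβ hT, fun hβ _ => hβ⟩
    have hstep : ∀ t, Measurable fun p : (T → ℝ) × (Fin d → ℝ) =>
        stepQuantile (stepMk T p.1) p.2 t := by
      intro t
      have : (fun p : (T → ℝ) × (Fin d → ℝ) => stepQuantile (stepMk T p.1) p.2 t) =
          fun p => ∑ Ω : T, if (Fin.snoc p.2 t : Fin (d + 1) → ℝ) ∈ (Ω : Set (Fin (d + 1) → ℝ))
            then p.1 Ω else 0 := by
        funext p; simp [stepQuantile, stepFun, Set.indicator_apply]
      rw [this]
      refine Finset.measurable_sum _ fun Ω _ => Measurable.ite ?_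
        ((measurable_pi_apply Ω).comp measurable_fst) measurable_const
      exact ((measurable_snoc t).comp measurable_snd) (hT Ω Ω.2)
    rw [hset]
    refine measurableSet_lt measurable_const ?_
    refine Measurable.lintegral_prod_right' (f := fun p : (T → ℝ) × (Fin d → ℝ) =>
      ∑ j, ENNReal.ofReal ((stepQuantile (stepMk T p.1) p.2 (τ j) - m p.2 j) ^ 2)) ?_
    exact Finset.measurable_sum _ fun j _ => (((hstep (τ j)).sub
      ((measurable_pi_apply j).comp (hm.comp measurable_snd))).pow_const 2).ennreal_ofReal
  · have hset : stepMk T ⁻¹' farSteps PX τ m a = Set.univ :=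
      Set.eq_univ_of_forall fun β h => absurd h hT
    rw [hset]
    exact MeasurableSet.univ

/-- The contribution of the partitions with fewer than `k` cells, bounded by a sum over codes. -/
noncomputable def smallMass (v : ℝ≥0) (W L ω a : ℝ) (k : ℕ) (PX : Measure (Fin d → ℝ))
    (τ : Fin r → ℝ) (m : (Fin d → ℝ) → Fin r → ℝ) (D : Sample d n) : ℝ≥0∞ :=
  ∑ _S : Finset (Fin (d + 1)), ∑ K ∈ Finset.range k, ENNReal.ofReal W *
    ∑ c : Fin K → BoxCode (Fin n × Fin r) (d + 1), codeMass v L ω a PX τ m c D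

/-- Clipping is inactive: inside the cube by the sup-norm bound, outside because both sides vanish.
It is there to keep `codeFun` bounded for all heights and codes, including those outside the support
of the truncated prior. -/
theorem stepQuantile_eq_codeFun {K : ℕ} {D : Sample d n} {L : ℝ} (hL : 0 ≤ L)
    {T : Finset (Set (Fin (d + 1) → ℝ))} (β : T → ℝ) (hβ : stepMk T β ∈ boundedSteps (d + 1) L)
    (c : Fin K → BoxCode (Fin n × Fin r) (d + 1)) (e : Fin K ≃ T)
    (he : ∀ k, (e k : Set (Fin (d + 1) → ℝ)) = codeBox (designPoint D τ) (c k)) :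
    stepQuantile (stepMk T β) = codeFun L D τ c fun k => β (e k) := by
  funext x t
  have hsum : stepQuantile (stepMk T β) x t =
      ∑ k, (codeBox (designPoint D τ) (c k)).indicator (fun _ => β (e k))
        (Fin.snoc x t : Fin (d + 1) → ℝ) := by
    simp only [stepQuantile, stepFun, ← he]
    exact (Equiv.sum_comp e fun Ω : T => (Ω : Set (Fin (d + 1) → ℝ)).indicator (fun _ => β Ω)
      (Fin.snoc x t : Fin (d + 1) → ℝ)).symm
  rw [codeFun, ← hsum, clip_of_abs_le]
  by_cases hx : (Fin.snoc x t : Fin (d + 1) → ℝ) ∈ unitCube (d + 1)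
  · exact hβ _ hx
  · have : stepQuantile (stepMk T β) x t = 0 := by
      rw [hsum]
      exact Finset.sum_eq_zero fun k _ => Set.indicator_of_notMem (fun h => hx h.1) _
    rw [this]
    simpa using hL

/-- The conditional weight of a partition is bounded by one, and each partition is charged to its
own code. The resulting sum runs over a set of codes that does not depend on the data. -/
theorem setLIntegral_gibbs_le_smallMass (h : PriorParams) {PX : Measure (Fin d → ℝ)} [SFinite PX]
    (hm : Measurable m) {L ω a W : ℝ} (hL : 0 ≤ L)
    (hshell : ∀ (S : Finset (Fin (d + 1))) (K : ℕ), shellWeight h S K ≤ W) (k : ℕ)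
    (D : Sample d n) :
    ∫⁻ θ in boundedSteps (d + 1) L ∩ {θ | θ.1.card ∈ Set.Iio k} ∩ farSteps PX τ m a,
      gibbs ω D τ (fun i => m (D i).1) θ ∂rawPrior h D τ
      ≤ smallMass h.variance W L ω a k PX τ m D := by
  classical
  set B := boundedSteps (d + 1) L ∩ {θ : StepParam (d + 1) | θ.1.card ∈ Set.Iio k} ∩
    farSteps PX τ m a with hB
  have hBm : MeasurableSet B := ((measurableSet_boundedSteps L).inter (measurableSet_card _)).inter
    (measurableSet_farSteps PX hm a)
  have hF : Measurable (B.indicator (gibbs ω D τ fun i => m (D i).1)) :=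
    (measurable_gibbs _ _ _ _).indicator hBm
  rw [← lintegral_indicator hBm, lintegral_rawPrior h D τ hF, smallMass]
  refine Finset.sum_le_sum fun S _ => ?_
  have hterm : ∀ K, ∀ T : validPartitions h D τ S K,
      ∀ (e : Fin K ≃ (T : Finset (Set (Fin (d + 1) → ℝ)))) (c : Fin K → BoxCode (Fin n × Fin r) (d + 1)),
      (∀ k, (e k : Set (Fin (d + 1) → ℝ)) = codeBox (designPoint D τ) (c k)) →
      cellWeight h D τ S K * ∫⁻ β, B.indicator (gibbs ω D τ fun i => m (D i).1) ⟨T, β⟩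
        ∂(Measure.pi fun _ => gaussianReal 0 h.variance)
      ≤ ENNReal.ofReal W * codeMass h.variance L ω a PX τ m c D := by
    rintro K ⟨T, hT⟩ e c he
    simp only at e he ⊢
    have hw : cellWeight h D τ S K ≤ ENNReal.ofReal W := by
      have hne : (validPartitions h D τ S K).Nonempty := ⟨T, hT⟩
      have hpos : 0 < (validPartitions h D τ S K).ncard := (Set.ncard_pos (Set.toFinite _)).2 hne
      rw [cellWeight]
      calc _ ≤ ENNReal.ofReal W * 1 := by
            refine mul_le_mul' (ENNReal.ofReal_le_ofReal (hshell S K)) ?_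
            rw [ENNReal.inv_le_one]
            exact_mod_cast hpos
        _ = _ := mul_one _
    refine mul_le_mul' hw ?_
    have hG : Measurable fun β : T → ℝ =>
        B.indicator (gibbs ω D τ fun i => m (D i).1) (stepMk T β) := hF.comp (measurable_stepMk T)
    rw [codeMass, ← (measurePreserving_piCongrLeft (fun _ : T =>
      gaussianReal 0 h.variance) e).lintegral_comp hG]
    refine lintegral_mono fun β => ?_
    set β' : T → ℝ :=
      MeasurableEquiv.piCongrLeft (fun _ => ℝ) e β with hβ'
    have hβe : (fun k => β' (e k)) = β := by
      funext k
      exact Equiv.piCongrLeft_apply_apply (fun _ => ℝ) e β k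
    by_cases hmem : stepMk T β' ∈ B
    · have hq := stepQuantile_eq_codeFun (τ := τ) hL β' hmem.1.1 c e he
      rw [hβe] at hq
      have hcells : ∀ Ω ∈ T, MeasurableSet Ω := by
        intro Ω hΩ
        have := he (e.symm ⟨Ω, hΩ⟩)
        rw [Equiv.apply_symm_apply] at this
        simp only at this
        rw [this]
        exact measurableSet_codeBox _ _
      have hfar := hmem.2 hcells
      rw [hq] at hfar
      have hfar' : sqDist PX τ m (codeFun L D τ c β) ∈ Set.Ioi (ENNReal.ofReal a) := hfar
      rw [Set.indicator_of_mem hmem, Set.indicator_of_mem hfar', gibbs_eq_prod, hq, Pi.one_apply,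
        one_mul]
    · rw [Set.indicator_of_notMem hmem]
      exact zero_le
  have hzero : ∀ K ∉ Finset.range k, ∑' T : validPartitions h D τ S K, cellWeight h D τ S K *
      ∫⁻ β, B.indicator (gibbs ω D τ fun i => m (D i).1) ⟨T, β⟩
        ∂(Measure.pi fun _ => gaussianReal 0 h.variance) = 0 := by
    intro K hK
    refine ENNReal.tsum_eq_zero.2 ?_
    rintro ⟨T, hT⟩
    have : ∀ β : T → ℝ,
        B.indicator (gibbs ω D τ fun i => m (D i).1) ⟨T, β⟩ = 0 := fun β => by
      refine Set.indicator_of_notMem (fun hmem => hK (Finset.mem_range.2 ?_)) _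
      rw [← hT.1]
      exact hmem.1.2
    simp only [this, lintegral_zero, mul_zero]
  rw [tsum_eq_sum hzero]
  refine Finset.sum_le_sum fun K _ => ?_
  obtain ⟨c, hc, he⟩ := exists_injective_code h D τ S K
  rw [Finset.mul_sum, ← tsum_fintype (L := .unconditional _)]
  -- Distinct partitions have distinct codes, so the sum over all codes dominates.
  refine le_trans (ENNReal.tsum_le_tsum fun T => ?_) (ENNReal.tsum_comp_le_tsum_of_injective hc
    fun c => ENNReal.ofReal W * codeMass h.variance L ω a PX τ m c D)
  obtain ⟨e, hek⟩ := he T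
  exact hterm K T e (c T) hek

theorem measurable_smallMass {PX : Measure (Fin d → ℝ)} [SFinite PX]
    (hm : Measurable m) (v : ℝ≥0) (W L ω a : ℝ) (k : ℕ) :
    Measurable (smallMass (n := n) v W L ω a k PX τ m) :=
  Finset.measurable_sum _ fun _ _ => Finset.measurable_sum _ fun _ _ =>
    (Finset.measurable_sum _ fun c _ => measurable_codeMass hm v L ω a c).const_mul _

theorem lintegral_smallMass_le [IsMarkovKernel κ] {PX : Measure (Fin d → ℝ)}
    [IsProbabilityMeasure PX] (hPX : ∀ᵐ x ∂PX, x ∈ unitCube d)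
    (hm : RegularModel κ τ m δ α A M₀ H ν) {L ω : ℝ} (hL : M₀ ≤ L) (hδL : δ ≤ 2 * L)
    (hω : 0 ≤ ω) (hω1 : ω * (r * (2 * L)) ≤ 1) (hω2 : ω * r ≤ α * δ / (16 * L))
    (hω3 : ω * (α * δ / (16 * L)) * (r * (2 * L) ^ 2) ≤ 1) (v : ℝ≥0) {a : ℝ} (ha : 0 ≤ a)
    (W : ℝ) (k : ℕ) :
    ∫⁻ D, smallMass v W L ω a k PX τ m D ∂(Measure.pi fun _ : Fin n => PX ⊗ₘ κ) ≤
      2 ^ (d + 1) * (k * (ENNReal.ofReal W * ((((n * r + 1) ^ 2) ^ (d + 1)) ^ k : ℕ) *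
      ENNReal.ofReal (Real.exp ((2 * (d + 1) * k : ℕ)
        - ω * (α * δ / (32 * L)) * a * ((n : ℝ) - (2 * (d + 1) * k : ℕ)))))) := by
  have hL0 : 0 < L := by linarith [hm.delta_pos]
  have hα := hm.alpha_pos
  have hδ := hm.delta_pos
  unfold smallMass
  have hcm : ∀ K, Measurable fun D => ∑ c : Fin K → BoxCode (Fin n × Fin r) (d + 1),
      codeMass v L ω a PX τ m c D := fun K =>
    Finset.measurable_sum _ fun c _ => measurable_codeMass hm.measurable v L ω a c
  rw [lintegral_finsetSum _ fun S _ => Finset.measurable_sum _ fun K _ => (hcm K).const_mul _]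
  set Q := ENNReal.ofReal (Real.exp ((2 * (d + 1) * k : ℕ)
        - ω * (α * δ / (32 * L)) * a * ((n : ℝ) - (2 * (d + 1) * k : ℕ)))) with hQ
  set N := ((n * r + 1) ^ 2) ^ (d + 1) with hN
  have hN1 : 1 ≤ N := Nat.one_le_pow _ _ (Nat.one_le_pow _ _ (by omega))
  have hS : ∀ _S : Finset (Fin (d + 1)), ∫⁻ D, ∑ K ∈ Finset.range k, ENNReal.ofReal W *
      ∑ c : Fin K → BoxCode (Fin n × Fin r) (d + 1), codeMass v L ω a PX τ m c D
        ∂(Measure.pi fun _ : Fin n => PX ⊗ₘ κ)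
      ≤ k * (ENNReal.ofReal W * (N ^ k : ℕ) * Q) := by
    intro S
    rw [lintegral_finsetSum _ fun K _ => (hcm K).const_mul _]
    refine (Finset.sum_le_card_nsmul _ _ (ENNReal.ofReal W * (N ^ k : ℕ) * Q)
      fun K hK => ?_).trans_eq (by simp)
    have hKk : K ≤ k := (Finset.mem_range.1 hK).le
    rw [lintegral_const_mul _ (hcm K),
      lintegral_finsetSum _ fun c _ => measurable_codeMass hm.measurable v L ω a c, mul_assoc]
    gcongr
    have hc : ∀ c : Fin K → BoxCode (Fin n × Fin r) (d + 1), ∫⁻ D, codeMass v L ω a PX τ m c D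
        ∂(Measure.pi fun _ : Fin n => PX ⊗ₘ κ) ≤ Q := by
      intro c
      refine (lintegral_codeMass_le hPX hm hL hδL hω hω1 hω2 hω3 v ha c).trans ?_
      refine ENNReal.ofReal_le_ofReal (Real.exp_le_exp.2 ?_)
      have h1 : ((2 * (d + 1) * K : ℕ) : ℝ) ≤ (2 * (d + 1) * k : ℕ) := by
        exact_mod_cast Nat.mul_le_mul_left _ hKk
      have h2 : 0 ≤ ω * (α * δ / (32 * L)) * a := by positivity
      have h3 := mul_le_mul_of_nonneg_left (sub_le_sub_left h1 (n : ℝ)) h2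
      linarith
    refine (Finset.sum_le_card_nsmul _ _ Q fun c _ => hc c).trans ?_
    rw [nsmul_eq_mul, Finset.card_univ, Fintype.card_fun, card_boxCode, Fintype.card_prod,
      Fintype.card_fin, Fintype.card_fin, Fintype.card_fin, ← hN]
    gcongr
  refine (Finset.sum_le_sum fun S _ => hS S).trans_eq ?_
  simp

end Parts

/-! ### The posterior mass of the far step functions. -/

/-- Used with `a` the reciprocal evidence and `b` the numerator: if `a ≤ s` the first term
dominates, otherwise `1 ≤ s⁻¹ a`. The two can then be averaged separately. -/
theorem le_mul_add_inv_mul {p a b s : ℝ≥0∞} (hp : p ≤ 1) (hpab : p ≤ a * b) (hs : s ≠ 0)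
    (hs' : s ≠ ∞) : p ≤ s * b + s⁻¹ * a := by
  rcases le_total a s with h | h
  · calc p ≤ a * b := hpab
      _ ≤ s * b := by gcongr
      _ ≤ _ := le_self_add
  · calc p ≤ 1 := hp
      _ = s⁻¹ * s := (ENNReal.inv_mul_cancel hs hs').symm
      _ ≤ s⁻¹ * a := by gcongr
      _ ≤ _ := le_add_self

section Posterior

variable {d n r : ℕ} {κ : Kernel (Fin d → ℝ) ℝ} {τ : Fin r → ℝ}
  {m : (Fin d → ℝ) → Fin r → ℝ} {δ α A M₀ H ν : ℝ}

theorem gibbs_le (hτ : ∀ j, τ j ∈ Set.Ioo (0 : ℝ) 1) {ω : ℝ} (hω : 0 ≤ ω) (D : Sample d n)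
    (m : Fin n → Fin r → ℝ) (θ : StepParam (d + 1)) : gibbs ω D τ m θ ≤
      ENNReal.ofReal (Real.exp (ω * ∑ i, ∑ j, checkLoss (τ j) ((D i).2 - m i j))) := by
  refine ENNReal.ofReal_le_ofReal (Real.exp_le_exp.2 ?_)
  rw [← mul_neg, ← Finset.sum_neg_distrib]
  refine mul_le_mul_of_nonneg_left (Finset.sum_le_sum fun i _ => ?_) hω
  rw [totalDiff, ← Finset.sum_neg_distrib]
  refine Finset.sum_le_sum fun j _ => ?_
  have := checkLoss_nonneg (hτ j) ((D i).2 - stepQuantile θ (D i).1 (τ j))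
  rw [lossDiff]
  linarith

theorem evidence_ne_top (hτ : ∀ j, τ j ∈ Set.Ioo (0 : ℝ) 1) (h : PriorParams) (L : ℝ) {ω : ℝ}
    (hω : 0 ≤ ω) (D : Sample d n) (m : (Fin d → ℝ) → Fin r → ℝ) : evidence h L ω D τ m ≠ ∞ := by
  refine ne_top_of_le_ne_top ?_ (lintegral_mono fun θ => gibbs_le hτ hω D _ θ)
  rw [setLIntegral_const]
  exact ENNReal.mul_ne_top ENNReal.ofReal_ne_top (rawPrior_ne_top h D τ _)

theorem rawPrior_boundedSteps_ne_zero {h : PriorParams} {L ω : ℝ} {D : Sample d n}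
    (hev : evidence h L ω D τ m ≠ 0) : rawPrior h D τ (boundedSteps (d + 1) L) ≠ 0 := fun h0 =>
  hev (by rw [evidence, Measure.restrict_eq_zero.2 h0, lintegral_zero_measure])

theorem posterior_apply_le {h : PriorParams} {L ω : ℝ} {D : Sample d n}
    (hev : evidence h L ω D τ m ≠ 0) {B : Set (StepParam (d + 1))} (hB : MeasurableSet B) :
    posterior h L ω D τ B = (evidence h L ω D τ m)⁻¹ *
      ∫⁻ θ in boundedSteps (d + 1) L ∩ B, gibbs ω D τ (fun i => m (D i).1) θ ∂rawPrior h D τ := by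
  rw [posterior_eq h L ω D τ (fun i => m (D i).1) (rawPrior_boundedSteps_ne_zero hev)
    (rawPrior_ne_top h D τ _), Measure.smul_apply, withDensity_apply _ hB,
    Measure.restrict_restrict hB, Set.inter_comm B, smul_eq_mul, evidence]

theorem isProbabilityMeasure_posterior (hτ : ∀ j, τ j ∈ Set.Ioo (0 : ℝ) 1) {h : PriorParams}
    {L ω : ℝ} (hω : 0 ≤ ω) {D : Sample d n} (hev : evidence h L ω D τ m ≠ 0) :
    IsProbabilityMeasure (posterior h L ω D τ) := by
  refine ⟨?_⟩
  rw [posterior_apply_le hev MeasurableSet.univ, Set.inter_univ]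
  exact ENNReal.inv_mul_cancel hev (evidence_ne_top hτ h L hω D m)

theorem posterior_farSteps_le (h : PriorParams) {PX : Measure (Fin d → ℝ)} [SFinite PX]
    (hm : Measurable m) {L ω a W : ℝ} (hL : 0 ≤ L)
    (hshell : ∀ (S : Finset (Fin (d + 1))) (K : ℕ), shellWeight h S K ≤ W) (k : ℕ)
    {D : Sample d n} (hev : evidence h L ω D τ m ≠ 0) :
    posterior h L ω D τ (farSteps PX τ m a) ≤ (evidence h L ω D τ m)⁻¹ *
      (largeMass h L ω k D τ m + smallMass h.variance W L ω a k PX τ m D) := by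
  rw [posterior_apply_le hev (measurableSet_farSteps PX hm a)]
  gcongr
  refine le_trans ?_ (add_le_add_right
    (setLIntegral_gibbs_le_smallMass (ω := ω) (a := a) h (PX := PX) hm hL hshell k D) _)
  refine le_trans (lintegral_mono_set fun θ hθ => ?_) (lintegral_union_le _ _ _)
  rcases le_or_gt k θ.1.card with hk | hk
  · exact Or.inl ⟨hθ.1, hk⟩
  · exact Or.inr ⟨⟨hθ.1, hk⟩, hθ.2⟩

theorem ae_pi_mem_unitCube {PX : Measure (Fin d → ℝ)} [IsProbabilityMeasure PX]
    (hPX : ∀ᵐ x ∂PX, x ∈ unitCube d) :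
    ∀ᵐ x ∂(Measure.pi fun _ : Fin n => PX), ∀ i, x i ∈ unitCube d :=
  ae_all_iff.2 fun i =>
    (measurePreserving_eval (fun _ : Fin n => PX) i).quasiMeasurePreserving.ae hPX

theorem ae_sample_mem_unitCube [IsMarkovKernel κ] {PX : Measure (Fin d → ℝ)}
    [IsProbabilityMeasure PX] (hPX : ∀ᵐ x ∂PX, x ∈ unitCube d) :
    ∀ᵐ D ∂(Measure.pi fun _ : Fin n => PX ⊗ₘ κ), ∀ i, (D i).1 ∈ unitCube d := by
  refine ae_all_iff.2 fun i => ?_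
  have h1 : ∀ᵐ z ∂(PX ⊗ₘ κ), z.1 ∈ unitCube d := by
    rw [← Measure.fst_compProd PX κ] at hPX
    exact ae_of_ae_map measurable_fst.aemeasurable hPX
  exact (measurePreserving_eval (fun _ : Fin n => PX ⊗ₘ κ) i).quasiMeasurePreserving.ae h1

/-- The expected posterior mass of the step functions far from the reference predictions. -/
theorem lintegral_posterior_farSteps_le [IsMarkovKernel κ] {PX : Measure (Fin d → ℝ)}
    [IsProbabilityMeasure PX] (hPX : ∀ᵐ x ∂PX, x ∈ unitCube d)
    (hτ : ∀ j, τ j ∈ Set.Ioo (0 : ℝ) 1) (hm : Measurable m) (h : PriorParams) {L ω a W : ℝ}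
    (hL : 0 ≤ L) (hω : 0 ≤ ω)
    (hshell : ∀ (S : Finset (Fin (d + 1))) (K : ℕ), shellWeight h S K ≤ W) (k : ℕ)
    {I T s : ℝ≥0∞} (hs : s ≠ 0) (hs' : s ≠ ∞)
    (hev : ∀ D : Sample d n, (∀ i, (D i).1 ∈ unitCube d) → evidence h L ω D τ m ≠ 0)
    (hI : ∀ x : Fin n → Fin d → ℝ, (∀ i, x i ∈ unitCube d) →
      ∫⁻ D, (evidence h L ω D τ m)⁻¹ ∂condLaw κ x ≤ I)
    (hT : ∀ x : Fin n → Fin d → ℝ, (∀ i, x i ∈ unitCube d) →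
      ∫⁻ D, largeMass h L ω k D τ m ∂condLaw κ x ≤ T) :
    ∫⁻ D, posterior h L ω D τ (farSteps PX τ m a) ∂(Measure.pi fun _ : Fin n => PX ⊗ₘ κ)
      ≤ s⁻¹ * I + s * T + s * ∫⁻ D, smallMass h.variance W L ω a k PX τ m D
        ∂(Measure.pi fun _ : Fin n => PX ⊗ₘ κ) := by
  have hSm : Measurable (smallMass (n := n) h.variance W L ω a k PX τ m) :=
    measurable_smallMass hm _ _ _ _ _ _
  rw [← lintegral_const_mul _ hSm]
  refine lintegral_pi_compProd_le PX κ _ _ (hSm.const_mul s) _ ?_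
  filter_upwards [ae_pi_mem_unitCube hPX] with x hx
  calc ∫⁻ D, posterior h L ω D τ (farSteps PX τ m a) ∂condLaw κ x
      ≤ ∫⁻ D, (s * largeMass h L ω k D τ m + s * smallMass h.variance W L ω a k PX τ m D)
          + s⁻¹ * (evidence h L ω D τ m)⁻¹ ∂condLaw κ x := by
        refine lintegral_mono_ae ?_
        filter_upwards [ae_condLaw_fst κ x] with D hD
        have hDx : ∀ i, (D i).1 ∈ unitCube d := fun i => by rw [hD i]; exact hx i
        have hev := hev D hDx
        have := isProbabilityMeasure_posterior hτ hω hev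
        rw [← mul_add]
        exact le_mul_add_inv_mul prob_le_one
          (posterior_farSteps_le h hm hL hshell k hev) hs hs'
    _ = (s * ∫⁻ D, largeMass h L ω k D τ m ∂condLaw κ x
          + ∫⁻ D, s * smallMass h.variance W L ω a k PX τ m D ∂condLaw κ x)
          + s⁻¹ * ∫⁻ D, (evidence h L ω D τ m)⁻¹ ∂condLaw κ x := by
        have hLm := (aemeasurable_largeMass (τ := τ) (m := m) (κ := κ) h L ω k x).const_mul s
        have hsum : AEMeasurable (fun D => s * largeMass h L ω k D τ m +
            s * smallMass h.variance W L ω a k PX τ m D) (condLaw κ x) :=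
          hLm.add (hSm.const_mul s).aemeasurable
        -- The reciprocal evidence stands on the right of the sum because no measurability is
        -- available for it.
        rw [lintegral_add_left' hsum,
          lintegral_add_left' hLm, lintegral_const_mul' _ _ hs',
          lintegral_const_mul' s⁻¹ _ (ENNReal.inv_ne_top.2 hs)]
    _ ≤ (s * T + ∫⁻ D, s * smallMass h.variance W L ω a k PX τ m D ∂condLaw κ x) + s⁻¹ * I := by
        gcongr
        · exact hT x hx
        · exact hI x hx
    _ = _ := by ring

/-- Step functions that are far in the averaged `L²(PX)`-distance belong to `farSteps`. -/
theorem setOf_lt_quantileDist_subset {PX : Measure (Fin d → ℝ)} {μ₀ : (Fin d → ℝ) → ℝ → ℝ}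
    (hμ : ∀ᵐ x ∂PX, ∀ j, μ₀ x (τ j) = m x j) {ρ : ℝ} (hρ : 0 ≤ ρ) :
    {θ : StepParam (d + 1) | ENNReal.ofReal ρ < quantileDist PX τ μ₀ (stepQuantile θ)} ⊆
      farSteps PX τ m (ρ ^ 2) := by
  intro θ hθ _
  by_contra hle
  rw [not_lt] at hle
  have hθ' : ENNReal.ofReal ρ < quantileDist PX τ μ₀ (stepQuantile θ) := hθ
  refine absurd hθ' (not_lt.2 ?_)
  have hj : ∀ j, eLpNorm (fun x => μ₀ x (τ j) - stepQuantile θ x (τ j)) 2 PX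
      ≤ ENNReal.ofReal ρ := by
    intro j
    rw [eLpNorm_eq_lintegral_rpow_enorm_toReal (by norm_num) (by norm_num)]
    have h1 : ∫⁻ x, ‖μ₀ x (τ j) - stepQuantile θ x (τ j)‖ₑ ^ (2 : ℝ≥0∞).toReal ∂PX
        ≤ ENNReal.ofReal ρ ^ 2 := by
      rw [← ENNReal.ofReal_pow hρ]
      refine le_trans (lintegral_mono_ae ?_) hle
      filter_upwards [hμ] with x hx
      have h2 : ‖μ₀ x (τ j) - stepQuantile θ x (τ j)‖ₑ ^ (2 : ℝ≥0∞).toReal =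
          ENNReal.ofReal ((stepQuantile θ x (τ j) - m x j) ^ 2) := by
        rw [ENNReal.toReal_ofNat, ENNReal.rpow_two, Real.enorm_eq_ofReal_abs, hx j,
          ← ENNReal.ofReal_pow (abs_nonneg _), sq_abs]
        congr 1; ring
      rw [h2]
      exact Finset.single_le_sum
        (f := fun j => ENNReal.ofReal ((stepQuantile θ x (τ j) - m x j) ^ 2))
        (fun _ _ => zero_le) (Finset.mem_univ j)
    calc _ ≤ (ENNReal.ofReal ρ ^ 2) ^ (1 / (2 : ℝ≥0∞).toReal) :=
          ENNReal.rpow_le_rpow h1 (by simp)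
      _ = _ := by
          rw [← ENNReal.rpow_two, ← ENNReal.rpow_mul]; norm_num
  calc quantileDist PX τ μ₀ (stepQuantile θ)
      ≤ (r : ℝ≥0∞)⁻¹ * ∑ _j : Fin r, ENNReal.ofReal ρ := by
        rw [quantileDist]; gcongr with j; exact hj j
    _ = ((r : ℝ≥0∞)⁻¹ * r) * ENNReal.ofReal ρ := by simp [mul_assoc]
    _ ≤ 1 * ENNReal.ofReal ρ := by
        gcongr; exact ENNReal.inv_mul_le_one _
    _ = _ := one_mul _

end Posterior

/-! ### From the assumptions of the theorem to the regular model. -/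

section Model

variable {d r : ℕ} {κ : Kernel (Fin d → ℝ) ℝ} {τ : Fin r → ℝ}

/-- On the compact cube the Hölder condition gives continuity and boundedness at each level. Off the
cube nothing is known about the conditional quantile, so it is replaced by zero to be measurable and
bounded everywhere. -/
theorem exists_regularModel [IsMarkovKernel κ] (hτ : ∀ j, τ j ∈ Set.Ioo (0 : ℝ) 1)
    {ν : ℝ≥0} (hν : 0 < ν) (hHolder : ∃ L : ℝ≥0, HolderOnWith L ν
      (fun z : (Fin d → ℝ) × ℝ => condQuantile κ z.1 z.2) (unitCube d ×ˢ Set.Ioo (0 : ℝ) 1))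
    {f : (Fin d → ℝ) → ℝ → ℝ}
    (hf_dens : ∀ x ∈ unitCube d, κ x = volume.withDensity fun y => ENNReal.ofReal (f x y))
    (hf_bound : ∃ δ > (0 : ℝ), ∃ α > (0 : ℝ), ∃ A : ℝ, ∀ x ∈ unitCube d, ∀ j, ∀ y,
      |y - condQuantile κ x (τ j)| < δ → α < f x y ∧ f x y ≤ A) :
    ∃ (m : (Fin d → ℝ) → Fin r → ℝ) (δ α A M₀ H : ℝ), RegularModel κ τ m δ α A M₀ H ν ∧
      ∀ x ∈ unitCube d, ∀ j, condQuantile κ x (τ j) = m x j := by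
  classical
  obtain ⟨H, hH⟩ := hHolder
  obtain ⟨δ, hδ, α, hα, A, hA⟩ := hf_bound
  have hclosed : IsClosed (unitCube d) := isClosed_Icc
  have hcont : ∀ j, ContinuousOn (fun x => condQuantile κ x (τ j)) (unitCube d) := fun j =>
    (hH.continuousOn hν).comp (f := fun x : Fin d → ℝ => (x, τ j)) (by fun_prop)
      fun x hx => ⟨hx, hτ j⟩
  have hcomp : IsCompact (unitCube d) := isCompact_Icc
  choose M hM using fun j => hcomp.exists_bound_of_continuousOn (hcont j)
  let m : (Fin d → ℝ) → Fin r → ℝ := fun x j =>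
    (unitCube d).piecewise (fun x => condQuantile κ x (τ j)) (fun _ => 0) x
  have hmem : ∀ x ∈ unitCube d, ∀ j, condQuantile κ x (τ j) = m x j := fun x hx j =>
    (Set.piecewise_eq_of_mem (unitCube d) (fun x => condQuantile κ x (τ j)) (fun _ => 0) hx).symm
  refine ⟨m, δ, α, max A 1, ∑ j, |M j|, H, ⟨hτ, fun x hx j => ?_, ?_, fun x j => ?_,
    Finset.sum_nonneg fun _ _ => abs_nonneg _, H.2, hδ, hα, by positivity, hν, ?_⟩, hmem⟩
  · rw [← hmem x hx j]
    exact regularQuantile_of_density (hf_dens x hx) (hτ j) hδ hα fun y hy =>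
      ⟨(hA x hx j y hy).1, (hA x hx j y hy).2.trans (le_max_left _ _)⟩
  · exact measurable_pi_lambda _ fun j =>
      (hcont j).measurable_piecewise continuousOn_const hclosed.measurableSet
  · have hj : |M j| ≤ ∑ j, |M j| :=
      Finset.single_le_sum (f := fun j => |M j|) (fun _ _ => abs_nonneg _) (Finset.mem_univ j)
    by_cases hx : x ∈ unitCube d
    · rw [← hmem x hx j]
      exact ((hM j x hx).trans (le_abs_self _)).trans hj
    · have : m x j = 0 := Set.piecewise_eq_of_notMem _ _ _ hx
      rw [this, abs_zero]
      exact (abs_nonneg _).trans hj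
  · intro x hx x' hx' j j' ε hε hxx htt
    rw [← hmem x hx j, ← hmem x' hx' j', ← Real.dist_eq]
    have h1 := hH.dist_le (x := (x, τ j)) (y := (x', τ j')) ⟨hx, hτ j⟩ ⟨hx', hτ j'⟩
    refine h1.trans ?_
    gcongr
    rw [Prod.dist_eq]
    exact max_le ((dist_pi_le_iff hε).2 fun k => by rw [Real.dist_eq]; exact hxx k)
      (by rw [Real.dist_eq]; exact htt)

end Model

/-! ### Choice of the scale and the explicit bound for the evidence. -/

section Rates

variable {d r : ℕ} {κ : Kernel (Fin d → ℝ) ℝ} {τ : Fin r → ℝ}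
  {m : (Fin d → ℝ) → Fin r → ℝ} {δ α A M₀ H ν : ℝ}

/-- The balance behind the rate: at `x = n` the first factor is the number of cells, and the other
is the inverse squared approximation error up to constants. -/
theorem rpow_sq_mul_eq {x : ℝ} (hx : 0 < x) (hν : 0 < ν) (d : ℕ) :
    x ^ (((d : ℝ) + 1) / (2 * ν + d + 1)) * (x ^ (ν / (2 * ν + d + 1))) ^ 2 = x := by
  rw [← Real.rpow_natCast, ← Real.rpow_mul hx.le, ← Real.rpow_add hx]
  have : ((d : ℝ) + 1) / (2 * ν + d + 1) + ν / (2 * ν + d + 1) * ((2 : ℕ) : ℝ) = 1 := by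
    have : (0 : ℝ) < 2 * ν + d + 1 := by positivity
    push_cast
    field_simp
    ring
  rw [this, Real.rpow_one]

/-- A dyadic scale `2^(-a)` with `2^a` of the order `n^(1/(2ν+d+1))`. -/
theorem exists_dyadic_scale {n : ℕ} (hn : 1 ≤ n) (hν : 0 < ν) (hν1 : ν ≤ 1) (d : ℕ) :
    ∃ a : ℕ, ((2 ^ (a * (d + 1)) : ℕ) : ℝ) ≤ (n : ℝ) ^ (((d : ℝ) + 1) / (2 * ν + d + 1)) ∧
      (n : ℝ)⁻¹ ≤ ((1 / 2 : ℝ) ^ a) ^ ν ∧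
      n * (((1 / 2 : ℝ) ^ a) ^ ν) ^ 2 ≤ 4 * (n : ℝ) ^ (((d : ℝ) + 1) / (2 * ν + d + 1)) := by
  have hn1 : (1 : ℝ) ≤ n := by exact_mod_cast hn
  have hn0 : (0 : ℝ) < n := by linarith
  have hγ : (0 : ℝ) < 2 * ν + d + 1 := by positivity
  have hγ1 : (1 : ℝ) ≤ 2 * ν + d + 1 := by linarith [(Nat.cast_nonneg d : (0 : ℝ) ≤ d)]
  set b := (n : ℝ) ^ (1 / (2 * ν + d + 1)) with hb
  have hb1 : 1 ≤ b := Real.one_le_rpow hn1 (by positivity)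
  have hbn : b ≤ n := by
    conv_rhs => rw [← Real.rpow_one (n : ℝ)]
    refine Real.rpow_le_rpow_of_exponent_le hn1 ?_
    rwa [div_le_one hγ]
  -- `2^a ≤ b` bounds the number of cells and keeps `η` above `1/n`; `b < 2^(a+1)` makes the scale
  -- fine enough.
  obtain ⟨a, ha, ha'⟩ := exists_nat_pow_near hb1 (one_lt_two (α := ℝ))
  set y := (1 / 2 : ℝ) ^ a with hy
  have hy0 : 0 < y := by positivity
  have hy1 : y ≤ 1 := pow_le_one₀ (by norm_num) (by norm_num)
  have hy2 : y * 2 ^ a = 1 := by rw [hy, ← mul_pow]; norm_num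
  have hyb : y * b ≤ 2 := by
    rw [pow_succ] at ha'
    nlinarith
  refine ⟨a, ?_, ?_, ?_⟩
  · have hK : (n : ℝ) ^ (((d : ℝ) + 1) / (2 * ν + d + 1)) = b ^ (d + 1) := by
      rw [hb, ← Real.rpow_natCast, ← Real.rpow_mul hn0.le]
      congr 1; push_cast; ring
    rw [hK, pow_mul]
    push_cast
    gcongr
  · calc (n : ℝ)⁻¹ ≤ y := by
          rw [inv_le_iff_one_le_mul₀ hn0]; nlinarith
      _ = y ^ (1 : ℝ) := (Real.rpow_one y).symm
      _ ≤ y ^ ν := Real.rpow_le_rpow_of_exponent_ge hy0 hy1 hν1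
  · have hbν : b ^ ν = (n : ℝ) ^ (ν / (2 * ν + d + 1)) := by
      rw [hb, ← Real.rpow_mul hn0.le]; congr 1; ring
    have h2 : y ^ ν * b ^ ν ≤ 2 := by
      rw [← Real.mul_rpow hy0.le (by positivity)]
      calc (y * b) ^ ν ≤ 2 ^ ν := by gcongr
        _ ≤ 2 ^ (1 : ℝ) := Real.rpow_le_rpow_of_exponent_le (by norm_num) hν1
        _ = 2 := Real.rpow_one 2
    have h3 : (y ^ ν * b ^ ν) ^ 2 ≤ 4 := by
      have : 0 ≤ y ^ ν * b ^ ν := by positivity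
      nlinarith
    have hn' := rpow_sq_mul_eq hn0 hν d
    rw [← hbν] at hn'
    set K := (n : ℝ) ^ (((d : ℝ) + 1) / (2 * ν + d + 1))
    have hK0 : 0 ≤ K := by positivity
    calc (n : ℝ) * (y ^ ν) ^ 2 = K * (y ^ ν * b ^ ν) ^ 2 := by
          conv_lhs => rw [← hn']
          ring
      _ ≤ K * 4 := by gcongr
      _ = _ := mul_comm _ _

theorem rpow_mem_Icc {n : ℕ} (hn : 1 ≤ n) (hν : 0 < ν) (d : ℕ) :
    (n : ℝ) ^ (((d : ℝ) + 1) / (2 * ν + d + 1)) ∈ Set.Icc (1 : ℝ) n := by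
  have hn1 : (1 : ℝ) ≤ n := by exact_mod_cast hn
  refine ⟨Real.one_le_rpow hn1 (by positivity), ?_⟩
  conv_rhs => rw [← Real.rpow_one (n : ℝ)]
  refine Real.rpow_le_rpow_of_exponent_le hn1 ?_
  rw [div_le_one (by positivity)]
  linarith

theorem learning_rate_bounds {ω L R : ℝ} (hω : 0 ≤ ω) (hL : 1 ≤ L) (hωL : ω * L ^ 2 ≤ 1)
    (hR : 2 * R ≤ L) : ω ≤ 1 ∧ ω * (R * (2 * L)) ≤ 1 ∧ ω * R ≤ 1 := by
  have h1 : ω * 1 ≤ ω * L ^ 2 := mul_le_mul_of_nonneg_left (one_le_pow₀ hL) hω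
  have h2 : ω * L * (2 * R) ≤ ω * L * L := by gcongr
  have h3 : ω * L * 1 ≤ ω * L * L := by gcongr
  have h4 : ω * (2 * R) ≤ ω * L := by gcongr
  refine ⟨?_, ?_, ?_⟩
  · linarith
  · linarith
  · linarith [mul_nonneg hω (zero_le_one.trans hL)]

/-- Given the covariates, the inverse of the evidence is at most `exp(C n^((d+1)/(2ν+d+1)) log n)`
on average. -/
theorem exists_lintegral_inv_evidence_le_exp [IsMarkovKernel κ]
    (hm : RegularModel κ τ m δ α A M₀ H ν) (hν1 : ν ≤ 1) (hr : 0 < r) (h : PriorParams) :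
    ∃ C₃ ≥ (1 : ℝ), ∃ X₀ : ℝ, ∀ (n : ℕ) (L ω : ℝ), X₀ ≤ L → X₀ ≤ n → 0 ≤ ω → ω * L ^ 2 ≤ 1 →
      (∀ D : Sample d n, (∀ i, (D i).1 ∈ unitCube d) → evidence h L ω D τ m ≠ 0) ∧
      ∀ x : Fin n → Fin d → ℝ, (∀ i, x i ∈ unitCube d) →
        ∫⁻ D, (evidence h L ω D τ m)⁻¹ ∂condLaw κ x ≤ ENNReal.ofReal (Real.exp
          (C₃ * (n : ℝ) ^ (((d : ℝ) + 1) / (2 * ν + d + 1)) * Real.log n)) := by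
  obtain ⟨w, hw, _, _, hshell⟩ := exists_shellWeight_bounds h (d + 1)
  obtain ⟨g, hg, hgauss⟩ := exists_gaussianReal_Icc_ge h.variance_pos M₀
  have hA := hm.A_pos
  have hδ := hm.delta_pos
  have hH := hm.H_nonneg
  have hM := hm.M_nonneg
  have hrate := h.rate_pos
  set R : ℝ := ((r : ℝ) + 1) ^ (2 * (d + 1)) / (h.rate * g) with hR
  have hR0 : 0 ≤ R := by positivity
  set C₄ : ℝ := (A + 1 / δ + 1) * (4 * r * (1 + H) ^ 2 + 4 * (h.C : ℝ) ^ 2) with hC₄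
  have hC₄0 : 0 ≤ C₄ := by positivity
  -- Of the constant, `2d + 5` comes from the prior mass per cell, one from `w⁻¹ ≤ n`, and `C₄` from
  -- the excess loss.
  refine ⟨(2 * d + 6) + C₄, by linarith [(Nat.cast_nonneg d : (0 : ℝ) ≤ d)],
    3 + M₀ + 2 * r + (h.C : ℝ) ^ 2 + w⁻¹ + R, fun n L ω hXL hXn hω hωL => ?_⟩
  have hr0 : (0 : ℝ) ≤ r := Nat.cast_nonneg r
  have hCs : (0 : ℝ) ≤ (h.C : ℝ) ^ 2 := by positivity
  have hw' : 0 < w⁻¹ := inv_pos.2 hw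
  have hn3 : (3 : ℝ) ≤ n := by linarith
  have hn0 : (0 : ℝ) < n := by linarith
  have hn1 : 1 ≤ n := by
    have : (0 : ℝ) < n := hn0
    exact_mod_cast this
  have hL1 : 3 ≤ L := by linarith
  have hLr : 2 * (r : ℝ) ≤ L := by linarith
  obtain ⟨hω1, hω2, hω3⟩ := learning_rate_bounds hω (by linarith) hωL hLr
  have hlog : 1 ≤ Real.log n := by
    rw [Real.le_log_iff_exp_le hn0]
    linarith [Real.exp_one_lt_d9]
  obtain ⟨hK1, hKn⟩ := rpow_mem_Icc hn1 hm.nu_pos d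
  obtain ⟨a, haK, hηn, hη2⟩ := exists_dyadic_scale hn1 hm.nu_pos hν1 d
  set K := (n : ℝ) ^ (((d : ℝ) + 1) / (2 * ν + d + 1)) with hK
  set η := ((1 / 2 : ℝ) ^ a) ^ ν with hη
  set N := 2 ^ (a * (d + 1)) with hN
  have hN0 : (0 : ℝ) < N := by rw [hN]; positivity
  -- The powers of `n`: one for `N`, `2d + 2` for the number of codes of a cell, one for `η`, and
  -- one to absorb the constant `R`.
  set q : ℝ := ((n : ℝ) ^ (2 * d + 5))⁻¹ with hq
  have hq0 : 0 < q := by positivity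
  have hq1 : q ≤ 1 := inv_le_one_of_one_le₀ (one_le_pow₀ (by linarith))
  have hcard : h.C ^ 2 ≤ n * r := by
    have h1 : h.C ^ 2 ≤ n := by
      have : ((h.C ^ 2 : ℕ) : ℝ) ≤ n := by push_cast; linarith
      exact_mod_cast this
    exact h1.trans (Nat.le_mul_of_pos_right n hr)
  have hqle : q ≤ h.rate / (N : ℝ) / (((n * r + 1 : ℕ) : ℝ) ^ 2) ^ (d + 1) * (g * η) := by
    have hRn : R ≤ n := by linarith
    rw [hR, div_le_iff₀ (by positivity)] at hRn
    have h1 : ((n * r + 1 : ℕ) : ℝ) ≤ n * (r + 1) := by push_cast; linarith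
    calc q ≤ h.rate / n / ((n * (r + 1) : ℝ) ^ 2) ^ (d + 1) * (g * (n : ℝ)⁻¹) := by
          have h2 : h.rate / n / ((n * (r + 1) : ℝ) ^ 2) ^ (d + 1) * (g * (n : ℝ)⁻¹)
              = h.rate * g / (((r : ℝ) + 1) ^ (2 * (d + 1)) * (n : ℝ) ^ (2 * d + 4)) := by
            rw [← pow_mul, mul_pow]
            field_simp
            ring
          rw [h2, hq, inv_eq_one_div, div_le_div_iff₀ (by positivity) (by positivity), one_mul]
          calc ((r : ℝ) + 1) ^ (2 * (d + 1)) * (n : ℝ) ^ (2 * d + 4)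
              ≤ n * (h.rate * g) * (n : ℝ) ^ (2 * d + 4) := by gcongr
            _ = _ := by ring
      _ ≤ _ := by
          have hNn : (N : ℝ) ≤ n := haK.trans hKn
          gcongr
  have key := fun x hx => lintegral_inv_evidence_le hm h (n := n) (L := L) (ω := ω) (by linarith) hω
    hω2 hω3 hcard a hw (fun S K => (hshell S K).1) hg hgauss hq0 hq1
    hqle x hx
  refine ⟨fun D hD => (key (fun i => (D i).1) hD).1 D fun _ => rfl, fun x hx =>
    (key x hx).2.trans ?_⟩
  rw [← ENNReal.ofReal_inv_of_pos (by positivity), ← ENNReal.ofReal_mul (by positivity)]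
  refine ENNReal.ofReal_le_ofReal ?_
  have hnexp : Real.exp (Real.log n) = n := Real.exp_log hn0
  have hwinv : w⁻¹ ≤ Real.exp (Real.log n) := by rw [hnexp]; linarith
  have hqinv : (q ^ N)⁻¹ = Real.exp (N * ((2 * d + 5 : ℕ) * Real.log n)) := by
    rw [hq, Real.exp_nat_mul, Real.exp_nat_mul, hnexp, inv_pow, inv_inv]
  have hE : ω * (A + 1 / δ + 1) * (((n * r : ℕ) : ℝ) * ((1 + H) * η) ^ 2
      + ((h.C ^ 2 * N : ℕ) : ℝ) * (2 * L) ^ 2) ≤ C₄ * K := by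
    have h1 : ω * (r * (1 + H) ^ 2 * (n * η ^ 2)) ≤ 1 * (r * (1 + H) ^ 2 * (4 * K)) := by gcongr
    have h2 : 4 * (h.C : ℝ) ^ 2 * N * (ω * L ^ 2) ≤ 4 * (h.C : ℝ) ^ 2 * K * 1 := by gcongr
    calc _ = (A + 1 / δ + 1) * (ω * (r * (1 + H) ^ 2 * (n * η ^ 2))
          + 4 * (h.C : ℝ) ^ 2 * N * (ω * L ^ 2)) := by push_cast; ring
      _ ≤ (A + 1 / δ + 1) * (1 * (r * (1 + H) ^ 2 * (4 * K)) + 4 * (h.C : ℝ) ^ 2 * K * 1) := by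
          gcongr
      _ = _ := by rw [hC₄]; ring
  rw [mul_inv, hqinv]
  refine (mul_le_mul_of_nonneg_right (mul_le_mul_of_nonneg_right hwinv (Real.exp_pos _).le)
    (Real.exp_pos _).le).trans ?_
  rw [← Real.exp_add, ← Real.exp_add]
  refine Real.exp_le_exp.2 ((add_le_add_right hE _).trans ?_)
  have h3 : (N : ℝ) * ((2 * d + 5 : ℕ) * Real.log n) ≤ K * ((2 * d + 5 : ℕ) * Real.log n) := by
    gcongr
  have h4 : C₄ * K * 1 ≤ C₄ * K * Real.log n := by gcongr
  have h5 : 1 * Real.log n ≤ K * Real.log n := by gcongr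
  have h6 : ((2 * d + 5 : ℕ) : ℝ) = 2 * d + 5 := by push_cast; ring
  rw [h6] at h3 ⊢
  linarith

end Rates

/-! ### Exponents and the contraction bound. -/

/-- With Chernoff parameter `t = K`, itself a power of `n`, the factor `K^(-k)` is `exp(-κ₀ l k)`.
For `k ≥ B K` this beats the multiplier `exp(2 C₃ K l)` and the factor `exp(R K)`. -/
theorem exp_mul_tail_le {C₃ B κ₀ K l W R : ℝ} {k : ℕ} (hK0 : 0 ≤ K) (hK : K = Real.exp (κ₀ * l))
    (hl : 1 ≤ l) (hk : B * K ≤ k) (hB : 2 * C₃ + 1 + R ≤ κ₀ * B) (hκ : 0 ≤ κ₀) (hR : 0 ≤ R)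
    (hW : 0 ≤ W) :
    Real.exp (2 * C₃ * K * l) * (W * (K ^ k)⁻¹ * Real.exp (R * K)) ≤ W * Real.exp (-(K * l)) := by
  have hpow : (K ^ k)⁻¹ = Real.exp (-(k * (κ₀ * l))) := by
    conv_lhs => rw [hK]
    rw [← Real.exp_nat_mul, Real.exp_neg]
  have hl0 : 0 ≤ l := by linarith
  have h1 : κ₀ * l * (B * K) ≤ κ₀ * l * k := by gcongr
  have h2 : (2 * C₃ + 1 + R) * (K * l) ≤ κ₀ * B * (K * l) := by gcongr
  have h3 : R * K * 1 ≤ R * K * l := by gcongr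
  calc _ = W * Real.exp (2 * C₃ * K * l + -(k * (κ₀ * l)) + R * K) := by
        rw [hpow, Real.exp_add, Real.exp_add]; ring
    _ ≤ _ := by
        gcongr
        linarith

/-- The multiplier, the number of codes and the named observations together cost `O(K l)`, while at
least half of the sample contributes decay, in total at least `c₁ L K l / 2`. -/
theorem exp_mul_small_le {C₃ B D c₁ K l L b n N : ℝ} {k : ℕ} (hB : 0 ≤ B)
    (hD : 0 ≤ D) (hK : 0 ≤ K) (hl : 1 ≤ l) (hN0 : 0 ≤ N) (hN : N ≤ Real.exp (4 * D * l))
    (hk : k ≤ B * K) (hk' : 2 * D * k ≤ n / 2) (hb0 : 0 ≤ b) (hb : c₁ * L * K * l ≤ b * n)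
    (hL : 2 * (2 * C₃ + 1 + B * (6 * D + 1)) ≤ c₁ * L) :
    Real.exp (2 * C₃ * K * l) * (k * (N ^ k * Real.exp (2 * D * k - b * (n - 2 * D * k))))
      ≤ Real.exp (-(K * l)) := by
  have hkexp : (k : ℝ) ≤ Real.exp k := by linarith [Real.add_one_le_exp (k : ℝ)]
  have hNk : N ^ k ≤ Real.exp (k * (4 * D * l)) := by
    rw [Real.exp_nat_mul]
    gcongr
  calc _ ≤ Real.exp (2 * C₃ * K * l) * (Real.exp k * (Real.exp (k * (4 * D * l)) *
        Real.exp (2 * D * k - b * (n - 2 * D * k)))) := by gcongr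
    _ = Real.exp (2 * C₃ * K * l + (k + (k * (4 * D * l) +
        (2 * D * k - b * (n - 2 * D * k))))) := by simp only [Real.exp_add]
    _ ≤ _ := by
        refine Real.exp_le_exp.2 ?_
        have h1 : b * (n / 2) ≤ b * (n - 2 * D * k) := by gcongr; linarith
        have h2 : 2 * (2 * C₃ + 1 + B * (6 * D + 1)) * (K * l) ≤ c₁ * L * (K * l) := by
          gcongr
        have h3 : (k : ℝ) * (4 * D * l) ≤ B * K * (4 * D * l) := by
          have : 0 ≤ 4 * D * l := by nlinarith
          gcongr
        have h4 : (1 + 2 * D) * k * 1 ≤ (1 + 2 * D) * (B * K) * l := by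
          have : 0 ≤ B * K := by positivity
          gcongr
        linarith

/-- With `L = log^p n` the right side is `K L⁴ l`: of the four powers of `L`, two offset `ω`, one
offsets the curvature constant of order `1/L`, and one is spare. -/
theorem natCast_mul_rate_sq {n : ℕ} (hn : 1 ≤ n) {ν : ℝ} (hν : 0 < ν) (d : ℕ) (p : ℝ)
    (hl : 0 < Real.log n) :
    n * rate d ν p n ^ 2 =
      (n : ℝ) ^ (((d : ℝ) + 1) / (2 * ν + d + 1)) * (Real.log n ^ p) ^ 4 * Real.log n := by
  have hn0 : (0 : ℝ) < n := by exact_mod_cast hn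
  have h1 : (Real.log n ^ (2 * p + 1 / 2)) ^ 2 = (Real.log n ^ p) ^ 4 * Real.log n := by
    rw [← Real.rpow_natCast, ← Real.rpow_mul hl.le, ← Real.rpow_natCast, ← Real.rpow_mul hl.le,
      ← Real.rpow_add_one hl.ne']
    congr 1
    push_cast
    ring
  have h2 := rpow_sq_mul_eq hn0 hν d
  set y := (n : ℝ) ^ (ν / (2 * ν + d + 1)) with hy
  have hy0 : 0 < y := by positivity
  rw [rate, mul_pow, h1, Real.rpow_neg hn0.le, ← hy]
  set K := (n : ℝ) ^ (((d : ℝ) + 1) / (2 * ν + d + 1))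
  calc n * (y⁻¹ ^ 2 * ((Real.log n ^ p) ^ 4 * Real.log n))
      = K * y ^ 2 * (y⁻¹ ^ 2 * ((Real.log n ^ p) ^ 4 * Real.log n)) := by rw [h2]
    _ = _ := by field_simp

section Contraction

variable {d r : ℕ} {κ : Kernel (Fin d → ℝ) ℝ} {τ : Fin r → ℝ}
  {m : (Fin d → ℝ) → Fin r → ℝ} {δ α A M₀ H ν : ℝ}

theorem exists_shellWeight_le (h : PriorParams) (m : ℕ) :
    ∃ W > (0 : ℝ), ∀ (S : Finset (Fin m)) (K : ℕ),
      shellWeight h S K ≤ W * (h.rate ^ K / K.factorial) ∧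
        shellWeight h S K ≤ W * Real.exp h.rate := by
  obtain ⟨_, _, W, hW, hshell⟩ := exists_shellWeight_bounds h m
  refine ⟨W, hW, fun S K => ⟨(hshell S K).2, (hshell S K).2.trans ?_⟩⟩
  gcongr
  exact Real.pow_div_factorial_le_exp _ h.rate_pos.le K

set_option maxHeartbeats 1000000 in
/-- The expected posterior mass of the step functions at distance at least the rate. -/
theorem exists_lintegral_posterior_farSteps_le [IsMarkovKernel κ] {PX : Measure (Fin d → ℝ)}
    [IsProbabilityMeasure PX] (hPX : ∀ᵐ x ∂PX, x ∈ unitCube d)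
    (hm : RegularModel κ τ m δ α A M₀ H ν) (hν1 : ν ≤ 1) (hr : 0 < r) (h : PriorParams) {c p : ℝ}
    (hc : 0 < c) :
    ∃ C X₀ : ℝ, ∀ (n : ℕ) (L ω ρ : ℝ), L = Real.log n ^ p → X₀ ≤ L → X₀ ≤ n →
      X₀ * (n : ℝ) ^ (((d : ℝ) + 1) / (2 * ν + d + 1)) ≤ n → 0 ≤ ω → ω * L ^ 2 ≤ 1 →
      c ≤ ω * L ^ 2 → rate d ν p n ≤ ρ →
      (∀ D : Sample d n, (∀ i, (D i).1 ∈ unitCube d) → evidence h L ω D τ m ≠ 0) ∧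
      ∫⁻ D, posterior h L ω D τ (farSteps PX τ m (ρ ^ 2))
        ∂(Measure.pi fun _ : Fin n => PX ⊗ₘ κ) ≤ ENNReal.ofReal (C / n) := by
  obtain ⟨C₃, hC₃, X₁, hinv⟩ := exists_lintegral_inv_evidence_le_exp hm hν1 hr h
  obtain ⟨W, hW, hshell⟩ := exists_shellWeight_le h (d + 1)
  have hα := hm.alpha_pos
  have hδ := hm.delta_pos
  have hM := hm.M_nonneg
  have hν := hm.nu_pos
  have hrate := h.rate_pos
  set κ₀ : ℝ := ((d : ℝ) + 1) / (2 * ν + d + 1) with hκ₀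
  have hκ0 : 0 < κ₀ := by positivity
  -- `B K` is the cut between small and large trees; `κ₀ B` is exactly the exponent required by the
  -- Poisson tail.
  set B : ℝ := (2 * C₃ + 1 + h.rate) / κ₀ with hB
  have hB0 : 0 ≤ B := by positivity
  set c₁ : ℝ := α * δ / 32 * c with hc₁
  have hc₁0 : 0 < c₁ := by positivity
  have hr0 : (0 : ℝ) ≤ r := Nat.cast_nonneg r
  -- The threshold which the spare factor `L` must exceed to beat the cost of the codes.
  set Z : ℝ := 2 * (2 * C₃ + 1 + (B + 1) * (6 * ((d : ℝ) + 1) + 1)) / c₁ with hZ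
  have hZ0 : 0 ≤ Z := by positivity
  set C : ℝ := 1 + 2 ^ (d + 1) * W + 2 ^ (d + 1) * (W * Real.exp h.rate) with hC
  refine ⟨C, |X₁| + 3 + M₀ + 2 * r + δ + 16 * r / (α * δ) + α * δ * r + Z
    + 4 * ((d : ℝ) + 1) * (B + 1), fun n L ω ρ hLp hXL hXn hXK hω hωL hcω hρ => ?_⟩
  set X₀ : ℝ := |X₁| + 3 + M₀ + 2 * r + δ + 16 * r / (α * δ) + α * δ * r + Z
    + 4 * ((d : ℝ) + 1) * (B + 1) with hX₀
  have e1 : 0 ≤ |X₁| := abs_nonneg _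
  have e2 : 0 ≤ 16 * r / (α * δ) := by positivity
  have e3 : 0 ≤ α * δ * r := by positivity
  have e4 : 0 ≤ 4 * ((d : ℝ) + 1) * (B + 1) := by positivity
  have hX₁ : X₁ ≤ X₀ := by linarith [le_abs_self X₁]
  have hL1 : 1 ≤ L := by linarith
  have hL0 : 0 < L := by linarith
  have hn3 : (3 : ℝ) ≤ n := by linarith
  have hn0 : (0 : ℝ) < n := by linarith
  have hn1 : 1 ≤ n := by exact_mod_cast hn0
  have hlog : 1 ≤ Real.log n := by
    rw [Real.le_log_iff_exp_le hn0]
    linarith [Real.exp_one_lt_d9]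
  obtain ⟨-, hω2, -⟩ := learning_rate_bounds hω hL1 hωL (R := r) (by linarith)
  have hω3 : ω * r ≤ α * δ / (16 * L) := by
    have : 16 * r / (α * δ) ≤ L := by linarith
    rw [div_le_iff₀ (by positivity)] at this
    rw [le_div_iff₀ (by positivity)]
    have h1 : ω * L * (16 * r) ≤ ω * L * (L * (α * δ)) := by gcongr
    have h2 : ω * L ^ 2 * (α * δ) ≤ 1 * (α * δ) := by gcongr
    linarith
  have hω4 : ω * (α * δ / (16 * L)) * (r * (2 * L) ^ 2) ≤ 1 := by
    have h1 : ω * L * (α * δ * r) ≤ ω * L * L := by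
      gcongr
      linarith
    have h2 : ω * (α * δ / (16 * L)) * (r * (2 * L) ^ 2) = ω * L * (α * δ * r) / 4 := by
      field_simp
      ring
    rw [h2]
    linarith [mul_nonneg hω hL0.le]
  obtain ⟨hev, hI⟩ := hinv n L ω (by linarith) (by linarith) hω hωL
  refine ⟨hev, ?_⟩
  obtain ⟨hK1, -⟩ := rpow_mem_Icc hn1 hν d
  rw [← hκ₀] at hK1
  have hKexp : (n : ℝ) ^ κ₀ = Real.exp (κ₀ * Real.log n) := by
    rw [Real.rpow_def_of_pos hn0, mul_comm]
  have hrate2 := natCast_mul_rate_sq hn1 hν d p (by linarith)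
  rw [← hLp, ← hκ₀] at hrate2
  set K := (n : ℝ) ^ κ₀ with hK
  set l := Real.log n with hl
  have hK0 : 0 ≤ K := by linarith
  set k := ⌈B * K⌉₊ with hk
  have hk1 : B * K ≤ k := Nat.le_ceil _
  have hk2 : (k : ℝ) ≤ (B + 1) * K := by
    have := Nat.ceil_lt_add_one (mul_nonneg hB0 hK0)
    linarith
  have hsmall := lintegral_smallMass_le (n := n) hPX hm (L := L) (ω := ω) (by linarith)
    (by linarith) hω hω2 hω3 hω4 h.variance (sq_nonneg ρ) (W * Real.exp h.rate) k
  have hlarge := lintegral_largeMass_le (n := n) hm h (L := L) (ω := ω) (by linarith)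
    (by linarith) hω hω2 hω3 hW.le (fun S K => (hshell S K).1) hK1 k
  -- With this `s` the evidence term becomes `exp(-C₃ K l)`, while both numerator bounds have to
  -- gain `exp(-2 C₃ K l)`.
  have hmain := lintegral_posterior_farSteps_le hPX hm.level hm.measurable h (L := L) (ω := ω)
    (a := ρ ^ 2) hL0.le hω (fun S K => (hshell S K).2) k
    (s := ENNReal.ofReal (Real.exp (2 * C₃ * K * l)))
    (by simpa using Real.exp_pos _) ENNReal.ofReal_ne_top hev hI hlarge
  refine hmain.trans ?_
  -- Since `K ≥ 1`; this is the source of the final `C/n`.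
  have hexp : Real.exp (-(K * l)) ≤ 1 / n := by
    rw [one_div, ← Real.exp_log hn0, ← Real.exp_neg, ← hl]
    exact Real.exp_le_exp.2 (neg_le_neg (le_mul_of_one_le_left (by linarith) hK1))
  have h1 : (ENNReal.ofReal (Real.exp (2 * C₃ * K * l)))⁻¹ * ENNReal.ofReal (Real.exp (C₃ * K * l))
      ≤ ENNReal.ofReal (1 / n) := by
    rw [← ENNReal.ofReal_inv_of_pos (Real.exp_pos _), ← ENNReal.ofReal_mul (by positivity),
      ← Real.exp_neg, ← Real.exp_add]
    refine ENNReal.ofReal_le_ofReal (le_trans (Real.exp_le_exp.2 ?_) hexp)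
    have : 1 * (K * l) ≤ C₃ * (K * l) := by gcongr
    linarith
  have h2pow : (2 : ℝ≥0∞) ^ (d + 1) = ENNReal.ofReal (2 ^ (d + 1)) := by
    rw [ENNReal.ofReal_pow (by norm_num), ENNReal.ofReal_ofNat]
  have h2 : ENNReal.ofReal (Real.exp (2 * C₃ * K * l)) * (2 ^ (d + 1) *
      ENNReal.ofReal (W * (K ^ k)⁻¹ * Real.exp (h.rate * K)))
      ≤ ENNReal.ofReal (2 ^ (d + 1) * W / n) := by
    rw [h2pow, mul_left_comm, ← ENNReal.ofReal_mul (by positivity),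
      ← ENNReal.ofReal_mul (by positivity)]
    refine ENNReal.ofReal_le_ofReal ?_
    have := exp_mul_tail_le (C₃ := C₃) (k := k) hK0 hKexp hlog hk1
      (by rw [hB, mul_div_cancel₀ _ hκ0.ne']) hκ0.le hrate.le hW.le
    calc _ ≤ 2 ^ (d + 1) * (W * (1 / n)) := mul_le_mul_of_nonneg_left
          (this.trans (mul_le_mul_of_nonneg_left hexp hW.le)) (by positivity)
      _ = _ := by ring
  have h3 : ENNReal.ofReal (Real.exp (2 * C₃ * K * l)) *
      ∫⁻ D, smallMass h.variance (W * Real.exp h.rate) L ω (ρ ^ 2) k PX τ m D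
        ∂(Measure.pi fun _ : Fin n => PX ⊗ₘ κ)
      ≤ ENNReal.ofReal (2 ^ (d + 1) * (W * Real.exp h.rate) / n) := by
    set N : ℕ := ((n * r + 1) ^ 2) ^ (d + 1) with hN
    have hnr : ((n * r + 1 : ℕ) : ℝ) ≤ n ^ 2 := by
      have : (n : ℝ) * (2 * r) ≤ n * n := by
        gcongr
        linarith
      have : (3 : ℝ) * n ≤ n * n := by gcongr
      push_cast
      linarith
    have hNle : (N : ℝ) ≤ Real.exp (4 * ((d : ℝ) + 1) * l) := by
      have hexp4 : Real.exp (4 * ((d : ℝ) + 1) * l) = (((n : ℝ) ^ 2) ^ 2) ^ (d + 1) := by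
        rw [← pow_mul, ← pow_mul, ← Real.exp_log hn0, ← hl, ← Real.exp_nat_mul]
        congr 1
        push_cast
        ring
      rw [hexp4, hN, Nat.cast_pow, Nat.cast_pow]
      gcongr
    have hkn : 2 * ((d : ℝ) + 1) * k ≤ n / 2 := by
      have h5 : 4 * ((d : ℝ) + 1) * (B + 1) * K ≤ X₀ * K := by
        gcongr
        linarith
      have h6 : 2 * ((d : ℝ) + 1) * k ≤ 2 * ((d : ℝ) + 1) * ((B + 1) * K) := by gcongr
      linarith
    -- `ω` is at least `c L⁻²` and `n ρ²` at least `K L⁴ l`, so one power of `L` survives the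
    -- division by `32 L`.
    have hb : c₁ * L * K * l ≤ ω * (α * δ / (32 * L)) * ρ ^ 2 * n := by
      have h0 : 0 ≤ rate d ν p n := by
        have : 0 ≤ l := by linarith
        rw [rate]
        positivity
      calc c₁ * L * K * l = α * δ / 32 * L * K * l * c := by rw [hc₁]; ring
        _ ≤ α * δ / 32 * L * K * l * (ω * L ^ 2) := by gcongr
        _ = ω * (α * δ / (32 * L)) * (K * L ^ 4 * l) := by field_simp
        _ = ω * (α * δ / (32 * L)) * (n * rate d ν p n ^ 2) := by rw [hrate2]
        _ ≤ ω * (α * δ / (32 * L)) * (n * ρ ^ 2) := by gcongr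
        _ = _ := by ring
    have hZL : 2 * (2 * C₃ + 1 + (B + 1) * (6 * ((d : ℝ) + 1) + 1)) ≤ c₁ * L := by
      have : Z ≤ L := by linarith
      rwa [hZ, div_le_iff₀' hc₁0] at this
    have hreal := exp_mul_small_le (k := k) (N := N) (by linarith) (by positivity)
      hK0 hlog (Nat.cast_nonneg N) hNle hk2 hkn (by positivity) hb hZL
    have hcast : ((2 * (d + 1) * k : ℕ) : ℝ) = 2 * ((d : ℝ) + 1) * k := by push_cast; ring
    rw [hcast] at hsmall
    refine (mul_le_mul_right hsmall _).trans ?_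
    rw [h2pow, ← ENNReal.ofReal_natCast k, ← ENNReal.ofReal_natCast (N ^ k),
      ← ENNReal.ofReal_mul (by positivity), ← ENNReal.ofReal_mul (by positivity),
      ← ENNReal.ofReal_mul (by positivity), ← ENNReal.ofReal_mul (by positivity),
      ← ENNReal.ofReal_mul (by positivity)]
    refine ENNReal.ofReal_le_ofReal ?_
    calc _ = 2 ^ (d + 1) * (W * Real.exp h.rate) * (Real.exp (2 * C₃ * K * l) *
          (k * ((N : ℝ) ^ k * Real.exp (2 * ((d : ℝ) + 1) * k - ω * (α * δ / (32 * L)) * ρ ^ 2 *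
            (n - 2 * ((d : ℝ) + 1) * k))))) := by push_cast; ring
      _ ≤ 2 ^ (d + 1) * (W * Real.exp h.rate) * (1 / n) := by
          gcongr
          exact hreal.trans hexp
      _ = _ := by ring
  refine (add_le_add (add_le_add h1 h2) h3).trans ?_
  rw [← ENNReal.ofReal_add (by positivity) (by positivity),
    ← ENNReal.ofReal_add (by positivity) (by positivity), hC, add_div, add_div]

end Contraction

end IQBART

/-! ### The theorem. -/

theorem theorem1 (d r : ℕ) (hd : 0 < d) (hr : 0 < r)
    -- the law of `(X, Y)`: covariates in `[0,1]^d`, conditional law `κ` of `Y` given `X`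
    (PX : Measure (Fin d → ℝ)) [IsProbabilityMeasure PX]
    (hPX : ∀ᵐ x ∂PX, x ∈ IQBART.unitCube d)
    (κ : Kernel (Fin d → ℝ) ℝ) [IsMarkovKernel κ]
    -- the sampled quantile levels
    (τ : Fin r → ℝ) (hτ : ∀ j, τ j ∈ Set.Ioo (0 : ℝ) 1)
    -- the conditional quantile function is `ν`-Hölder
    (ν : ℝ≥0) (hν : 0 < ν) (hν1 : ν ≤ 1)
    (hHolder : ∃ L : ℝ≥0, HolderOnWith L ν
      (fun z : (Fin d → ℝ) × ℝ => IQBART.condQuantile κ z.1 z.2)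
      (IQBART.unitCube d ×ˢ Set.Ioo (0 : ℝ) 1))
    -- conditional densities, bounded away from zero and infinity near the quantiles
    (f : (Fin d → ℝ) → ℝ → ℝ) (hf_meas : ∀ x ∈ IQBART.unitCube d, Measurable (f x))
    (hf_nonneg : ∀ x ∈ IQBART.unitCube d, ∀ y, 0 ≤ f x y)
    (hf_dens : ∀ x ∈ IQBART.unitCube d,
      κ x = volume.withDensity fun y => ENNReal.ofReal (f x y))
    (hf_bound : ∃ δ > (0 : ℝ), ∃ α > (0 : ℝ), ∃ A : ℝ, ∀ x ∈ IQBART.unitCube d, ∀ j, ∀ y,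
      |y - IQBART.condQuantile κ x (τ j)| < δ → α < f x y ∧ f x y ≤ A)
    -- the prior, its truncation level `(log n)^p` and the learning rate
    (h : IQBART.PriorParams) (p : ℝ) (hp : 0 < p)
    (ω : ℕ → ℝ)
    (hω : ∀ᶠ n : ℕ in atTop, 0 < ω n ∧ ω n < 1 / 2 * Real.log n ^ (-(2 * p)))
    (hω_lower : ∃ c > (0 : ℝ), ∀ᶠ n : ℕ in atTop, c * Real.log n ^ (-(2 * p)) ≤ ω n)
    (M : ℕ → ℝ) (hM : Tendsto M atTop atTop) :
    (∀ᶠ n : ℕ in atTop, ∀ᵐ D ∂(Measure.pi fun _ : Fin n => PX ⊗ₘ κ),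
      IsProbabilityMeasure (IQBART.posterior h (Real.log n ^ p) (ω n) D τ)) ∧
    Tendsto (fun n : ℕ =>
      ∫⁻ D, IQBART.posterior h (Real.log n ^ p) (ω n) D τ
          {θ | ENNReal.ofReal (M n * IQBART.rate d ν p n) <
            IQBART.quantileDist PX τ (IQBART.condQuantile κ) (IQBART.stepQuantile θ)}
        ∂(Measure.pi fun _ : Fin n => PX ⊗ₘ κ))
      atTop (𝓝 0) := by
  have hν' : (0 : ℝ) < ν := hν
  obtain ⟨m, δ, α, A, M₀, H, hm, hmq⟩ := IQBART.exists_regularModel hτ hν hHolder hf_dens hf_bound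
  obtain ⟨c, hc, hcω⟩ := hω_lower
  obtain ⟨C, X₀, hfix⟩ := IQBART.exists_lintegral_posterior_farSteps_le hPX hm
    (by exact_mod_cast hν1) hr h (p := p) hc
  have hlog : Tendsto (fun n : ℕ => Real.log n) atTop atTop :=
    Real.tendsto_log_atTop.comp tendsto_natCast_atTop_atTop
  have hall : ∀ᶠ n : ℕ in atTop, 0 ≤ ω n ∧ 0 ≤ M n * IQBART.rate d ν p n ∧
      (∀ D : IQBART.Sample d n, (∀ i, (D i).1 ∈ IQBART.unitCube d) →
        IQBART.evidence h (Real.log n ^ p) (ω n) D τ m ≠ 0) ∧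
      ∫⁻ D, IQBART.posterior h (Real.log n ^ p) (ω n) D τ
        (IQBART.farSteps PX τ m ((M n * IQBART.rate d ν p n) ^ 2))
        ∂(Measure.pi fun _ : Fin n => PX ⊗ₘ κ) ≤ ENNReal.ofReal (C / n) := by
    have hK : ∀ᶠ n : ℕ in atTop,
        X₀ * (n : ℝ) ^ (((d : ℝ) + 1) / (2 * ν + d + 1)) ≤ n := by
      have h1 : Tendsto (fun n : ℕ => (n : ℝ) ^ ((ν : ℝ) / (2 * ν + d + 1))) atTop atTop :=
        (tendsto_rpow_atTop (by positivity)).comp tendsto_natCast_atTop_atTop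
      -- `n` is the number of cells times the square of `n^(ν/(2ν+d+1))`, which tends to infinity.
      filter_upwards [h1.eventually_ge_atTop X₀, h1.eventually_ge_atTop 1, eventually_gt_atTop 0]
        with n hX h1 hn
      have hn0 : (0 : ℝ) < n := by exact_mod_cast hn
      conv_rhs => rw [← IQBART.rpow_sq_mul_eq hn0 hν' d]
      rw [mul_comm]
      gcongr
      nlinarith
    filter_upwards [hω, hcω, hK, hlog.eventually_gt_atTop 0,
      ((tendsto_rpow_atTop hp).comp hlog).eventually_ge_atTop X₀,
      tendsto_natCast_atTop_atTop.eventually_ge_atTop X₀, hM.eventually_ge_atTop 1]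
      with n hω hcω hK hl hL hn hM
    have hL2 : Real.log n ^ (-(2 * p)) * (Real.log n ^ p) ^ 2 = 1 := by
      rw [← Real.rpow_natCast, ← Real.rpow_mul hl.le, ← Real.rpow_add hl]
      have : -(2 * p) + p * ((2 : ℕ) : ℝ) = 0 := by push_cast; ring
      rw [this, Real.rpow_zero]
    have hsq : 0 ≤ (Real.log n ^ p) ^ 2 := sq_nonneg _
    have hrate : 0 ≤ IQBART.rate d ν p n := by
      rw [IQBART.rate]
      positivity
    have hup := mul_le_mul_of_nonneg_right hω.2.le hsq
    have hlow := mul_le_mul_of_nonneg_right hcω hsq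
    rw [mul_assoc, hL2] at hup hlow
    -- The bound holds at every radius above the rate, so `M n ≥ 1` suffices.
    exact ⟨hω.1.le, mul_nonneg (by linarith) hrate, hfix n _ (ω n) _ rfl hL hn hK hω.1.le
      (by linarith) (by linarith) (le_mul_of_one_le_left hrate hM)⟩
  refine ⟨?_, ?_⟩
  · filter_upwards [hall] with n hn
    filter_upwards [IQBART.ae_sample_mem_unitCube hPX] with D hD
    exact IQBART.isProbabilityMeasure_posterior hτ hn.1 (hn.2.2.1 D hD)
  · have hlim : Tendsto (fun n : ℕ => ENNReal.ofReal (C / n)) atTop (𝓝 0) := by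
      rw [← ENNReal.ofReal_zero]
      exact ENNReal.tendsto_ofReal (tendsto_const_div_atTop_nhds_zero_nat C)
    refine tendsto_of_tendsto_of_tendsto_of_le_of_le' tendsto_const_nhds hlim
      (Eventually.of_forall fun _ => zero_le) ?_
    filter_upwards [hall] with n hn
    refine (lintegral_mono fun D => measure_mono ?_).trans hn.2.2.2
    exact IQBART.setOf_lt_quantileDist_subset (hPX.mono hmq) hn.2.1
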